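/- Let $Z$ be a real random variable with finite moments of all orders. For each $\sigma_N>0$ let $N\sim\mathcal N(0,\sigma_N^2)$ be independent of $Z$ (natural logarithms throughout), and put $Y=Z+N$, $\mu=\mathbb E Y$, $\sigma^2=\mathrm{Var}(Y)=\sigma_N^2+\mathrm{Var}(Z)$ with $\sigma>0$. Let $Y^*\sim\mathcal N(\mu,\sigma^2)$, let $f$ be the density of $(Y-\mu)/\sigma$ and $g$ the standard Gaussian density. Let $\kappa_k=\kappa_k(Z)$ be the cumulants of $Z$, defined by $\kappa_k = i^{-k}\,\frac{d^k}{dt^k}\log \mathbb E(e^{itZ})\big|_{t=0}$, and define the modified moments by $\widetilde m_0=1$, $\widetilde m_1=\widetilde m_2=0$ and $\widetilde m_k=\kappa_k+\sum_{j=3}^{k-3}\binom{k-1}{j}\widetilde m_j\,\kappa_{k-j}$ for $k\ge 3$. Then, for every $\sigma_N>0$, $\kappa_k(Y)=\kappa_k$ for all $k\ge 3$, and the Kullback-Leibler divergence $D(Y\|Y^*)$ is finite and equals $D(f\|g)$. As $\sigma_N\to\infty$, $$ \begin{aligned} D(Y\|Y^*) &= \frac{\widetilde m_3^2}{12\sigma^6}+\frac{\widetilde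 m_4^2}{48\sigma^8}+\frac{\widetilde m_5^2}{240\sigma^{10}}-\frac{\widetilde m_3^2\widetilde m_4}{8\sigma^{10}}+\frac{\widetilde m_6^2}{1440\sigma^{12}}-\frac{\widetilde m_4^3}{48\sigma^{12}}-\frac{\widetilde m_3\widetilde m_4\widetilde m_5}{12\sigma^{12}}-\frac{\widetilde m_3^2\widetilde m_6}{72\sigma^{12}}+\frac{31\,\widetilde m_3^4}{144\sigma^{12}}+O\Bigl(\frac1{\sigma^{14}}\Bigr)\\ &= \frac{\kappa_3^2}{12\sigma^6}+\frac{\kappa_4^2}{48\sigma^8}-\frac{\kappa_3^2\kappa_4}{8\sigma^{10}}+\frac{\kappa_5^2}{240\sigma^{10}}+\frac{7\kappa_3^4}{48\sigma^{12}}-\frac{\kappa_4^3}{48\sigma^{12}}-\frac{\kappa_3\kappa_4\kappa_5}{12\sigma^{12}}+\frac{\kappa_6^2}{1440\sigma^{12}}+O\Bigl(\frac1{\sigma^{14}}\Bigr). \end{aligned} $$ Moreover, for every $\sigma_N>0$ the differential entropies $h(Y)$ and $h(Y^*)$ are well defined, $h(Y^*)=\frac12\log(2\pi e\sigma^2)$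 and $D(Y\|Y^*)=h(Y^*)-h(Y)$; hence, as $\sigma_N\to\infty$, $$ h(Y)=\frac12\log(2\pi e\sigma^2)-\frac{\kappa_3^2}{12\sigma^6}-\frac{\kappa_4^2}{48\sigma^8}+\frac{\kappa_3^2\kappa_4}{8\sigma^{10}}-\frac{\kappa_5^2}{240\sigma^{10}}-\frac{7\kappa_3^4}{48\sigma^{12}}+\frac{\kappa_4^3}{48\sigma^{12}}+\frac{\kappa_3\kappa_4\kappa_5}{12\sigma^{12}}-\frac{\kappa_6^2}{1440\sigma^{12}}+O\Bigl(\frac1{\sigma^{14}}\Bigr). $$ -/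

import Mathlib

open MeasureTheory ProbabilityTheory InformationTheory Filter Asymptotics
open scoped ENNReal NNReal

noncomputable section

/-- The `k`-th cumulant of a real random variable `X`: the coefficient of `(i t) ^ k / k!` in the
Taylor expansion at `0` of the logarithm of the characteristic function `t ↦ E[exp (i t X)]`,
that is `i ^ (-k)` times its `k`-th derivative at `0`. (The characteristic function equals `1` at
`0`, so the principal logarithm is the right branch there; the coefficient is a real number.) -/
def cumulant {Ω : Type*} [MeasurableSpace Ω] (X : Ω → ℝ) (P : Measure Ω) (k : ℕ) : ℝ :=
  (iteratedDeriv k (fun t : ℝ => Complex.log (charFun (P.map X) t)) 0 / Complex.I ^ k).re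

/-- The modified moments `m k` built from cumulants `κ`:
`m 0 = 1`, `m 1 = m 2 = 0` and
`m k = κ k + ∑_{j = 3}^{k - 3} (k - 1).choose j * m j * κ (k - j)` for `k ≥ 3`. -/
def modifiedMoment (κ : ℕ → ℝ) (k : ℕ) : ℝ :=
  if k = 0 then 1
  else if k < 3 then 0
  else κ k + ∑ j ∈ (Finset.Icc 3 (k - 3)).attach,
    ((k - 1).choose (j : ℕ) : ℝ) * modifiedMoment κ (j : ℕ) * κ (k - (j : ℕ))
  termination_by k
  decreasing_by
    have hj := Finset.mem_Icc.mp j.2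
    omega

/-- The density with respect to Lebesgue measure of a measure on the real line
(meaningful when the measure is absolutely continuous). -/
def lebesgueDensity (μ : Measure ℝ) (y : ℝ) : ℝ := (μ.rnDeriv volume y).toReal

/-- The differential entropy of `μ` is well defined: `μ` has a density `p` with respect to Lebesgue
measure and `p log p` is integrable. -/
def HasDifferentialEntropy (μ : Measure ℝ) : Prop :=
  μ ≪ volume ∧
  Integrable (fun y => lebesgueDensity μ y * Real.log (lebesgueDensity μ y)) volume

/-- The differential entropy `- ∫ p log p`, in nats, of a measure on the real line with Lebesgue density `p`
(meaningful when `HasDifferentialEntropy μ` holds). -/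
def differentialEntropy (μ : Measure ℝ) : ℝ :=
  - ∫ y, lebesgueDensity μ y * Real.log (lebesgueDensity μ y)

/-- The standard deviation of a real random variable. -/
def stdDev {Ω : Type*} [MeasurableSpace Ω] (X : Ω → ℝ) (P : Measure Ω) : ℝ :=
  Real.sqrt (variance X P)

/-- The law of the Gaussian variable `X*` with the same mean and the same variance as `X`. -/
def matchedGaussian {Ω : Type*} [MeasurableSpace Ω] (X : Ω → ℝ) (P : Measure Ω) : Measure ℝ :=
  gaussianReal (∫ ω, X ω ∂P) (Real.toNNReal (variance X P))

/-- The non-Gaussianity (negentropy) `D(X‖X*)` of a real random variable `X`. -/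
def nonGaussianity {Ω : Type*} [MeasurableSpace Ω] (X : Ω → ℝ) (P : Measure Ω) : ℝ≥0∞ :=
  klDiv (P.map X) (matchedGaussian X P)

/-- The standardized variable `(X - E X) / σ_X`. -/
def standardize {Ω : Type*} [MeasurableSpace Ω] (X : Ω → ℝ) (P : Measure Ω) (ω : Ω) : ℝ :=
  (X ω - ∫ ω', X ω' ∂P) / stdDev X P

/-- The expansion of non-Gaussianity up to order `σ ^ (-12)`, in modified moments. -/
def expansionInModifiedMoments (m : ℕ → ℝ) (σ : ℝ) : ℝ :=
  m 3 ^ 2 / (12 * σ ^ 6) + m 4 ^ 2 / (48 * σ ^ 8) + m 5 ^ 2 / (240 * σ ^ 10)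
    - m 3 ^ 2 * m 4 / (8 * σ ^ 10) + m 6 ^ 2 / (1440 * σ ^ 12)
    - m 4 ^ 3 / (48 * σ ^ 12) - m 3 * m 4 * m 5 / (12 * σ ^ 12)
    - m 3 ^ 2 * m 6 / (72 * σ ^ 12) + 31 * m 3 ^ 4 / (144 * σ ^ 12)

/-- The expansion of non-Gaussianity up to order `σ ^ (-12)`, in cumulants. -/
def expansionInCumulants (κ : ℕ → ℝ) (σ : ℝ) : ℝ :=
  κ 3 ^ 2 / (12 * σ ^ 6) + κ 4 ^ 2 / (48 * σ ^ 8)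
    - κ 3 ^ 2 * κ 4 / (8 * σ ^ 10) + κ 5 ^ 2 / (240 * σ ^ 10)
    + 7 * κ 3 ^ 4 / (48 * σ ^ 12) - κ 4 ^ 3 / (48 * σ ^ 12)
    - κ 3 * κ 4 * κ 5 / (12 * σ ^ 12) + κ 6 ^ 2 / (1440 * σ ^ 12)

end

/-! Put ε = 1/σ, Z' = Z − E Z and c² = Var Z. The standardized Y is εZ' plus an independent Gaussian
of variance 1 − c²ε². Its density relative to the standard Gaussian law γ is therefore an average
ρ(x) = E k(x, Z') of explicit ratios of Gaussian densities (`ratioKernel`, `gaussianRatio`).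
Relative entropy is invariant under affine changes of variable, so the divergence is ∫ ρ log ρ dγ,
and everything reduces to expanding this integral as ε → 0+.

Shifting γ by w multiplies its density by exp(xw − w²/2) = ∑ wⁿ Heₙ(x)/n!. The deficit c²ε² in the
noise variance is compensated by an imaginary Gaussian shift: k(x, z) is the mean of this generating
function at w = ε(z − icG) with G standard normal (`integral_cexp_hermite_generating`). Hence ρ has
the asymptotic expansion ∑ mₙ εⁿ Heₙ/n! with mₙ = E (Z' − icG)ⁿ. These mₙ are the Taylor
coefficients (up to iⁿ) of E exp(itZ') · exp(c²t²/2), whose logarithm is that of the characteristic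
function of Z with its first two cumulants removed. Differentiating the exponential gives exactly
the recurrence of the modified moments (`modifiedMoment_cumulant_eq`). In particular m₁ = m₂ = 0, so
r = ρ − 1 is of order ε³.

Only moments of Z are assumed finite, so the expansion is proved with remainder, after restricting
the average to |εZ'| ≤ 1 (`exists_norm_truncatedRatio_sub_le`). The error grows in x only like
exp(x²/32), which leaves fifth powers γ-integrable. The discarded part costs O(ε¹⁴): the fourteenth
moment controls its mass, and |log ρ| grows at most quadratically, the lower bound coming from
Jensen's inequality (`abs_integral_mul_log_sub_truncated_le`).

Finally (1 + r) log(1 + r) = r + r²/2 − r³/6 + r⁴/12 + O(|r|⁵) on all of r ≥ −1, and the last term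
is O(ε¹⁵). What remains are Gaussian expectations of products of Hermite polynomials, which
orthogonality and parity reduce to a few numbers. The passage to cumulants uses m₆ = κ₆ + 10κ₃². The
entropy statements follow because the logarithm of the matched Gaussian density is quadratic and Y
has the same first two moments. -/

open Polynomial in
/-- The probabilists' Hermite polynomial with real coefficients. -/
noncomputable def realHermite (n : ℕ) : Polynomial ℝ := (hermite n).map (Int.castRingHom ℝ)

/-! ### Hermite polynomials: recurrences and parity. -/

section Hermite
open Polynomial

lemma realHermite_zero : realHermite 0 = 1 := by simp [realHermite]

lemma realHermite_one : realHermite 1 = X := by simp [realHermite]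

lemma realHermite_succ (n : ℕ) :
    realHermite (n + 1) = X * realHermite n - derivative (realHermite n) := by
  simp [realHermite, hermite_succ, derivative_map]

lemma derivative_realHermite_succ (n : ℕ) :
    derivative (realHermite (n + 1)) = (n + 1 : ℝ[X]) * realHermite n := by
  induction n with
  | zero => simp [realHermite_zero, realHermite_one]
  | succ n ih =>
    rw [realHermite_succ (n + 1)]
    simp only [derivative_sub, derivative_mul, derivative_X, ih]
    rw [realHermite_succ n]
    have : derivative ((n : ℝ[X]) + 1) = 0 := by
      simp
    rw [this]
    push_cast
    ring

lemma realHermite_succ_succ (n : ℕ) :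
    realHermite (n + 2) = X * realHermite (n + 1) - (n + 1 : ℝ[X]) * realHermite n := by
  rw [realHermite_succ (n + 1), derivative_realHermite_succ]

lemma eval_realHermite_succ_succ (n : ℕ) (x : ℝ) :
    (realHermite (n + 2)).eval x
      = x * (realHermite (n + 1)).eval x - (n + 1) * (realHermite n).eval x := by
  simp [realHermite_succ_succ]

lemma eval_neg_realHermite (n : ℕ) (x : ℝ) :
    (realHermite n).eval (-x) = (-1) ^ n * (realHermite n).eval x := by
  induction n using Nat.twoStepInduction with
  | zero => simp [realHermite_zero]
  | one => simp [realHermite_one]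
  | more n h0 h1 =>
    rw [eval_realHermite_succ_succ, eval_realHermite_succ_succ, h0, h1]
    ring

end Hermite

/-! ### The Hermite generating function and its Taylor remainder. -/

/-- The coefficient of `w ^ n` in the expansion of `exp (x w - w ^ 2 / 2)`. -/
noncomputable def hermiteCoeff (x : ℝ) (n : ℕ) : ℝ :=
  (realHermite n).eval x / n.factorial

lemma hermiteCoeff_zero (x : ℝ) : hermiteCoeff x 0 = 1 := by
  simp [hermiteCoeff, realHermite_zero]

lemma hermiteCoeff_one (x : ℝ) : hermiteCoeff x 1 = x := by
  simp [hermiteCoeff, realHermite_one]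

lemma hermiteCoeff_succ_succ (x : ℝ) (n : ℕ) :
    (n + 2) * hermiteCoeff x (n + 2) = x * hermiteCoeff x (n + 1) - hermiteCoeff x n := by
  have h := Nat.factorial_pos n
  have h' : (n.factorial : ℝ) ≠ 0 := by positivity
  simp only [hermiteCoeff, eval_realHermite_succ_succ, Nat.factorial_succ, Nat.cast_mul]
  push_cast
  field_simp
  ring

/-- A crude geometric bound is enough: in the three-term recurrence the factor n + 2 on the left is
simply replaced by 1. -/
lemma abs_hermiteCoeff_le (x : ℝ) (n : ℕ) : |hermiteCoeff x n| ≤ (1 + |x|) ^ n := by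
  induction n using Nat.twoStepInduction with
  | zero => simp [hermiteCoeff_zero]
  | one => simp [hermiteCoeff_one]
  | more n h0 h1 =>
    have h := hermiteCoeff_succ_succ x n
    have hx : 0 ≤ |x| := abs_nonneg x
    have h2 : (n + 2) * |hermiteCoeff x (n + 2)|
        ≤ |x| * (1 + |x|) ^ (n + 1) + (1 + |x|) ^ n := by
      have : (n + 2 : ℝ) * |hermiteCoeff x (n + 2)| = |(n + 2) * hermiteCoeff x (n + 2)| := by
        rw [abs_mul, abs_of_nonneg (by positivity : (0 : ℝ) ≤ n + 2)]
      rw [this, h]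
      refine (abs_sub _ _).trans ?_
      rw [abs_mul]
      gcongr
    have h3 : |x| * (1 + |x|) ^ (n + 1) + (1 + |x|) ^ n ≤ (1 + |x|) ^ (n + 2) := by
      have : (1 + |x|) ^ (n + 2) - (|x| * (1 + |x|) ^ (n + 1) + (1 + |x|) ^ n)
        = (1 + |x|) ^ n * |x| := by ring
      have : 0 ≤ (1 + |x|) ^ n * |x| := by positivity
      linarith
    have h4 : 0 ≤ (n + 1 : ℝ) * |hermiteCoeff x (n + 2)| := by positivity
    linarith

/-- The partial sum `∑_{n ≤ N} w ^ n He_n(x) / n!` of the Hermite generating function. -/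
noncomputable def hermiteSum (x : ℝ) (N : ℕ) (w : ℂ) : ℂ :=
  ∑ n ∈ Finset.range (N + 1), (hermiteCoeff x n : ℂ) * w ^ n

lemma hermiteSum_succ (x : ℝ) (N : ℕ) (w : ℂ) :
    hermiteSum x (N + 1) w = hermiteSum x N w + hermiteCoeff x (N + 1) * w ^ (N + 1) := by
  simp [hermiteSum, Finset.sum_range_succ]

/-- The full series solves S' = (x − w) S. By the recurrence for the coefficients, truncation
violates this equation only through two terms of degree at least N + 1 in w, and this smallness
produces the remainder estimate. -/
lemma hasDerivAt_hermiteSum (x : ℝ) (N : ℕ) (w : ℂ) :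
    HasDerivAt (hermiteSum x (N + 1))
      ((x - w) * hermiteSum x (N + 1) w - (x - w) * (hermiteCoeff x (N + 1) * w ^ (N + 1))
        + hermiteCoeff x N * w ^ (N + 1)) w := by
  induction N with
  | zero =>
    have h : hermiteSum x (0 + 1) = fun w : ℂ => 1 + x * w := by
      funext w
      simp [hermiteSum, Finset.sum_range_succ, hermiteCoeff_zero, hermiteCoeff_one]
    rw [h]
    have := ((hasDerivAt_id w).const_mul (x : ℂ)).const_add 1
    refine this.congr_deriv ?_
    simp [hermiteCoeff_zero, hermiteCoeff_one]
    ring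
  | succ N ih =>
    have h : hermiteSum x (N + 1 + 1)
        = fun w => hermiteSum x (N + 1) w + hermiteCoeff x (N + 2) * w ^ (N + 2) := by
      funext w
      rw [hermiteSum_succ]
    rw [h]
    have h1 := ih.add ((hasDerivAt_pow (N + 2) w).const_mul (hermiteCoeff x (N + 2) : ℂ))
    refine h1.congr_deriv ?_
    have h2 : ((N : ℂ) + 2) * hermiteCoeff x (N + 2)
        = x * hermiteCoeff x (N + 1) - hermiteCoeff x N := by
      exact_mod_cast hermiteCoeff_succ_succ x N
    push_cast
    have h3 : (hermiteCoeff x (N + 2) : ℂ) * (((N : ℂ) + 2) * w ^ (N + 1))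
      = (x * hermiteCoeff x (N + 1) - hermiteCoeff x N) * w ^ (N + 1) := by
      rw [← h2]; ring
    rw [h3]
    ring

/-- The unit factor `a` lets one bound serve both the exponential (`a = 1`) and its inverse (`a =
-1`), along the whole segment from 0 to w. -/
lemma norm_exp_quadratic_le (x : ℝ) (w : ℂ) (t r : ℝ) (ht : ‖w‖ ≤ r) (ht1 : |t| ≤ 1) (a : ℂ)
    (ha : ‖a‖ = 1) :
    ‖Complex.exp (a * (x * (t * w) - (t * w) ^ 2 / 2))‖ ≤ Real.exp (|x| * r + r ^ 2 / 2) := by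
  rw [Complex.norm_exp]
  refine Real.exp_le_exp.mpr ((Complex.re_le_norm _).trans ?_)
  rw [norm_mul, ha, one_mul]
  have h1 : ‖(t : ℂ) * w‖ ≤ r := by
    rw [norm_mul, Complex.norm_real, Real.norm_eq_abs]
    nlinarith [norm_nonneg w, abs_nonneg t]
  calc ‖(x : ℂ) * (t * w) - (t * w) ^ 2 / 2‖
      ≤ ‖(x : ℂ) * (t * w)‖ + ‖(t * w) ^ 2 / 2‖ := norm_sub_le _ _
    _ = |x| * ‖(t : ℂ) * w‖ + ‖(t : ℂ) * w‖ ^ 2 / 2 := by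
        rw [norm_mul (x : ℂ), norm_div, norm_pow, Complex.norm_real, Real.norm_eq_abs]; simp
    _ ≤ |x| * r + r ^ 2 / 2 := by gcongr

/-- Taylor's formula with remainder for the Hermite generating function. -/
lemma norm_exp_sub_hermiteSum_le (x : ℝ) (N : ℕ) (w : ℂ) :
    ‖Complex.exp (x * w - w ^ 2 / 2) - hermiteSum x (N + 1) w‖
      ≤ 2 * ‖w‖ ^ (N + 2) * (1 + |x|) ^ (N + 2) * (1 + ‖w‖)
        * Real.exp (2 * |x| * ‖w‖ + ‖w‖ ^ 2) := by
  set q : ℂ → ℂ := fun w => x * w - w ^ 2 / 2 with hq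
  -- φ is the partial sum divided by the generating function along the segment from 0 to w. It
  -- equals 1 at t = 0, and the differential equation leaves only top-degree terms in φ', so the
  -- mean value inequality bounds φ(1) − 1.
  set φ : ℝ → ℂ := fun t => Complex.exp (-q (t * w)) * hermiteSum x (N + 1) (t * w) with hφ
  set r := ‖w‖ with hr
  have hr0 : 0 ≤ r := norm_nonneg w
  have hder : ∀ t : ℝ, HasDerivAt φ (Complex.exp (-q (t * w))
      * (-(x - t * w) * (hermiteCoeff x (N + 1) * (t * w) ^ (N + 1))
        + hermiteCoeff x N * (t * w) ^ (N + 1)) * w) t := by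
    intro t
    have h1 : HasDerivAt (fun y : ℂ => Complex.exp (-q y) * hermiteSum x (N + 1) y)
        (Complex.exp (-q (t * w)) * (-(x - t * w) * (hermiteCoeff x (N + 1) * (t * w) ^ (N + 1))
        + hermiteCoeff x N * (t * w) ^ (N + 1))) (t * w) := by
      have hqd : HasDerivAt (fun y => -q y) (-(x - t * w)) (t * w) := by
        have := (((hasDerivAt_id (t * w : ℂ)).const_mul (x : ℂ)).sub
          ((hasDerivAt_pow 2 (t * w : ℂ)).div_const 2)).neg
        refine this.congr_deriv ?_
        push_cast
        ring
      refine (hqd.cexp.mul (hasDerivAt_hermiteSum x N (t * w))).congr_deriv ?_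
      ring
    have h2 : HasDerivAt (fun t : ℝ => (t : ℂ) * w) w t := by
      simpa using (Complex.ofRealCLM.hasDerivAt (x := t)).mul_const w
    have := h1.comp t h2
    exact this
  have hbound : ∀ t ∈ Set.Ico (0 : ℝ) 1, ‖Complex.exp (-q (t * w))
      * (-(x - t * w) * (hermiteCoeff x (N + 1) * (t * w) ^ (N + 1))
        + hermiteCoeff x N * (t * w) ^ (N + 1)) * w‖
      ≤ Real.exp (|x| * r + r ^ 2 / 2) * (2 * r ^ (N + 1) * (1 + |x|) ^ (N + 2) * (1 + r)) * r := by
    intro t ht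
    have ht1 : |t| ≤ 1 := by rw [abs_of_nonneg ht.1]; exact ht.2.le
    have e1 := norm_exp_quadratic_le x w t r le_rfl ht1 (-1) (by simp)
    rw [neg_one_mul] at e1
    have e2 : ‖(t : ℂ) * w‖ ≤ r := by
      rw [norm_mul, Complex.norm_real, Real.norm_eq_abs]
      nlinarith [norm_nonneg w, abs_nonneg t]
    rw [norm_mul, norm_mul]
    refine mul_le_mul_of_nonneg_right (mul_le_mul e1 ?_ (norm_nonneg _) (Real.exp_nonneg _)) hr0
    have e3 : ‖(x : ℂ) - t * w‖ ≤ |x| + r := by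
      refine (norm_sub_le _ _).trans ?_
      rw [Complex.norm_real, Real.norm_eq_abs]
      gcongr
    calc _ ≤ ‖(-((x : ℂ) - t * w)) * (hermiteCoeff x (N + 1) * (t * w) ^ (N + 1))‖
          + ‖(hermiteCoeff x N : ℂ) * (t * w) ^ (N + 1)‖ := norm_add_le _ _
      _ = ‖(x : ℂ) - t * w‖ * (|hermiteCoeff x (N + 1)| * ‖(t : ℂ) * w‖ ^ (N + 1))
          + |hermiteCoeff x N| * ‖(t : ℂ) * w‖ ^ (N + 1) := by
          simp only [norm_mul, norm_neg, norm_pow, Complex.norm_real, Real.norm_eq_abs]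
      _ ≤ (|x| + r) * ((1 + |x|) ^ (N + 1) * r ^ (N + 1)) + (1 + |x|) ^ N * r ^ (N + 1) := by
          gcongr
          · exact abs_hermiteCoeff_le x _
          · exact abs_hermiteCoeff_le x _
      _ ≤ (1 + |x|) * (1 + r) * ((1 + |x|) ^ (N + 1) * r ^ (N + 1))
          + (1 + |x|) ^ (N + 2) * (1 + r) * r ^ (N + 1) := by
          gcongr ?_ * _ + ?_ * _
          · nlinarith [abs_nonneg x]
          · have : (1 + |x|) ^ N ≤ (1 + |x|) ^ (N + 2) :=
              pow_le_pow_right₀ (by linarith [abs_nonneg x]) (by omega)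
            have h0 : 0 ≤ (1 + |x|) ^ (N + 2) * r := by positivity
            linarith
      _ = 2 * r ^ (N + 1) * (1 + |x|) ^ (N + 2) * (1 + r) := by ring
  have hmv := norm_image_sub_le_of_norm_deriv_le_segment_01'
    (fun t _ => (hder t).hasDerivWithinAt) hbound
  have h0 : φ 0 = 1 := by
    simp only [hφ, hq, hermiteSum, Finset.sum_range_succ']
    simp [hermiteCoeff_zero]
  have h1 : φ 1 = Complex.exp (-q w) * hermiteSum x (N + 1) w := by simp [hφ]
  rw [h0, h1] at hmv
  have h2 : Complex.exp (x * w - w ^ 2 / 2) - hermiteSum x (N + 1) w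
      = - (Complex.exp (q w) * (Complex.exp (-q w) * hermiteSum x (N + 1) w - 1)) := by
    rw [mul_sub, ← mul_assoc, ← Complex.exp_add]
    simp [hq]
  rw [h2, norm_neg, norm_mul]
  have e1 := norm_exp_quadratic_le x w 1 r le_rfl (by simp) 1 (by simp)
  simp only [Complex.ofReal_one, one_mul] at e1
  refine (mul_le_mul e1 hmv (norm_nonneg _) (Real.exp_nonneg _)).trans (le_of_eq ?_)
  have : Real.exp (2 * |x| * r + r ^ 2)
      = Real.exp (|x| * r + r ^ 2 / 2) * Real.exp (|x| * r + r ^ 2 / 2) := by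
    rw [← Real.exp_add]; ring_nf
  rw [this]
  ring

/-! ### Integrability with respect to the standard Gaussian law. -/

lemma gaussianPDFReal_zero_one (x : ℝ) :
    gaussianPDFReal 0 1 x = (Real.sqrt (2 * Real.pi))⁻¹ * Real.exp (-x ^ 2 / 2) := by
  simp [gaussianPDFReal]

lemma gaussianReal_zero_one_eq_withDensity :
    gaussianReal 0 1 = volume.withDensity (gaussianPDF 0 1) :=
  gaussianReal_of_var_ne_zero 0 one_ne_zero

lemma integrable_gaussianReal_iff {E : Type*} [NormedAddCommGroup E] [NormedSpace ℝ E]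
    {f : ℝ → E} (m : ℝ) {v : ℝ≥0} (hv : v ≠ 0) :
    Integrable f (gaussianReal m v) ↔ Integrable (fun x => gaussianPDFReal m v x • f x) := by
  rw [gaussianReal_of_var_ne_zero m hv,
    integrable_withDensity_iff_integrable_smul' (measurable_gaussianPDF m v)
      (ae_of_all _ fun x => gaussianPDF_lt_top)]
  simp only [toReal_gaussianPDF]

/-- `exp (a x ^ 2)` is integrable for the standard Gaussian measure when `a < 1 / 2`. -/
lemma integrable_exp_mul_sq_gaussianReal {a : ℝ} (ha : a < 1 / 2) :
    Integrable (fun x : ℝ => Real.exp (a * x ^ 2)) (gaussianReal 0 1) := by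
  rw [integrable_gaussianReal_iff 0 one_ne_zero]
  have h := (integrable_exp_neg_mul_sq (b := 1 / 2 - a) (by linarith)).const_mul
    (Real.sqrt (2 * Real.pi))⁻¹
  refine h.congr (ae_of_all _ fun x => ?_)
  simp only [gaussianPDFReal_zero_one, smul_eq_mul]
  rw [mul_assoc, ← Real.exp_add]
  ring_nf

lemma integrable_pow_gaussianReal (n : ℕ) :
    Integrable (fun x : ℝ => x ^ n) (gaussianReal 0 1) := by
  have h := memLp_id_gaussianReal (μ := 0) (v := 1) (n : ℝ≥0)
  rcases Nat.eq_zero_or_pos n with rfl | hn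
  · simp
  have h2 := h.integrable_norm_pow (p := n) (by omega)
  refine h2.mono' (by fun_prop) (ae_of_all _ fun x => ?_)
  simp [norm_pow]

/-! ### Gaussian expectations of polynomials and of products of Hermite polynomials. -/

section GaussianFunctional
open Polynomial

lemma integrable_eval_gaussianReal (p : ℝ[X]) :
    Integrable (fun x => p.eval x) (gaussianReal 0 1) := by
  simp only [eval_eq_sum_range]
  exact integrable_finsetSum _ fun i _ => (integrable_pow_gaussianReal i).const_mul _

/-- Integration of polynomials against the standard Gaussian measure. -/
noncomputable def gaussianFunctional : ℝ[X] →ₗ[ℝ] ℝ where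
  toFun p := ∫ x, p.eval x ∂(gaussianReal 0 1)
  map_add' p q := by
    simp only [eval_add]
    exact integral_add (integrable_eval_gaussianReal p) (integrable_eval_gaussianReal q)
  map_smul' c p := by
    simp only [eval_smul, RingHom.id_apply]
    exact integral_smul c _

lemma gaussianFunctional_apply (p : ℝ[X]) :
    gaussianFunctional p = ∫ x, p.eval x ∂(gaussianReal 0 1) := rfl

/-- Stein's identity for polynomials. -/
lemma gaussianFunctional_X_mul (p : ℝ[X]) :
    gaussianFunctional (X * p) = gaussianFunctional (derivative p) := by
  have hint : ∀ q : ℝ[X], Integrable (fun x => gaussianPDFReal 0 1 x * q.eval x) := by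
    intro q
    simpa using (integrable_gaussianReal_iff 0 one_ne_zero).mp (integrable_eval_gaussianReal q)
  have hd : ∀ x, HasDerivAt (fun x => gaussianPDFReal 0 1 x * p.eval x)
      (gaussianPDFReal 0 1 x * (derivative p - X * p).eval x) x := by
    intro x
    have h1 : HasDerivAt (gaussianPDFReal 0 1) (gaussianPDFReal 0 1 x * (-x)) x := by
      have : gaussianPDFReal 0 1
          = fun x => (Real.sqrt (2 * Real.pi))⁻¹ * Real.exp (-x ^ 2 / 2) := by
        funext x; exact gaussianPDFReal_zero_one x
      rw [this]
      have h2 : HasDerivAt (fun x : ℝ => -x ^ 2 / 2) (-x) x := by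
        refine ((hasDerivAt_pow 2 x).neg.div_const 2).congr_deriv ?_
        push_cast
        ring
      refine (h2.exp.const_mul _).congr_deriv ?_
      ring
    refine (h1.mul (p.hasDerivAt x)).congr_deriv ?_
    simp
    ring
  have h0 := integral_eq_zero_of_hasDerivAt_of_integrable hd (hint _) (hint _)
  have h1 : gaussianFunctional (derivative p - X * p) = 0 := by
    rw [gaussianFunctional_apply, integral_gaussianReal_eq_integral_smul one_ne_zero]
    simpa using h0
  rw [map_sub] at h1
  linarith

lemma gaussianFunctional_one : gaussianFunctional 1 = 1 := by
  simp [gaussianFunctional_apply]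

lemma gaussianFunctional_X_pow_succ_succ (n : ℕ) :
    gaussianFunctional (X ^ (n + 2)) = (n + 1) * gaussianFunctional (X ^ n) := by
  rw [pow_succ', gaussianFunctional_X_mul, derivative_X_pow]
  simp only [Nat.add_sub_cancel, C_mul', map_smul, smul_eq_mul]
  push_cast
  rfl

/-- Stein's identity says that p ↦ Xp − p' is adjoint to differentiation; Heₙ arises from 1 by
applying it n times, so n integrations by parts move all of it onto `p`. -/
lemma gaussianFunctional_realHermite_mul (n : ℕ) (p : ℝ[X]) :
    gaussianFunctional (realHermite n * p) = gaussianFunctional (derivative^[n] p) := by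
  induction n generalizing p with
  | zero => simp [realHermite_zero]
  | succ n ih =>
    have : realHermite (n + 1) * p
        = X * (realHermite n * p) - derivative (realHermite n) * p := by
      rw [realHermite_succ]; ring
    rw [this, map_sub, gaussianFunctional_X_mul, derivative_mul, map_add, ih,
      Function.iterate_succ_apply]
    ring

lemma realHermite_monic (n : ℕ) : (realHermite n).Monic := (hermite_monic n).map _

lemma natDegree_realHermite (n : ℕ) : (realHermite n).natDegree = n := by
  rw [realHermite, (hermite_monic n).natDegree_map, natDegree_hermite]

/-- Orthogonality of the Hermite polynomials. -/
lemma gaussianFunctional_realHermite_mul_realHermite (m n : ℕ) :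
    gaussianFunctional (realHermite m * realHermite n) = if m = n then (n.factorial : ℝ) else 0 := by
  wlog h : n ≤ m generalizing m n
  · rw [mul_comm, this n m (by omega)]
    split_ifs <;> first | omega | simp_all
  rw [gaussianFunctional_realHermite_mul]
  split_ifs with hmn
  · subst hmn
    have h2 : derivative^[m] (realHermite m) = C (m.factorial : ℝ) := by
      ext k
      rw [coeff_iterate_derivative, coeff_C]
      rcases Nat.eq_zero_or_pos k with rfl | hk
      · have := realHermite_monic m
        rw [Monic, leadingCoeff, natDegree_realHermite] at this
        simp [this, Nat.descFactorial_self]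
      · rw [coeff_eq_zero_of_natDegree_lt (by rw [natDegree_realHermite]; omega)]
        simp [hk.ne']
    rw [h2, show C (m.factorial : ℝ) = (m.factorial : ℝ) • (1 : ℝ[X]) by simp [smul_eq_C_mul],
      map_smul, gaussianFunctional_one]
    simp
  · rw [iterate_derivative_eq_zero (by rw [natDegree_realHermite]; omega), map_zero]

/-- The Gaussian expectation of a product of Hermite polynomials of odd total degree vanishes. -/
lemma gaussianFunctional_eq_zero_of_odd {p : ℝ[X]} (hp : ∀ x, p.eval (-x) = -p.eval x) :
    gaussianFunctional p = 0 := by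
  have h1 : ∫ x, p.eval x ∂(gaussianReal 0 1) = ∫ x, p.eval (-x) ∂(gaussianReal 0 1) := by
    have h := gaussianReal_map_neg (μ := 0) (v := 1)
    rw [neg_zero] at h
    conv_lhs => rw [← h]
    rw [integral_map (by fun_prop) (by
      rw [h]; exact (integrable_eval_gaussianReal p).aestronglyMeasurable)]
  simp only [hp, integral_neg] at h1
  rw [gaussianFunctional_apply]
  linarith

lemma gaussianFunctional_realHermite_triple_of_odd {i j k : ℕ} (h : Odd (i + j + k)) :
    gaussianFunctional (realHermite i * realHermite j * realHermite k) = 0 := by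
  refine gaussianFunctional_eq_zero_of_odd fun x => ?_
  simp only [eval_mul, eval_neg_realHermite]
  have : (-1 : ℝ) ^ i * (-1) ^ j * (-1) ^ k = -1 := by
    rw [← pow_add, ← pow_add, h.neg_one_pow]
  linear_combination (realHermite i).eval x * (realHermite j).eval x * (realHermite k).eval x * this

lemma realHermite_two : realHermite 2 = X ^ 2 - 1 := by
  have := realHermite_succ_succ 0
  rw [this, zero_add, realHermite_one, realHermite_zero]; push_cast; ring

lemma realHermite_three : realHermite 3 = X ^ 3 - 3 * X := by
  have := realHermite_succ_succ 1
  rw [this, realHermite_two, realHermite_one]; push_cast; ring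

lemma realHermite_four : realHermite 4 = X ^ 4 - 6 * X ^ 2 + 3 := by
  have := realHermite_succ_succ 2
  rw [this, realHermite_three, realHermite_two]; push_cast; ring

lemma realHermite_five : realHermite 5 = X ^ 5 - 10 * X ^ 3 + 15 * X := by
  have := realHermite_succ_succ 3
  rw [this, realHermite_four, realHermite_three]; push_cast; ring

lemma realHermite_six : realHermite 6 = X ^ 6 - 15 * X ^ 4 + 45 * X ^ 2 - 15 := by
  have := realHermite_succ_succ 4
  rw [this, realHermite_five, realHermite_four]; push_cast; ring

lemma gaussianFunctional_X_pow_even :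
    gaussianFunctional (X ^ 2) = 1 ∧ gaussianFunctional (X ^ 4) = 3
      ∧ gaussianFunctional (X ^ 6) = 15 ∧ gaussianFunctional (X ^ 8) = 105
      ∧ gaussianFunctional (X ^ 10) = 945 ∧ gaussianFunctional (X ^ 12) = 10395 := by
  have h0 := gaussianFunctional_one
  have h2 := gaussianFunctional_X_pow_succ_succ 0
  have h4 := gaussianFunctional_X_pow_succ_succ 2
  have h6 := gaussianFunctional_X_pow_succ_succ 4
  have h8 := gaussianFunctional_X_pow_succ_succ 6
  have h10 := gaussianFunctional_X_pow_succ_succ 8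
  have h12 := gaussianFunctional_X_pow_succ_succ 10
  norm_num at h2 h4 h6 h8 h10 h12
  rw [h0] at h2
  rw [h2] at h4
  rw [h4] at h6
  rw [h6] at h8
  rw [h8] at h10
  rw [h10] at h12
  norm_num at h2 h4 h6 h8 h10 h12
  exact ⟨h2, h4, h6, h8, h10, h12⟩

/-- The values below are computed by expanding in monomials and inserting the even Gaussian moments.
-/
lemma gaussianFunctional_realHermite_334 :
    gaussianFunctional (realHermite 3 * realHermite 3 * realHermite 4) = 216 := by
  obtain ⟨h2, h4, h6, h8, h10, -⟩ := gaussianFunctional_X_pow_even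
  have : realHermite 3 * realHermite 3 * realHermite 4
      = X ^ 10 - (12 : ℝ) • X ^ 8 + (48 : ℝ) • X ^ 6 - (72 : ℝ) • X ^ 4 + (27 : ℝ) • X ^ 2 := by
    simp only [realHermite_three, realHermite_four, smul_eq_C_mul]
    simp only [map_ofNat]
    ring
  rw [this]
  simp only [map_add, map_sub, map_smul, smul_eq_mul, h2, h4, h6, h8, h10]
  norm_num

lemma gaussianFunctional_realHermite_336 :
    gaussianFunctional (realHermite 3 * realHermite 3 * realHermite 6) = 720 := by
  obtain ⟨h2, h4, h6, h8, h10, h12⟩ := gaussianFunctional_X_pow_even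
  have : realHermite 3 * realHermite 3 * realHermite 6
      = X ^ 12 - (21 : ℝ) • X ^ 10 + (144 : ℝ) • X ^ 8 - (420 : ℝ) • X ^ 6
        + (495 : ℝ) • X ^ 4 - (135 : ℝ) • X ^ 2 := by
    simp only [realHermite_three, realHermite_six, smul_eq_C_mul]
    simp only [map_ofNat]
    ring
  rw [this]
  simp only [map_add, map_sub, map_smul, smul_eq_mul, h2, h4, h6, h8, h10, h12]
  norm_num

lemma gaussianFunctional_realHermite_345 :
    gaussianFunctional (realHermite 3 * realHermite 4 * realHermite 5) = 1440 := by
  obtain ⟨h2, h4, h6, h8, h10, h12⟩ := gaussianFunctional_X_pow_even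
  have : realHermite 3 * realHermite 4 * realHermite 5
      = X ^ 12 - (19 : ℝ) • X ^ 10 + (126 : ℝ) • X ^ 8 - (354 : ℝ) • X ^ 6
        + (405 : ℝ) • X ^ 4 - (135 : ℝ) • X ^ 2 := by
    simp only [realHermite_three, realHermite_four, realHermite_five, smul_eq_C_mul]
    simp only [map_ofNat]
    ring
  rw [this]
  simp only [map_add, map_sub, map_smul, smul_eq_mul, h2, h4, h6, h8, h10, h12]
  norm_num

lemma gaussianFunctional_realHermite_444 :
    gaussianFunctional (realHermite 4 * realHermite 4 * realHermite 4) = 1728 := by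
  obtain ⟨h2, h4, h6, h8, h10, h12⟩ := gaussianFunctional_X_pow_even
  have : realHermite 4 * realHermite 4 * realHermite 4
      = X ^ 12 - (18 : ℝ) • X ^ 10 + (117 : ℝ) • X ^ 8 - (324 : ℝ) • X ^ 6
        + (351 : ℝ) • X ^ 4 - (162 : ℝ) • X ^ 2 + (27 : ℝ) • 1 := by
    simp only [realHermite_four, smul_eq_C_mul]
    simp only [map_ofNat]
    ring
  rw [this]
  simp only [map_add, map_sub, map_smul, smul_eq_mul, h2, h4, h6, h8, h10, h12,
    gaussianFunctional_one]
  norm_num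

lemma gaussianFunctional_realHermite_three_pow_four :
    gaussianFunctional (realHermite 3 ^ 4) = 3348 := by
  obtain ⟨h2, h4, h6, h8, h10, h12⟩ := gaussianFunctional_X_pow_even
  have : realHermite 3 ^ 4
      = X ^ 12 - (12 : ℝ) • X ^ 10 + (54 : ℝ) • X ^ 8 - (108 : ℝ) • X ^ 6
        + (81 : ℝ) • X ^ 4 := by
    simp only [realHermite_three, smul_eq_C_mul]
    simp only [map_ofNat]
    ring
  rw [this]
  simp only [map_add, map_sub, map_smul, smul_eq_mul, h4, h6, h8, h10, h12]
  norm_num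

end GaussianFunctional

/-! ### The Gaussian kernel and the Hermite expansion of the truncated density ratio. -/

/-- The density at `x`, relative to the standard Gaussian law, of the Gaussian law with mean `ε z`
and variance `1 - v ε ^ 2`. -/
noncomputable def ratioKernel (v ε x z : ℝ) : ℝ :=
  (Real.sqrt (1 - v * ε ^ 2))⁻¹
    * Real.exp ((-(v * ε ^ 2 * x ^ 2) + 2 * ε * x * z - ε ^ 2 * z ^ 2) / (2 * (1 - v * ε ^ 2)))

/-- The kernel is the average of the Hermite generating function at the complex Gaussian point
`ε (z - I c g)`. -/
lemma integral_cexp_hermite_generating {c ε : ℝ} (h : c ^ 2 * ε ^ 2 < 1) (x z : ℝ) :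
    ∫ g : ℝ, Complex.exp (x * (ε * (z - Complex.I * c * g)) - (ε * (z - Complex.I * c * g)) ^ 2 / 2)
      ∂(gaussianReal 0 1) = (ratioKernel (c ^ 2) ε x z : ℂ) := by
  set u : ℝ := 1 - c ^ 2 * ε ^ 2 with hu
  have hu0 : 0 < u := by rw [hu]; linarith
  have huC : (u : ℂ) ≠ 0 := by exact_mod_cast hu0.ne'
  rw [integral_gaussianReal_eq_integral_smul one_ne_zero]
  have h1 : ∀ g : ℝ, gaussianPDFReal 0 1 g • Complex.exp
      (x * (ε * (z - Complex.I * c * g)) - (ε * (z - Complex.I * c * g)) ^ 2 / 2)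
      = ((Real.sqrt (2 * Real.pi))⁻¹ : ℝ) * Complex.exp ((-(u : ℂ) / 2) * g ^ 2
        + (Complex.I * ε * c * (ε * z - x)) * g + (x * ε * z - ε ^ 2 * z ^ 2 / 2)) := by
    intro g
    rw [gaussianPDFReal_zero_one, Complex.real_smul, Complex.ofReal_mul, mul_assoc,
      Complex.ofReal_exp, ← Complex.exp_add]
    congr 2
    rw [hu]
    push_cast
    linear_combination (-(ε : ℂ) ^ 2 * c ^ 2 * g ^ 2 / 2) * Complex.I_sq
  simp_rw [h1]
  rw [integral_const_mul, integral_cexp_quadratic (by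
    rw [show (-(u : ℂ) / 2) = ((-u / 2 : ℝ) : ℂ) by push_cast; ring, Complex.ofReal_re]; linarith)]
  -- The base is a positive real because u > 0, so the complex power 1/2 is the real square root and
  -- no branch question arises.
  have h2 : ((Real.pi : ℂ) / -(-(u : ℂ) / 2)) ^ (1 / 2 : ℂ)
      = ((Real.sqrt (2 * Real.pi) * (Real.sqrt u)⁻¹ : ℝ) : ℂ) := by
    have : ((Real.pi : ℂ) / -(-(u : ℂ) / 2)) = ((2 * Real.pi / u : ℝ) : ℂ) := by
      push_cast; field_simp
    rw [this, show (1 / 2 : ℂ) = ((1 / 2 : ℝ) : ℂ) by push_cast; rfl,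
      ← Complex.ofReal_cpow (by positivity), ← Real.sqrt_eq_rpow,
      Real.sqrt_div (by positivity), div_eq_mul_inv]
  have h3 : (x * ε * z - ε ^ 2 * z ^ 2 / 2 : ℂ)
      - (Complex.I * ε * c * (ε * z - x)) ^ 2 / (4 * (-(u : ℂ) / 2))
      = (((-(c ^ 2 * ε ^ 2 * x ^ 2) + 2 * ε * x * z - ε ^ 2 * z ^ 2) / (2 * u) : ℝ) : ℂ) := by
    have hI : (Complex.I * ε * c * (ε * z - x)) ^ 2 = -((ε * c * (ε * z - x)) ^ 2 : ℂ) := by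
      linear_combination ((ε * c * (ε * z - x)) ^ 2 : ℂ) * Complex.I_sq
    rw [hI]
    push_cast
    field_simp
    rw [hu]
    push_cast
    ring
  rw [h2, h3, ratioKernel, ← hu, ← Complex.ofReal_exp, ← Complex.ofReal_mul, ← Complex.ofReal_mul]
  congr 1
  have : Real.sqrt (2 * Real.pi) ≠ 0 := by positivity
  field_simp

lemma one_add_pow_le_factorial_mul_exp (k : ℕ) {t : ℝ} (ht : 0 ≤ t) :
    (1 + t) ^ k ≤ k.factorial * Real.exp (1 + t) := by
  have h := Real.pow_div_factorial_le_exp (1 + t) (by linarith) k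
  have h0 : (0 : ℝ) < k.factorial := by positivity
  rwa [div_le_iff₀ h0, mul_comm] at h

lemma norm_hermiteSum_le (x : ℝ) (N : ℕ) (w : ℂ) :
    ‖hermiteSum x N w‖ ≤ (N + 1) * ((1 + |x|) ^ N * (1 + ‖w‖) ^ N) := by
  refine (norm_sum_le _ _).trans ?_
  have : ∀ n ∈ Finset.range (N + 1), ‖(hermiteCoeff x n : ℂ) * w ^ n‖
      ≤ (1 + |x|) ^ N * (1 + ‖w‖) ^ N := by
    intro n hn
    have hn' : n ≤ N := by simpa [Nat.lt_succ_iff] using hn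
    rw [norm_mul, norm_pow, Complex.norm_real, Real.norm_eq_abs]
    have h1 : |hermiteCoeff x n| ≤ (1 + |x|) ^ N :=
      (abs_hermiteCoeff_le x n).trans (pow_le_pow_right₀ (by linarith [abs_nonneg x]) hn')
    have h2 : ‖w‖ ^ n ≤ (1 + ‖w‖) ^ N :=
      (pow_le_pow_left₀ (norm_nonneg w) (by linarith) n).trans
        (pow_le_pow_right₀ (by linarith [norm_nonneg w]) hn')
    gcongr
  refine (Finset.sum_le_sum this).trans ?_
  simp

/-- Pointwise error of the truncated Hermite generating function. -/
lemma norm_truncated_exp_sub_hermiteSum_le (N : ℕ) {c ε : ℝ} (hc : 0 ≤ c) (hε : 0 < ε)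
    (hε1 : ε ≤ 1) (hεc : ε * c ≤ 1 / 64) (x z g : ℝ) :
    ‖(if |ε * z| ≤ 1 then Complex.exp
        (x * (ε * (z - Complex.I * c * g)) - (ε * (z - Complex.I * c * g)) ^ 2 / 2) else 0)
      - hermiteSum x (N + 1) (ε * (z - Complex.I * c * g))‖
      ≤ ε ^ (N + 2) * (4 * (N + 2) * (N + 2).factorial * Real.exp 147) * Real.exp (x ^ 2 / 32)
        * ((1 + |z|) ^ (2 * N + 4) * ((1 + c * |g|) ^ (2 * N + 4) * Real.exp (g ^ 2 / 16))) := by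
  set w : ℂ := ε * (z - Complex.I * c * g) with hw
  have hx0 := abs_nonneg x
  have hz0 := abs_nonneg z
  have hg0 := abs_nonneg g
  have hcg : 0 ≤ c * |g| := mul_nonneg hc hg0
  have hnorm : ‖w‖ ≤ ε * |z| + ε * c * |g| := by
    rw [hw, norm_mul, Complex.norm_real, Real.norm_eq_abs, abs_of_pos hε]
    have : ‖(z : ℂ) - Complex.I * c * g‖ ≤ |z| + c * |g| := by
      refine (norm_sub_le _ _).trans ?_
      simp [abs_of_nonneg hc]
    calc ε * _ ≤ ε * (|z| + c * |g|) := by gcongr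
      _ = _ := by ring
  -- This is (|x|/8 − 12)² ≥ 0, that is 3|x| ≤ x²/64 + 144; it is the origin of the constant 147.
  have hexpx : 3 * |x| + x ^ 2 / 64 + 3 ≤ 147 + x ^ 2 / 32 := by
    nlinarith [sq_nonneg (|x| / 8 - 12), sq_abs x]
  set L := (1 + |z|) ^ (2 * N + 4) with hL
  set Q := (1 + c * |g|) ^ (2 * N + 4) with hQ
  have hfac : (0 : ℝ) < (N + 2).factorial := by positivity
  have hg1 : 1 ≤ Real.exp (g ^ 2 / 16) := Real.one_le_exp (by positivity)
  have hxpow := one_add_pow_le_factorial_mul_exp (N + 2) hx0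
  split_ifs with hA
  -- On the kept region ‖w‖ ≤ 1 + |g|/64, so the exponential in the Taylor remainder grows only like
  -- exp(x²/64 + 2|x|) in x and exp(g²/16) in g.
  · have hεz : ε * |z| ≤ 1 := by rwa [abs_mul, abs_of_pos hε] at hA
    have hn1 : ‖w‖ ≤ 1 + |g| / 64 := by nlinarith
    have hn2 : ‖w‖ ≤ ε * ((1 + |z|) * (1 + c * |g|)) := by
      refine hnorm.trans ?_
      have : 0 ≤ ε * (1 + |z| * (c * |g|)) := by positivity
      nlinarith
    have hn3 : 1 + ‖w‖ ≤ 2 * (1 + c * |g|) := by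
      have : ε * c * |g| ≤ c * |g| := by
        rw [mul_assoc]; exact mul_le_of_le_one_left hcg hε1
      linarith
    have hp : ‖w‖ ^ (N + 2) * (1 + ‖w‖) ≤ ε ^ (N + 2) * (2 * (L * Q)) := by
      calc ‖w‖ ^ (N + 2) * (1 + ‖w‖)
          ≤ (ε * ((1 + |z|) * (1 + c * |g|))) ^ (N + 2) * (2 * (1 + c * |g|)) := by gcongr
        _ = ε ^ (N + 2) * (2 * ((1 + |z|) ^ (N + 2) * (1 + c * |g|) ^ (N + 3))) := by
            rw [mul_pow, mul_pow]; ring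
        _ ≤ ε ^ (N + 2) * (2 * (L * Q)) := by
            have l1 : (1 + |z|) ^ (N + 2) ≤ L := pow_le_pow_right₀ (by linarith) (by omega)
            have l2 : (1 + c * |g|) ^ (N + 3) ≤ Q := pow_le_pow_right₀ (by linarith) (by omega)
            gcongr
    have he : 2 * |x| * ‖w‖ + ‖w‖ ^ 2 ≤ 2 * |x| + x ^ 2 / 64 + 2 + g ^ 2 / 16 := by
      have e1 : 2 * |x| * ‖w‖ ≤ 2 * |x| * (1 + |g| / 64) := by gcongr
      have e2 : ‖w‖ ^ 2 ≤ (1 + |g| / 64) ^ 2 := by gcongr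
      nlinarith [sq_nonneg (|x| - |g|), sq_abs x, sq_abs g, sq_nonneg (1 - |g| / 64)]
    refine (norm_exp_sub_hermiteSum_le x N w).trans ?_
    calc 2 * ‖w‖ ^ (N + 2) * (1 + |x|) ^ (N + 2) * (1 + ‖w‖)
        * Real.exp (2 * |x| * ‖w‖ + ‖w‖ ^ 2)
        = 2 * (‖w‖ ^ (N + 2) * (1 + ‖w‖)) * (1 + |x|) ^ (N + 2)
          * Real.exp (2 * |x| * ‖w‖ + ‖w‖ ^ 2) := by ring
      _ ≤ 2 * (ε ^ (N + 2) * (2 * (L * Q))) * ((N + 2).factorial * Real.exp (1 + |x|))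
          * Real.exp (2 * |x| + x ^ 2 / 64 + 2 + g ^ 2 / 16) := by gcongr
      _ = ε ^ (N + 2) * (4 * (N + 2).factorial * Real.exp (3 * |x| + x ^ 2 / 64 + 3))
          * (L * (Q * Real.exp (g ^ 2 / 16))) := by
          rw [show 2 * |x| + x ^ 2 / 64 + 2 + g ^ 2 / 16
            = (2 * |x| + x ^ 2 / 64 + 2) + g ^ 2 / 16 by ring, Real.exp_add _ (g ^ 2 / 16),
            show 3 * |x| + x ^ 2 / 64 + 3 = (1 + |x|) + (2 * |x| + x ^ 2 / 64 + 2) by ring,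
            Real.exp_add (1 + |x|)]
          ring
      _ ≤ ε ^ (N + 2) * (4 * (N + 2).factorial * Real.exp (147 + x ^ 2 / 32))
          * (L * (Q * Real.exp (g ^ 2 / 16))) := by gcongr
      _ = ε ^ (N + 2) * (4 * (1 * (N + 2).factorial * Real.exp 147)) * Real.exp (x ^ 2 / 32)
          * (L * (Q * Real.exp (g ^ 2 / 16))) := by rw [Real.exp_add]; ring
      _ ≤ ε ^ (N + 2) * (4 * ((N + 2) * (N + 2).factorial * Real.exp 147))
          * Real.exp (x ^ 2 / 32) * (L * (Q * Real.exp (g ^ 2 / 16))) := by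
          gcongr
          have : (0 : ℝ) ≤ N := Nat.cast_nonneg N
          linarith
      _ = _ := by ring
  -- On the discarded region only the polynomial survives. Since 1 ≤ ε|z|, a factor (ε|z|)^(N+2) may
  -- be inserted for free: it supplies the power of ε at the price of a higher moment of z, whence
  -- the exponent 2N + 4.
  · have hεz : 1 ≤ ε * |z| := by
      rw [abs_mul, abs_of_pos hε] at hA; linarith
    have hn : 1 + ‖w‖ ≤ (1 + |z|) * (1 + c * |g|) := by
      have e1 : ε * |z| ≤ |z| := mul_le_of_le_one_left hz0 hε1
      have e2 : ε * c * |g| ≤ c * |g| := by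
        rw [mul_assoc]; exact mul_le_of_le_one_left hcg hε1
      nlinarith [mul_nonneg hz0 hcg]
    rw [zero_sub, norm_neg]
    refine (norm_hermiteSum_le x (N + 1) w).trans ?_
    have e1 : (1 + ‖w‖) ^ (N + 1) ≤ ε ^ (N + 2) * (L * Q) := by
      calc (1 + ‖w‖) ^ (N + 1) ≤ ((1 + |z|) * (1 + c * |g|)) ^ (N + 1) := by gcongr
        _ ≤ (ε * |z|) ^ (N + 2) * ((1 + |z|) * (1 + c * |g|)) ^ (N + 1) :=
            le_mul_of_one_le_left (by positivity) (one_le_pow₀ hεz)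
        _ ≤ (ε * (1 + |z|)) ^ (N + 2) * ((1 + |z|) * (1 + c * |g|)) ^ (N + 1) := by
            gcongr; linarith
        _ = ε ^ (N + 2) * ((1 + |z|) ^ (2 * N + 3) * (1 + c * |g|) ^ (N + 1)) := by
            rw [mul_pow, mul_pow]; ring
        _ ≤ ε ^ (N + 2) * (L * Q) := by
            have l1 : (1 + |z|) ^ (2 * N + 3) ≤ L := pow_le_pow_right₀ (by linarith) (by omega)
            have l2 : (1 + c * |g|) ^ (N + 1) ≤ Q := pow_le_pow_right₀ (by linarith) (by omega)
            gcongr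
    have e2 : (1 + |x|) ^ (N + 1) ≤ (N + 2).factorial * Real.exp (147 + x ^ 2 / 32) := by
      calc (1 + |x|) ^ (N + 1) ≤ (1 + |x|) ^ (N + 2) :=
            pow_le_pow_right₀ (by linarith) (by omega)
        _ ≤ (N + 2).factorial * Real.exp (1 + |x|) := hxpow
        _ ≤ _ := by
            refine mul_le_mul_of_nonneg_left (Real.exp_le_exp.mpr ?_) hfac.le
            linarith [sq_nonneg x]
    calc ((N + 1 : ℕ) + 1 : ℝ) * ((1 + |x|) ^ (N + 1) * (1 + ‖w‖) ^ (N + 1))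
        ≤ ((N + 1 : ℕ) + 1 : ℝ) * (((N + 2).factorial * Real.exp (147 + x ^ 2 / 32))
          * (ε ^ (N + 2) * (L * Q))) := by gcongr
      _ = 1 * (ε ^ (N + 2) * ((N + 2) * (N + 2).factorial * Real.exp 147) * Real.exp (x ^ 2 / 32)
          * (L * (Q * 1))) := by rw [Real.exp_add]; push_cast; ring
      _ ≤ 4 * (ε ^ (N + 2) * ((N + 2) * (N + 2).factorial * Real.exp 147) * Real.exp (x ^ 2 / 32)
          * (L * (Q * Real.exp (g ^ 2 / 16)))) := by
          gcongr
          norm_num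
      _ = _ := by ring

/-- The `n`-th moment of `Z - I c G`, where `Z` has law `ν` and `G` is an independent standard
Gaussian variable. -/
noncomputable def deconvolvedMoment (ν : Measure ℝ) (c : ℝ) (n : ℕ) : ℂ :=
  ∫ p : ℝ × ℝ, ((p.1 : ℂ) - Complex.I * c * p.2) ^ n ∂(ν.prod (gaussianReal 0 1))

/-- The density, relative to the standard Gaussian law, of the part of `ε Z + N` coming from
`|ε Z| ≤ 1`, where `N` is Gaussian with variance `1 - v ε ^ 2`. -/
noncomputable def truncatedRatio (ν : Measure ℝ) (v ε x : ℝ) : ℝ :=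
  ∫ z, (if |ε * z| ≤ 1 then ratioKernel v ε x z else 0) ∂ν

lemma integrable_one_add_abs_pow {ν : Measure ℝ} [IsFiniteMeasure ν]
    (hν : ∀ n : ℕ, MemLp id (n : ℝ≥0∞) ν) (n : ℕ) :
    Integrable (fun z : ℝ => (1 + |z|) ^ n) ν := by
  have h : ∀ k : ℕ, Integrable (fun z : ℝ => |z| ^ k) ν := by
    intro k
    rcases Nat.eq_zero_or_pos k with rfl | hk
    · simp
    · simpa using (hν k).integrable_norm_pow (p := k) (by omega)
  have : (fun z : ℝ => (1 + |z|) ^ n)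
      = fun z => ∑ k ∈ Finset.range (n + 1), |z| ^ k * (n.choose k : ℝ) := by
    funext z
    rw [add_comm, add_pow]
    simp
  rw [this]
  exact integrable_finsetSum _ fun k _ => (h k).mul_const _

/-- The power is dominated by M! exp(1 + c|g|), and c|g| ≤ 4c² + g²/16. The total Gaussian growth
exp(g²/8) stays below the critical exp(g²/2). -/
lemma integrable_one_add_mul_abs_pow_mul_exp (M : ℕ) {c : ℝ} (hc : 0 ≤ c) :
    Integrable (fun g : ℝ => (1 + c * |g|) ^ M * Real.exp (g ^ 2 / 16)) (gaussianReal 0 1) := by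
  have h := (integrable_exp_mul_sq_gaussianReal (a := 1 / 8) (by norm_num)).const_mul
    (M.factorial * Real.exp (1 + 4 * c ^ 2))
  refine h.mono' (by fun_prop) (ae_of_all _ fun g => ?_)
  have hg := abs_nonneg g
  rw [Real.norm_of_nonneg (by positivity)]
  have h1 := one_add_pow_le_factorial_mul_exp M (mul_nonneg hc hg)
  have h2 : Real.exp (1 + c * |g|) ≤ Real.exp (1 + 4 * c ^ 2 + g ^ 2 / 16) := by
    refine Real.exp_le_exp.mpr ?_
    nlinarith [sq_nonneg (2 * c - |g| / 4), sq_abs g]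
  calc (1 + c * |g|) ^ M * Real.exp (g ^ 2 / 16)
      ≤ M.factorial * Real.exp (1 + 4 * c ^ 2 + g ^ 2 / 16) * Real.exp (g ^ 2 / 16) := by
        gcongr
        exact h1.trans (by gcongr)
    _ = M.factorial * Real.exp (1 + 4 * c ^ 2) * Real.exp (1 / 8 * g ^ 2) := by
        rw [mul_assoc, mul_assoc, ← Real.exp_add, ← Real.exp_add]
        ring_nf

lemma integrable_deconvolved_bound {ν : Measure ℝ} [IsProbabilityMeasure ν]
    (hν : ∀ n : ℕ, MemLp id (n : ℝ≥0∞) ν) (M : ℕ) {c : ℝ} (hc : 0 ≤ c) :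
    Integrable (fun p : ℝ × ℝ => (1 + |p.1|) ^ M * ((1 + c * |p.2|) ^ M * Real.exp (p.2 ^ 2 / 16)))
      (ν.prod (gaussianReal 0 1)) :=
  (integrable_one_add_abs_pow hν M).mul_prod (integrable_one_add_mul_abs_pow_mul_exp M hc)

lemma integrable_deconvolved_pow {ν : Measure ℝ} [IsProbabilityMeasure ν]
    (hν : ∀ n : ℕ, MemLp id (n : ℝ≥0∞) ν) (n : ℕ) {c : ℝ} (hc : 0 ≤ c) :
    Integrable (fun p : ℝ × ℝ => ((p.1 : ℂ) - Complex.I * c * p.2) ^ n)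
      (ν.prod (gaussianReal 0 1)) := by
  refine (integrable_deconvolved_bound hν n hc).mono' (by fun_prop) (ae_of_all _ fun p => ?_)
  have h1 : ‖(p.1 : ℂ) - Complex.I * c * p.2‖ ≤ (1 + |p.1|) * (1 + c * |p.2|) := by
    refine (norm_sub_le _ _).trans ?_
    simp only [norm_mul, Complex.norm_real, Complex.norm_I, Real.norm_eq_abs, abs_of_nonneg hc]
    nlinarith [abs_nonneg p.1, mul_nonneg hc (abs_nonneg p.2),
      mul_nonneg (abs_nonneg p.1) (mul_nonneg hc (abs_nonneg p.2))]
  rw [norm_pow]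
  have hp2 : 0 ≤ c * |p.2| := mul_nonneg hc (abs_nonneg _)
  calc _ ≤ ((1 + |p.1|) * (1 + c * |p.2|)) ^ n := by gcongr
    _ = (1 + |p.1|) ^ n * ((1 + c * |p.2|) ^ n * 1) := by rw [mul_pow, mul_one]
    _ ≤ _ := by
      gcongr
      exact Real.one_le_exp (by positivity)

/-- Hermite expansion of the truncated density ratio, to any order. -/
lemma exists_norm_truncatedRatio_sub_le {ν : Measure ℝ} [IsProbabilityMeasure ν]
    (hν : ∀ n : ℕ, MemLp id (n : ℝ≥0∞) ν) {c : ℝ} (hc : 0 ≤ c) (N : ℕ) :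
    ∃ C : ℝ, 0 ≤ C ∧ ∀ ε x : ℝ, 0 < ε → ε ≤ 1 → ε * c ≤ 1 / 64 →
      ‖(truncatedRatio ν (c ^ 2) ε x : ℂ)
        - ∑ n ∈ Finset.range (N + 2), (hermiteCoeff x n : ℂ) * ε ^ n * deconvolvedMoment ν c n‖
        ≤ C * ε ^ (N + 2) * Real.exp (x ^ 2 / 32) := by
  set π := ν.prod (gaussianReal 0 1) with hπ
  set B : ℝ × ℝ → ℝ := fun p =>
    (1 + |p.1|) ^ (2 * N + 4) * ((1 + c * |p.2|) ^ (2 * N + 4) * Real.exp (p.2 ^ 2 / 16)) with hB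
  have hBint : Integrable B π := integrable_deconvolved_bound hν (2 * N + 4) hc
  have hB0 : 0 ≤ ∫ p, B p ∂π := integral_nonneg fun p => by
    have : 0 ≤ c * |p.2| := mul_nonneg hc (abs_nonneg _)
    positivity
  refine ⟨4 * (N + 2) * (N + 2).factorial * Real.exp 147 * ∫ p, B p ∂π, by positivity, ?_⟩
  intro ε x hε hε1 hεc
  set T : ℝ × ℝ → ℂ := fun p => if |ε * p.1| ≤ 1 then Complex.exp
        (x * (ε * (p.1 - Complex.I * c * p.2)) - (ε * (p.1 - Complex.I * c * p.2)) ^ 2 / 2)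
        else 0 with hT
  set S : ℝ × ℝ → ℂ := fun p => hermiteSum x (N + 1) (ε * (p.1 - Complex.I * c * p.2)) with hS
  set K := ε ^ (N + 2) * (4 * (N + 2) * (N + 2).factorial * Real.exp 147) * Real.exp (x ^ 2 / 32)
    with hK
  have hle : ∀ p, ‖T p - S p‖ ≤ K * B p := fun p =>
    norm_truncated_exp_sub_hermiteSum_le N hc hε hε1 hεc x p.1 p.2
  have hSeq : ∀ p, S p = ∑ n ∈ Finset.range (N + 2),
      ((hermiteCoeff x n : ℂ) * ε ^ n) * ((p.1 : ℂ) - Complex.I * c * p.2) ^ n := by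
    intro p
    simp only [hS, hermiteSum]
    refine Finset.sum_congr rfl fun n _ => ?_
    rw [mul_pow]; ring
  have hSint : Integrable S π := by
    rw [show S = _ from funext hSeq]
    exact integrable_finsetSum _ fun n _ => (integrable_deconvolved_pow hν n hc).const_mul _
  have hTm : Measurable T := by
    refine Measurable.ite (measurableSet_le (by fun_prop) measurable_const) ?_ measurable_const
    fun_prop
  have hdiff : Integrable (fun p => T p - S p) π :=
    (hBint.const_mul K).mono' (hTm.aestronglyMeasurable.sub hSint.aestronglyMeasurable)
      (ae_of_all _ hle)
  have hTint : Integrable T π := by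
    have := hdiff.add hSint
    refine this.congr (ae_of_all _ fun p => ?_)
    simp
  have hTeq : ∫ p, T p ∂π = (truncatedRatio ν (c ^ 2) ε x : ℂ) := by
    -- Fubini: integrating out the Gaussian coordinate first turns the complex exponential into the
    -- real kernel. The truncation depends on z alone, so it passes through the inner integral.
    rw [hπ, integral_prod _ hTint, truncatedRatio, ← integral_complex_ofReal]
    refine integral_congr_ae (ae_of_all _ fun z => ?_)
    simp only [hT]
    split_ifs with h
    · refine integral_cexp_hermite_generating ?_ x z
      have : c * ε ≤ 1 / 64 := by linarith
      have h0 : 0 ≤ c * ε := by positivity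
      nlinarith
    · simp
  have hSi : ∫ p, S p ∂π
      = ∑ n ∈ Finset.range (N + 2), (hermiteCoeff x n : ℂ) * ε ^ n * deconvolvedMoment ν c n := by
    rw [show S = _ from funext hSeq,
      integral_finsetSum _ fun n _ => (integrable_deconvolved_pow hν n hc).const_mul _]
    refine Finset.sum_congr rfl fun n _ => ?_
    rw [integral_const_mul, deconvolvedMoment]
  rw [← hTeq, ← hSi, ← integral_sub hTint hSint]
  refine (norm_integral_le_of_norm_le (hBint.const_mul K) (ae_of_all _ hle)).trans (le_of_eq ?_)
  rw [integral_const_mul, hK]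
  ring

/-! ### Elementary inequalities for the function x log x. -/

/-- Fourth order Taylor expansion of `(1 + r) log (1 + r)`, valid on the whole domain. -/
lemma abs_one_add_mul_log_sub_le {r : ℝ} (hr : -1 ≤ r) :
    |(1 + r) * Real.log (1 + r) - (r + r ^ 2 / 2 - r ^ 3 / 6 + r ^ 4 / 12)| ≤ 100 * |r| ^ 5 := by
  by_cases h : |r| ≤ 1 / 2
  · have h1 := Real.abs_log_sub_add_sum_range_le (x := -r) (by rw [abs_neg]; linarith) 4
    simp only [Finset.sum_range_succ, Finset.sum_range_zero, abs_neg] at h1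
    norm_num at h1
    set e := -r + r ^ 2 / 2 + (-r) ^ 3 / 3 + r ^ 4 / 4 + Real.log (1 + r) with he
    have h2 : |r| ^ 5 / (1 - |r|) ≤ 2 * |r| ^ 5 := by
      rw [div_le_iff₀ (by linarith)]
      have : 0 ≤ |r| ^ 5 := by positivity
      nlinarith
    have h3 : (1 + r) * Real.log (1 + r) - (r + r ^ 2 / 2 - r ^ 3 / 6 + r ^ 4 / 12)
        = (1 + r) * e - r ^ 5 / 4 := by rw [he]; ring
    have h4 : |e| ≤ 2 * |r| ^ 5 := by
      refine le_trans ?_ h2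
      convert h1 using 2
    rw [h3]
    refine (abs_sub _ _).trans ?_
    rw [abs_mul, abs_div, abs_pow]
    have h5 : |1 + r| ≤ 2 := by
      rw [abs_le] at h ⊢; constructor <;> linarith [h.1, h.2]
    have h6 : |1 + r| * |e| ≤ 2 * (2 * |r| ^ 5) := by gcongr
    have : 0 ≤ |r| ^ 5 := by positivity
    norm_num
    linarith
  -- Away from 0 no cancellation is needed: |r|⁵ ≥ 1/32, each term is bounded separately, and the
  -- constant 100 absorbs them all. The endpoint r = −1 relies on `Real.log 0 = 0`.
  · rcases lt_or_ge r 0 with h0 | h0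
    · have hr2 : 1 / 2 ≤ -r := by rw [abs_of_neg h0] at h; linarith
      set y := 1 + r with hy
      have hy0 : 0 ≤ y := by linarith
      have h1 : y * Real.log y ≤ 0 := Real.mul_log_nonpos hy0 (by linarith)
      have h2 := klFun_nonneg hy0
      rw [klFun_apply] at h2
      have e5 : (1 / 2 : ℝ) ^ 5 ≤ |r| ^ 5 := by
        gcongr; rw [abs_of_neg h0]; exact hr2
      have p2 : r ^ 2 ≤ 1 := by nlinarith
      have p20 : 0 ≤ r ^ 2 := by positivity
      have p3 : -1 ≤ r ^ 3 := by nlinarith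
      have p30 : r ^ 3 ≤ 0 := by nlinarith
      have p4 : r ^ 4 ≤ 1 := by nlinarith
      have p40 : 0 ≤ r ^ 4 := by positivity
      norm_num at e5
      rw [abs_le]
      constructor <;> linarith
    · have hr2 : 1 / 2 ≤ r := by rw [abs_of_nonneg h0] at h; linarith
      rw [abs_of_nonneg h0]
      have h1 : Real.log (1 + r) ≤ r := by
        have := Real.log_le_sub_one_of_pos (show 0 < 1 + r by linarith); linarith
      have h2 : 0 ≤ Real.log (1 + r) := Real.log_nonneg (by linarith)
      have h3 : (1 + r) * Real.log (1 + r) ≤ (1 + r) * r := by gcongr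
      have h4 : 0 ≤ (1 + r) * Real.log (1 + r) := by positivity
      have q1 : r ≤ 2 * r ^ 2 := by nlinarith
      have q2 : r ^ 2 ≤ 2 * r ^ 3 := by nlinarith [sq_nonneg r]
      have q3 : r ^ 3 ≤ 2 * r ^ 4 := by nlinarith [pow_nonneg h0 3]
      have q4 : r ^ 4 ≤ 2 * r ^ 5 := by nlinarith [pow_nonneg h0 4]
      have q0 : 0 ≤ r ^ 2 := by positivity
      rw [abs_le]
      constructor <;> nlinarith

/-- Removing a part `b` from `a + b` changes `x log x` by at most `b (|log (a + b)| + 1)`. -/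
lemma abs_mul_log_sub_mul_log_le {a b : ℝ} (ha : 0 ≤ a) (hb : 0 ≤ b) :
    |(a + b) * Real.log (a + b) - a * Real.log a| ≤ b * (|Real.log (a + b)| + 1) := by
  -- The case a = 0 is separate because the quotient (a + b)/a is used below.
  rcases ha.eq_or_lt with rfl | ha
  · simp only [zero_add, zero_mul, sub_zero, abs_mul, abs_of_nonneg hb]
    nlinarith [abs_nonneg (Real.log b)]
  have hab : 0 < a + b := by linarith
  have h1 : (a + b) * Real.log (a + b) - a * Real.log a
      = b * Real.log (a + b) + a * (Real.log (a + b) - Real.log a) := by ring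
  have h2 : 0 ≤ Real.log (a + b) - Real.log a :=
    sub_nonneg.mpr (Real.log_le_log ha (by linarith))
  have h3 : a * (Real.log (a + b) - Real.log a) ≤ b := by
    rw [← Real.log_div hab.ne' ha.ne']
    have := Real.log_le_sub_one_of_pos (show 0 < (a + b) / a by positivity)
    calc a * Real.log ((a + b) / a) ≤ a * ((a + b) / a - 1) := by gcongr
      _ = b := by field_simp; ring
  rw [h1]
  refine (abs_add_le _ _).trans ?_
  rw [abs_mul, abs_of_nonneg hb, abs_of_nonneg (mul_nonneg ha.le h2)]
  linarith

/-! ### The kernel as a ratio of Gaussian densities. -/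

section Kernel

variable {v ε : ℝ}

lemma ratioKernel_nonneg (v ε x z : ℝ) : 0 ≤ ratioKernel v ε x z := by
  unfold ratioKernel
  positivity

/-- Completing the square, the exponent is x²/2 − (x − εz)²/(2(1 − vε²)). The bound does not depend
on z, so the kernel is integrable against any probability law of z. -/
lemma ratioKernel_le (h : v * ε ^ 2 < 1) (x z : ℝ) :
    ratioKernel v ε x z ≤ (Real.sqrt (1 - v * ε ^ 2))⁻¹ * Real.exp (x ^ 2 / 2) := by
  unfold ratioKernel
  refine mul_le_mul_of_nonneg_left (Real.exp_le_exp.mpr ?_) (by positivity)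
  rw [div_le_iff₀ (by linarith)]
  nlinarith [sq_nonneg (x - ε * z)]

lemma continuous_ratioKernel (v ε : ℝ) :
    Continuous (fun p : ℝ × ℝ => ratioKernel v ε p.2 p.1) := by
  unfold ratioKernel
  fun_prop

lemma gaussianPDFReal_eq_ratioKernel_mul (h : v * ε ^ 2 < 1) (x z : ℝ) :
    gaussianPDFReal (ε * z) (Real.toNNReal (1 - v * ε ^ 2)) x
      = ratioKernel v ε x z * gaussianPDFReal 0 1 x := by
  have hu : 0 < 1 - v * ε ^ 2 := by linarith
  rw [gaussianPDFReal_zero_one, gaussianPDFReal, Real.coe_toNNReal _ hu.le, ratioKernel,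
    Real.sqrt_mul (by positivity)]
  have : Real.exp (-(x - ε * z) ^ 2 / (2 * (1 - v * ε ^ 2)))
      = Real.exp ((-(v * ε ^ 2 * x ^ 2) + 2 * ε * x * z - ε ^ 2 * z ^ 2) / (2 * (1 - v * ε ^ 2)))
        * Real.exp (-x ^ 2 / 2) := by
    rw [← Real.exp_add]
    congr 1
    rw [div_add_div _ _ (by positivity) two_ne_zero, div_eq_div_iff (by positivity) (by positivity)]
    ring
  rw [this, mul_inv]
  ring

lemma gaussianReal_eq_withDensity_ratioKernel (h : v * ε ^ 2 < 1) (z : ℝ) :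
    gaussianReal (ε * z) (Real.toNNReal (1 - v * ε ^ 2))
      = (gaussianReal 0 1).withDensity (fun x => ENNReal.ofReal (ratioKernel v ε x z)) := by
  have hu : 0 < 1 - v * ε ^ 2 := by linarith
  have hm : Measurable fun x => ENNReal.ofReal (ratioKernel v ε x z) := by
    unfold ratioKernel; fun_prop
  rw [gaussianReal_of_var_ne_zero _ (by simpa using hu), gaussianReal_zero_one_eq_withDensity,
    ← withDensity_mul _ (measurable_gaussianPDF 0 1) hm]
  congr 1
  funext x
  simp only [gaussianPDF, Pi.mul_apply]
  rw [gaussianPDFReal_eq_ratioKernel_mul h, ENNReal.ofReal_mul (ratioKernel_nonneg _ _ _ _), mul_comm]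

lemma integral_ratioKernel_mul (h : v * ε ^ 2 < 1) (z : ℝ) (f : ℝ → ℝ) :
    ∫ x, ratioKernel v ε x z * f x ∂(gaussianReal 0 1)
      = ∫ x, f x ∂(gaussianReal (ε * z) (Real.toNNReal (1 - v * ε ^ 2))) := by
  have hm : Measurable fun x => ratioKernel v ε x z := by
    unfold ratioKernel; fun_prop
  rw [gaussianReal_eq_withDensity_ratioKernel h,
    integral_withDensity_eq_integral_toReal_smul (by fun_prop) (by simp)]
  refine integral_congr_ae (ae_of_all _ fun x => ?_)
  simp [ENNReal.toReal_ofReal (ratioKernel_nonneg _ _ _ _)]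

lemma integrable_ratioKernel_mul_iff (h : v * ε ^ 2 < 1) (z : ℝ) (f : ℝ → ℝ) :
    Integrable (fun x => ratioKernel v ε x z * f x) (gaussianReal 0 1)
      ↔ Integrable f (gaussianReal (ε * z) (Real.toNNReal (1 - v * ε ^ 2))) := by
  have hm : Measurable fun x => ratioKernel v ε x z := by
    unfold ratioKernel; fun_prop
  rw [gaussianReal_eq_withDensity_ratioKernel h,
    integrable_withDensity_iff_integrable_smul' (by fun_prop) (by simp)]
  simp [ENNReal.toReal_ofReal (ratioKernel_nonneg _ _ _ _)]

lemma integrable_sq_gaussianReal (m : ℝ) (u : ℝ≥0) :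
    Integrable (fun x => x ^ 2) (gaussianReal m u) :=
  (memLp_id_gaussianReal (μ := m) (v := u) 2).integrable_sq

lemma integral_sq_gaussianReal (m : ℝ) (u : ℝ≥0) :
    ∫ x, x ^ 2 ∂(gaussianReal m u) = u + m ^ 2 := by
  have h := variance_eq_sub (memLp_id_gaussianReal (μ := m) (v := u) 2)
  rw [variance_id_gaussianReal] at h
  simp only [id_eq, integral_id_gaussianReal, Pi.pow_apply] at h
  linarith

lemma integrable_ratioKernel_mul_one_add_sq (h : v * ε ^ 2 < 1) (z : ℝ) :
    Integrable (fun x => ratioKernel v ε x z * (1 + x ^ 2)) (gaussianReal 0 1) := by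
  rw [integrable_ratioKernel_mul_iff h]
  exact (integrable_const 1).add (integrable_sq_gaussianReal _ _)

/-- Weighted by the kernel, x has the Gaussian law with mean εz and variance 1 − vε². The weight 1 +
x² is used throughout because it dominates |log ρ|. -/
lemma integral_ratioKernel_mul_one_add_sq (h : v * ε ^ 2 < 1) (z : ℝ) :
    ∫ x, ratioKernel v ε x z * (1 + x ^ 2) ∂(gaussianReal 0 1)
      = 1 + (1 - v * ε ^ 2) + ε ^ 2 * z ^ 2 := by
  rw [integral_ratioKernel_mul h, integral_add (integrable_const 1) (integrable_sq_gaussianReal _ _),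
    integral_sq_gaussianReal, Real.coe_toNNReal _ (by linarith)]
  simp
  ring

end Kernel

/-! ### The density ratio: two-sided bounds and the cost of truncation. -/

/-- The density, relative to the standard Gaussian law, of `ε Z + N`, where `Z` has law `ν` and `N`
is an independent centered Gaussian variable with variance `1 - v ε ^ 2`. -/
noncomputable def gaussianRatio (ν : Measure ℝ) (v ε x : ℝ) : ℝ := ∫ z, ratioKernel v ε x z ∂ν

section Ratio

variable {ν : Measure ℝ} [IsProbabilityMeasure ν] {v ε : ℝ}

lemma integrable_ratioKernel (h : v * ε ^ 2 < 1) (x : ℝ) :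
    Integrable (fun z => ratioKernel v ε x z) ν := by
  refine (integrable_const ((Real.sqrt (1 - v * ε ^ 2))⁻¹ * Real.exp (x ^ 2 / 2))).mono' ?_
    (ae_of_all _ fun z => ?_)
  · exact (Measurable.aestronglyMeasurable (by unfold ratioKernel; fun_prop))
  · rw [Real.norm_of_nonneg (ratioKernel_nonneg _ _ _ _)]
    exact ratioKernel_le h x z

lemma gaussianRatio_le (h : v * ε ^ 2 < 1) (x : ℝ) :
    gaussianRatio ν v ε x ≤ (Real.sqrt (1 - v * ε ^ 2))⁻¹ * Real.exp (x ^ 2 / 2) := by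
  have := integral_mono (integrable_ratioKernel (ν := ν) h x) (integrable_const _)
    (fun z => ratioKernel_le h x z)
  simpa [gaussianRatio] using this

/-- Lower bound for the density ratio, by Jensen's inequality. -/
lemma exp_le_gaussianRatio (hν : MemLp id 2 ν) (hm : ∫ z, z ∂ν = 0)
    (hv : ∫ z, z ^ 2 ∂ν = v) (h : v * ε ^ 2 < 1) (x : ℝ) :
    Real.exp (-((v * ε ^ 2) / (2 * (1 - v * ε ^ 2)) * (1 + x ^ 2))) ≤ gaussianRatio ν v ε x := by
  set u := 1 - v * ε ^ 2 with hu
  have hu0 : 0 < u := by rw [hu]; linarith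
  have hv0 : 0 ≤ v := hv ▸ integral_nonneg fun z => sq_nonneg z
  have hu1 : u ≤ 1 := by rw [hu]; nlinarith [mul_nonneg hv0 (sq_nonneg ε)]
  set f : ℝ → ℝ := fun z =>
    (-(v * ε ^ 2 * x ^ 2) + 2 * ε * x * z - ε ^ 2 * z ^ 2) / (2 * u) with hf
  have hi1 : Integrable (fun z : ℝ => z) ν := hν.integrable (by norm_num)
  have hi2 : Integrable (fun z : ℝ => z ^ 2) ν := hν.integrable_sq
  have hfi : Integrable f ν :=
    ((((integrable_const _).add (hi1.const_mul _)).sub (hi2.const_mul _)).div_const _)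
  have hsq : 0 < Real.sqrt u := Real.sqrt_pos.mpr hu0
  have hgi : Integrable (Real.exp ∘ f) ν := by
    refine ((integrable_ratioKernel (ν := ν) h x).const_mul (Real.sqrt u)).congr
      (ae_of_all _ fun z => ?_)
    simp only [ratioKernel, ← hu, Function.comp, hf]
    field_simp
  have hJ := ConvexOn.map_integral_le (μ := ν) convexOn_exp Real.continuous_exp.continuousOn
    isClosed_univ (ae_of_all _ fun _ => Set.mem_univ _) hfi hgi
  have hfint : ∫ z, f z ∂ν = -((v * ε ^ 2) / (2 * u) * (1 + x ^ 2)) := by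
    have hi3 : Integrable (fun z : ℝ => -(v * ε ^ 2 * x ^ 2) + 2 * ε * x * z) ν :=
      (integrable_const _).add (hi1.const_mul _)
    simp only [hf]
    rw [integral_div, integral_sub hi3 (hi2.const_mul _),
      integral_add (integrable_const _) (hi1.const_mul _), integral_const_mul, integral_const_mul,
      hm, hv]
    simp
    ring
  rw [hfint] at hJ
  refine hJ.trans ?_
  have h1 : gaussianRatio ν v ε x = (Real.sqrt u)⁻¹ * ∫ z, Real.exp (f z) ∂ν := by
    rw [gaussianRatio, ← integral_const_mul]
    rfl
  rw [h1]
  -- The prefactor u^(−1/2) is at least 1 because u ≤ 1, so it can be dropped.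
  refine le_mul_of_one_le_left (integral_nonneg fun z => (Real.exp_nonneg _)) ?_
  exact (one_le_inv₀ hsq).mpr (Real.sqrt_le_one.mpr hu1)

lemma gaussianRatio_pos (hν : MemLp id 2 ν) (hm : ∫ z, z ∂ν = 0)
    (hv : ∫ z, z ^ 2 ∂ν = v) (h : v * ε ^ 2 < 1) (x : ℝ) : 0 < gaussianRatio ν v ε x :=
  (Real.exp_pos _).trans_le (exp_le_gaussianRatio hν hm hv h x)

/-- Jensen's inequality gives the lower side and the uniform bound on the kernel the upper side.
Quadratic growth of log ρ makes ρ log ρ integrable using two moments only. -/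
lemma abs_log_gaussianRatio_le (hν : MemLp id 2 ν) (hm : ∫ z, z ∂ν = 0)
    (hv : ∫ z, z ^ 2 ∂ν = v) (h : v * ε ^ 2 < 1) (x : ℝ) :
    |Real.log (gaussianRatio ν v ε x)| ≤ (1 - v * ε ^ 2)⁻¹ * (1 + x ^ 2) := by
  have hpos := gaussianRatio_pos hν hm hv h x
  have hlow := (Real.le_log_iff_exp_le hpos).mpr (exp_le_gaussianRatio hν hm hv h x)
  have hup := Real.log_le_log hpos (gaussianRatio_le (ν := ν) h x)
  set u := 1 - v * ε ^ 2 with hu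
  have hu0 : 0 < u := by rw [hu]; linarith
  have hv0 : 0 ≤ v := hv ▸ integral_nonneg fun z => sq_nonneg z
  have hu1 : u ≤ 1 := by rw [hu]; nlinarith [mul_nonneg hv0 (sq_nonneg ε)]
  have hsq : 0 < Real.sqrt u := Real.sqrt_pos.mpr hu0
  have hinv : 1 ≤ u⁻¹ := (one_le_inv₀ hu0).mpr hu1
  rw [Real.log_mul (inv_ne_zero hsq.ne') (Real.exp_ne_zero _), Real.log_exp, Real.log_inv,
    Real.log_sqrt hu0.le] at hup
  have hlogu : -Real.log u ≤ u⁻¹ - 1 := by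
    rw [← Real.log_inv]
    exact Real.log_le_sub_one_of_pos (inv_pos.mpr hu0)
  have h1 : (v * ε ^ 2) / (2 * u) ≤ u⁻¹ := by
    rw [div_le_iff₀ (by positivity), show u⁻¹ * (2 * u) = 2 by field_simp]
    linarith
  rw [abs_le]
  constructor
  · refine le_trans ?_ hlow
    have : v * ε ^ 2 / (2 * u) * (1 + x ^ 2) ≤ u⁻¹ * (1 + x ^ 2) := by gcongr
    linarith
  · refine hup.trans ?_
    nlinarith [sq_nonneg x]

lemma integrable_prod_ratioKernel_mul_one_add_sq (hν : MemLp id 2 ν) (h : v * ε ^ 2 < 1) :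
    Integrable (fun p : ℝ × ℝ => ratioKernel v ε p.2 p.1 * (1 + p.2 ^ 2))
      (ν.prod (gaussianReal 0 1)) := by
  rw [integrable_prod_iff]
  · refine ⟨ae_of_all _ fun z => integrable_ratioKernel_mul_one_add_sq h z, ?_⟩
    have : (fun z => ∫ x, ‖ratioKernel v ε x z * (1 + x ^ 2)‖ ∂(gaussianReal 0 1))
        = fun z => 1 + (1 - v * ε ^ 2) + ε ^ 2 * z ^ 2 := by
      funext z
      rw [← integral_ratioKernel_mul_one_add_sq h z]
      refine integral_congr_ae (ae_of_all _ fun x => ?_)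
      simp only
      rw [Real.norm_of_nonneg (mul_nonneg (ratioKernel_nonneg _ _ _ _) (by positivity))]
    simp only
    rw [this]
    exact (integrable_const _).add (hν.integrable_sq.const_mul _)
  · exact ((continuous_ratioKernel v ε).mul (by fun_prop)).aestronglyMeasurable

lemma measurable_gaussianRatio (ν : Measure ℝ) [IsProbabilityMeasure ν] (v ε : ℝ) :
    Measurable (gaussianRatio ν v ε) := by
  have h : StronglyMeasurable (fun p : ℝ × ℝ => ratioKernel v ε p.1 p.2) :=
    ((continuous_ratioKernel v ε).comp continuous_swap).stronglyMeasurable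
  exact h.integral_prod_right.measurable

lemma measurable_ite_ratioKernel (v ε : ℝ) :
    Measurable (fun p : ℝ × ℝ => if |ε * p.2| ≤ 1 then ratioKernel v ε p.1 p.2 else 0) := by
  refine Measurable.ite (measurableSet_le (by fun_prop) measurable_const) ?_ measurable_const
  exact ((continuous_ratioKernel v ε).comp continuous_swap).measurable

lemma measurable_truncatedRatio (ν : Measure ℝ) [IsProbabilityMeasure ν] (v ε : ℝ) :
    Measurable (truncatedRatio ν v ε) :=
  (measurable_ite_ratioKernel v ε).stronglyMeasurable.integral_prod_right.measurable

lemma integrable_gaussianRatio_mul_one_add_sq (hν : MemLp id 2 ν) (h : v * ε ^ 2 < 1) :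
    Integrable (fun x => gaussianRatio ν v ε x * (1 + x ^ 2)) (gaussianReal 0 1) := by
  have := (integrable_prod_ratioKernel_mul_one_add_sq (ν := ν) hν h).integral_prod_right
  refine this.congr (ae_of_all _ fun x => ?_)
  simp only [gaussianRatio]
  rw [integral_mul_const]

lemma integrable_gaussianRatio_mul_log (hν : MemLp id 2 ν) (hm : ∫ z, z ∂ν = 0)
    (hv : ∫ z, z ^ 2 ∂ν = v) (h : v * ε ^ 2 < 1) :
    Integrable (fun x => gaussianRatio ν v ε x * Real.log (gaussianRatio ν v ε x))
      (gaussianReal 0 1) := by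
  refine ((integrable_gaussianRatio_mul_one_add_sq hν h).const_mul (1 - v * ε ^ 2)⁻¹).mono' ?_
    (ae_of_all _ fun x => ?_)
  · exact ((measurable_gaussianRatio ν v ε).mul
      (measurable_gaussianRatio ν v ε).log).aestronglyMeasurable
  · rw [norm_mul, Real.norm_of_nonneg (gaussianRatio_pos hν hm hv h x).le, Real.norm_eq_abs]
    have h1 := abs_log_gaussianRatio_le hν hm hv h x
    have h2 := (gaussianRatio_pos hν hm hv h x).le
    calc _ ≤ gaussianRatio ν v ε x * ((1 - v * ε ^ 2)⁻¹ * (1 + x ^ 2)) := by gcongr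
      _ = _ := by ring

lemma truncatedRatio_nonneg (ν : Measure ℝ) (v ε x : ℝ) : 0 ≤ truncatedRatio ν v ε x :=
  integral_nonneg fun z => by
    simp only
    split_ifs
    · exact ratioKernel_nonneg _ _ _ _
    · exact le_rfl

lemma truncatedRatio_add (h : v * ε ^ 2 < 1) (x : ℝ) :
    truncatedRatio ν v ε x + ∫ z, (if |ε * z| ≤ 1 then 0 else ratioKernel v ε x z) ∂ν
      = gaussianRatio ν v ε x := by
  have hi := integrable_ratioKernel (ν := ν) h x
  have hs : MeasurableSet {z : ℝ | |ε * z| ≤ 1} :=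
    measurableSet_le (by fun_prop) measurable_const
  rw [truncatedRatio, gaussianRatio, ← integral_add]
  · refine integral_congr_ae (ae_of_all _ fun z => ?_)
    simp only
    split_ifs <;> simp
  · refine (hi.indicator hs).congr (ae_of_all _ fun z => ?_)
    simp [Set.indicator_apply]
  · refine (hi.indicator hs.compl).congr (ae_of_all _ fun z => ?_)
    by_cases hz : |ε * z| ≤ 1 <;>
      simp only [Set.indicator_apply, Set.mem_compl_iff, Set.mem_ofPred_eq, hz, not_true_eq_false,
        not_false_eq_true, if_true, if_false]

/-- Truncating `ε Z` to `[-1, 1]` changes the divergence by a negligible amount. -/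
lemma abs_integral_mul_log_sub_truncated_le (hν : ∀ n : ℕ, MemLp id (n : ℝ≥0∞) ν)
    (hm : ∫ z, z ∂ν = 0) (hv : ∫ z, z ^ 2 ∂ν = v) (h : v * ε ^ 2 ≤ 1 / 2) :
    Integrable (fun x => truncatedRatio ν v ε x * Real.log (truncatedRatio ν v ε x))
      (gaussianReal 0 1) ∧
    |∫ x, gaussianRatio ν v ε x * Real.log (gaussianRatio ν v ε x) ∂(gaussianReal 0 1)
      - ∫ x, truncatedRatio ν v ε x * Real.log (truncatedRatio ν v ε x) ∂(gaussianReal 0 1)|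
      ≤ 9 * (∫ z, z ^ 14 ∂ν) * ε ^ 14 := by
  have h1 : v * ε ^ 2 < 1 := by linarith
  have hν2 : MemLp id 2 ν := by exact_mod_cast hν 2
  have hv0 : 0 ≤ v := hv ▸ integral_nonneg fun z => sq_nonneg z
  have hvε : 0 ≤ v * ε ^ 2 := by positivity
  set ρ := gaussianRatio ν v ε with hρ
  set ρ₁ := truncatedRatio ν v ε with hρ₁
  set ρ₂ : ℝ → ℝ := fun x => ∫ z, (if |ε * z| ≤ 1 then 0 else ratioKernel v ε x z) ∂ν with hρ₂
  have hsum : ∀ x, ρ₁ x + ρ₂ x = ρ x := fun x => truncatedRatio_add h1 x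
  have hρ₂0 : ∀ x, 0 ≤ ρ₂ x := fun x => integral_nonneg fun z => by
    simp only
    split_ifs
    · exact le_rfl
    · exact ratioKernel_nonneg _ _ _ _
  -- The factor 3 collects |log ρ| ≤ 2(1 + x²), valid since vε² ≤ 1/2, and the additional 1 ≤ 1 +
  -- x².
  have hpt : ∀ x, |ρ x * Real.log (ρ x) - ρ₁ x * Real.log (ρ₁ x)| ≤ 3 * (ρ₂ x * (1 + x ^ 2)) := by
    intro x
    have e1 := abs_mul_log_sub_mul_log_le (truncatedRatio_nonneg ν v ε x) (hρ₂0 x)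
    rw [← hρ₁, hsum x] at e1
    have e2 := abs_log_gaussianRatio_le hν2 hm hv h1 x
    have e3 : (1 - v * ε ^ 2)⁻¹ ≤ 2 := by
      rw [inv_le_comm₀ (by linarith) two_pos]; linarith
    have e4 : (1 - v * ε ^ 2)⁻¹ * (1 + x ^ 2) ≤ 2 * (1 + x ^ 2) := by gcongr
    calc _ ≤ ρ₂ x * (|Real.log (ρ x)| + 1) := e1
      _ ≤ ρ₂ x * (2 * (1 + x ^ 2) + (1 + x ^ 2)) := by
          refine mul_le_mul_of_nonneg_left (add_le_add (e2.trans e4) ?_) (hρ₂0 x)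
          nlinarith [sq_nonneg x]
      _ = _ := by ring
  set F : ℝ × ℝ → ℝ := fun p =>
    (if |ε * p.1| ≤ 1 then 0 else ratioKernel v ε p.2 p.1) * (1 + p.2 ^ 2) with hF
  have hset : MeasurableSet {p : ℝ × ℝ | |ε * p.1| ≤ 1} :=
    measurableSet_le (by fun_prop) measurable_const
  have hFint : Integrable F (ν.prod (gaussianReal 0 1)) := by
    refine ((integrable_prod_ratioKernel_mul_one_add_sq (ν := ν) hν2 h1).indicator
      hset.compl).congr (ae_of_all _ fun p => ?_)
    by_cases hz : |ε * p.1| ≤ 1 <;>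
      simp only [Set.indicator_apply, Set.mem_compl_iff, Set.mem_ofPred_eq, hF, hz,
        not_true_eq_false, not_false_eq_true, if_true, if_false, zero_mul]
  have hρ₂eq : ∀ x, ρ₂ x * (1 + x ^ 2) = ∫ z, F (z, x) ∂ν := by
    intro x
    simp only [hF, hρ₂]
    rw [integral_mul_const]
  have hρ₂int : Integrable (fun x => ρ₂ x * (1 + x ^ 2)) (gaussianReal 0 1) := by
    simp_rw [hρ₂eq]
    exact hFint.integral_prod_right
  have hpow : Integrable (fun z : ℝ => z ^ 14) ν := by
    have := (hν 14).integrable_norm_pow (p := 14) (by norm_num)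
    refine this.congr (ae_of_all _ fun z => ?_)
    simp only [id_eq, Real.norm_eq_abs]
    exact (show Even 14 by decide).pow_abs z
  have hρ₂val : ∫ x, ρ₂ x * (1 + x ^ 2) ∂(gaussianReal 0 1) ≤ 3 * (∫ z, z ^ 14 ∂ν) * ε ^ 14 := by
    simp_rw [hρ₂eq]
    rw [← integral_integral_swap hFint]
    have : 3 * (∫ z, z ^ 14 ∂ν) * ε ^ 14 = ∫ z, 3 * ε ^ 14 * z ^ 14 ∂ν := by
      rw [integral_const_mul]; ring
    rw [this]
    refine integral_mono hFint.integral_prod_left (hpow.const_mul _) fun z => ?_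
    simp only [hF]
    have hev : 0 ≤ 3 * ε ^ 14 * z ^ 14 := by positivity
    split_ifs with hz
    · simpa using hev
    · rw [integral_ratioKernel_mul_one_add_sq h1]
      have hz1 : 1 ≤ (ε * z) ^ 2 := by
        rw [← sq_abs]
        exact one_le_pow₀ (by linarith)
      -- A Chebyshev argument: where |εz| > 1, the quantity 1 + (1 − vε²) + (εz)² is at most 3(εz)²
      -- ≤ 3(εz)¹⁴. With the earlier factor 3 this yields the constant 9.
      have hz2 : (ε * z) ^ 2 ≤ ((ε * z) ^ 2) ^ 7 := le_self_pow₀ hz1 (by norm_num)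
      have hz3 : 3 * ε ^ 14 * z ^ 14 = 3 * ((ε * z) ^ 2) ^ 7 := by ring
      rw [hz3]
      have : ε ^ 2 * z ^ 2 = (ε * z) ^ 2 := by ring
      linarith
  have hρint := integrable_gaussianRatio_mul_log hν2 hm hv h1
  have hdiff : Integrable (fun x => ρ x * Real.log (ρ x) - ρ₁ x * Real.log (ρ₁ x))
      (gaussianReal 0 1) := by
    refine (hρ₂int.const_mul 3).mono' ?_ (ae_of_all _ hpt)
    exact (((measurable_gaussianRatio ν v ε).mul (measurable_gaussianRatio ν v ε).log).sub
      ((measurable_truncatedRatio ν v ε).mul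
        (measurable_truncatedRatio ν v ε).log)).aestronglyMeasurable
  have hρ₁int : Integrable (fun x => ρ₁ x * Real.log (ρ₁ x)) (gaussianReal 0 1) := by
    refine (hρint.sub hdiff).congr (ae_of_all _ fun x => ?_)
    simp [hρ]
  refine ⟨hρ₁int, ?_⟩
  rw [← integral_sub hρint hρ₁int]
  rw [← Real.norm_eq_abs]
  refine (norm_integral_le_of_norm_le (hρ₂int.const_mul 3)
    (ae_of_all _ fun x => (Real.norm_eq_abs _).trans_le (hpt x))).trans ?_
  rw [integral_const_mul]
  linarith

end Ratio

/-! ### Reduction of the entropy integral to Gaussian functionals of Hermite sums. -/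

section Expansion

open Polynomial Topology

/-- The Hermite polynomial approximation `∑_{3 ≤ n ≤ N} m n ε ^ n He_n / n!` of the density ratio
minus one. -/
noncomputable def hermiteApprox (m : ℕ → ℝ) (N : ℕ) (ε : ℝ) : ℝ[X] :=
  ∑ n ∈ Finset.Icc 3 N, (m n / n.factorial * ε ^ n) • realHermite n

variable {ν : Measure ℝ} [IsProbabilityMeasure ν] {c : ℝ} {m : ℕ → ℝ}

/-- Because m₀ = 1 and m₁ = m₂ = 0, the general expansion minus 1 starts at n = 3. -/
lemma exists_abs_truncatedRatio_sub_hermiteApprox_le (hν : ∀ n : ℕ, MemLp id (n : ℝ≥0∞) ν)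
    (hc : 0 ≤ c) (hm : ∀ n, deconvolvedMoment ν c n = (m n : ℂ)) (h0 : m 0 = 1) (h1 : m 1 = 0)
    (h2 : m 2 = 0) {N : ℕ} (hN : 2 ≤ N) :
    ∃ C : ℝ, 0 ≤ C ∧ ∀ ε x : ℝ, 0 < ε → ε ≤ 1 → ε * c ≤ 1 / 64 →
      |truncatedRatio ν (c ^ 2) ε x - 1 - (hermiteApprox m N ε).eval x|
        ≤ C * ε ^ (N + 1) * Real.exp (x ^ 2 / 32) := by
  obtain ⟨K, rfl⟩ : ∃ K, N = K + 1 := ⟨N - 1, by omega⟩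
  obtain ⟨C, hC0, hC⟩ := exists_norm_truncatedRatio_sub_le hν hc K
  refine ⟨C, hC0, fun ε x hε hε1 hεc => ?_⟩
  refine le_trans (le_of_eq ?_) (hC ε x hε hε1 hεc)
  have hsum : ∑ n ∈ Finset.range (K + 2), hermiteCoeff x n * ε ^ n * m n
      = 1 + (hermiteApprox m (K + 1) ε).eval x := by
    have e1 : Finset.range (K + 2) = {0, 1, 2} ∪ Finset.Icc 3 (K + 1) := by
      ext n
      simp only [Finset.mem_range, Finset.mem_union, Finset.mem_insert, Finset.mem_singleton,
        Finset.mem_Icc]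
      omega
    rw [e1, Finset.sum_union]
    · congr 1
      · simp [h0, h1, h2, hermiteCoeff_zero]
      · rw [hermiteApprox, eval_finsetSum]
        refine Finset.sum_congr rfl fun n _ => ?_
        rw [eval_smul, smul_eq_mul, hermiteCoeff]
        ring
    · rw [Finset.disjoint_left]
      intro n hn
      simp only [Finset.mem_insert, Finset.mem_singleton] at hn
      simp only [Finset.mem_Icc]
      omega
  rw [sub_sub, ← hsum, ← Real.norm_eq_abs, ← Complex.norm_real]
  congr 1
  push_cast
  congr 1
  refine Finset.sum_congr rfl fun n _ => ?_
  rw [hm]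

/-- This is where the exponent 1/32 pays off: k/32 ≤ 5/32 < 1/2, enough for the fifth power of the
remainder. -/
lemma integrable_exp_sq_div_pow {k : ℕ} (hk : k ≤ 5) :
    Integrable (fun x : ℝ => Real.exp (x ^ 2 / 32) ^ k) (gaussianReal 0 1) := by
  have hk' : (k : ℝ) ≤ 5 := by exact_mod_cast hk
  refine (integrable_exp_mul_sq_gaussianReal (a := k / 32) (by linarith)).congr
    (ae_of_all _ fun x => ?_)
  simp only
  rw [← Real.exp_nat_mul]
  ring_nf

/-- The moments of the truncated density ratio agree with those of its Hermite approximation. -/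
lemma exists_abs_integral_pow_sub_le (hν : ∀ n : ℕ, MemLp id (n : ℝ≥0∞) ν)
    (hc : 0 ≤ c) (hm : ∀ n, deconvolvedMoment ν c n = (m n : ℂ)) (h0 : m 0 = 1) (h1 : m 1 = 0)
    (h2 : m 2 = 0) {N k : ℕ} (hN : 2 ≤ N) (hk : k + 1 ≤ 5) :
    ∃ C : ℝ, 0 ≤ C ∧ ∀ ε : ℝ, 0 < ε → ε ≤ 1 → ε * c ≤ 1 / 64 →
      Integrable (fun x => (truncatedRatio ν (c ^ 2) ε x - 1) ^ (k + 1)) (gaussianReal 0 1) ∧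
      |∫ x, (truncatedRatio ν (c ^ 2) ε x - 1) ^ (k + 1) ∂(gaussianReal 0 1)
        - gaussianFunctional (hermiteApprox m N ε ^ (k + 1))| ≤ C * ε ^ (N + 1 + 3 * k) := by
  obtain ⟨C₁, hC₁0, hC₁⟩ := exists_abs_truncatedRatio_sub_hermiteApprox_le hν hc hm h0 h1 h2 hN
  -- With N = 2 the Hermite sum is empty, so this bounds the density ratio minus one itself, by a
  -- multiple of ε³.
  obtain ⟨C₂, hC₂0, hC₂⟩ :=
    exists_abs_truncatedRatio_sub_hermiteApprox_le hν hc hm h0 h1 h2 le_rfl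
  set J := ∫ x, Real.exp (x ^ 2 / 32) ^ (k + 1) ∂(gaussianReal 0 1) with hJ
  have hJ0 : 0 ≤ J := integral_nonneg fun x => by positivity
  refine ⟨C₁ * (k + 1) * (C₁ + C₂) ^ k * J, by positivity, fun ε hε hε1 hεc => ?_⟩
  set r : ℝ → ℝ := fun x => truncatedRatio ν (c ^ 2) ε x - 1 with hr
  set p : ℝ → ℝ := fun x => (hermiteApprox m N ε).eval x with hp
  have hrp : ∀ x, |r x - p x| ≤ C₁ * ε ^ (N + 1) * Real.exp (x ^ 2 / 32) := fun x =>
    hC₁ ε x hε hε1 hεc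
  have hr3 : ∀ x, |r x| ≤ C₂ * ε ^ 3 * Real.exp (x ^ 2 / 32) := fun x => by
    simpa [hermiteApprox] using hC₂ ε x hε hε1 hεc
  have hp3 : ∀ x, |p x| ≤ (C₁ + C₂) * ε ^ 3 * Real.exp (x ^ 2 / 32) := fun x => by
    have e1 : |p x| ≤ |r x - p x| + |r x| := by
      rw [abs_sub_comm]
      have := abs_add_le (p x - r x) (r x)
      simpa using this
    have e2 : ε ^ (N + 1) ≤ ε ^ 3 := pow_le_pow_of_le_one hε.le hε1 (by omega)
    have e3 : C₁ * ε ^ (N + 1) * Real.exp (x ^ 2 / 32) ≤ C₁ * ε ^ 3 * Real.exp (x ^ 2 / 32) := by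
      gcongr
    have := hrp x
    have := hr3 x
    linarith
  have hmax : ∀ x, max |r x| |p x| ≤ (C₁ + C₂) * ε ^ 3 * Real.exp (x ^ 2 / 32) := fun x => by
    refine max_le ((hr3 x).trans ?_) (hp3 x)
    gcongr
    linarith
  -- In the difference of (k+1)-th powers one factor is r − p, of order ε^(N+1), and the other k are
  -- of order ε³; together they give the exponent N + 1 + 3k.
  have hpow : ∀ x, |r x ^ (k + 1) - p x ^ (k + 1)|
      ≤ C₁ * (k + 1) * (C₁ + C₂) ^ k * ε ^ (N + 1 + 3 * k)
        * Real.exp (x ^ 2 / 32) ^ (k + 1) := fun x => by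
    refine (abs_pow_sub_pow_le (r x) (p x) (k + 1)).trans ?_
    rw [Nat.add_sub_cancel]
    have hb := hmax x
    have hb0 : 0 ≤ max |r x| |p x| := (abs_nonneg _).trans (le_max_left _ _)
    calc |r x - p x| * ((k + 1 : ℕ) : ℝ) * max |r x| |p x| ^ k
        ≤ (C₁ * ε ^ (N + 1) * Real.exp (x ^ 2 / 32)) * ((k + 1 : ℕ) : ℝ)
          * ((C₁ + C₂) * ε ^ 3 * Real.exp (x ^ 2 / 32)) ^ k := by
          gcongr
          exact hrp x
      _ = _ := by
          rw [mul_pow, mul_pow, ← pow_mul]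
          push_cast
          ring
  have hE := integrable_exp_sq_div_pow hk
  have hmeas : Measurable r := (measurable_truncatedRatio ν (c ^ 2) ε).sub_const 1
  have hpint : Integrable (fun x => p x ^ (k + 1)) (gaussianReal 0 1) := by
    simpa [hp] using integrable_eval_gaussianReal (hermiteApprox m N ε ^ (k + 1))
  have hrint : Integrable (fun x => r x ^ (k + 1)) (gaussianReal 0 1) := by
    refine (hE.const_mul ((C₂ * ε ^ 3) ^ (k + 1))).mono' (hmeas.pow_const _).aestronglyMeasurable
      (ae_of_all _ fun x => ?_)
    rw [norm_pow, Real.norm_eq_abs, ← mul_pow]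
    exact pow_le_pow_left₀ (abs_nonneg _) (hr3 x) _
  refine ⟨hrint, ?_⟩
  have hΛ : gaussianFunctional (hermiteApprox m N ε ^ (k + 1))
      = ∫ x, p x ^ (k + 1) ∂(gaussianReal 0 1) := by
    simp [gaussianFunctional_apply, hp]
  rw [hΛ, ← integral_sub hrint hpint, ← Real.norm_eq_abs]
  refine (norm_integral_le_of_norm_le (hE.const_mul _)
    (ae_of_all _ fun x => (Real.norm_eq_abs _).trans_le (hpow x))).trans (le_of_eq ?_)
  rw [integral_const_mul, ← hJ]
  ring

/-- The entropy integral of the truncated density ratio in terms of its Hermite approximations. -/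
lemma exists_abs_integral_truncatedRatio_mul_log_sub_le
    (hν : ∀ n : ℕ, MemLp id (n : ℝ≥0∞) ν)
    (hc : 0 ≤ c) (hm : ∀ n, deconvolvedMoment ν c n = (m n : ℂ)) (h0 : m 0 = 1) (h1 : m 1 = 0)
    (h2 : m 2 = 0) :
    ∃ C : ℝ, ∀ ε : ℝ, 0 < ε → ε ≤ 1 → ε * c ≤ 1 / 64 →
      Integrable (fun x => truncatedRatio ν (c ^ 2) ε x * Real.log (truncatedRatio ν (c ^ 2) ε x))
        (gaussianReal 0 1) →
      |∫ x, truncatedRatio ν (c ^ 2) ε x * Real.log (truncatedRatio ν (c ^ 2) ε x)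
          ∂(gaussianReal 0 1)
        - (gaussianFunctional (hermiteApprox m 13 ε)
          + gaussianFunctional (hermiteApprox m 10 ε ^ 2) / 2
          - gaussianFunctional (hermiteApprox m 7 ε ^ 3) / 6
          + gaussianFunctional (hermiteApprox m 4 ε ^ 4) / 12)| ≤ C * ε ^ 14 := by
  -- The cut-offs N = 13, 10, 7, 4 for the powers k + 1 = 1, 2, 3, 4 are those for which N + 1 + 3k
  -- = 14.
  obtain ⟨C₁, hC₁0, hC₁⟩ := exists_abs_integral_pow_sub_le hν hc hm h0 h1 h2
    (N := 13) (k := 0) (by norm_num) (by norm_num)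
  obtain ⟨C₂, hC₂0, hC₂⟩ := exists_abs_integral_pow_sub_le hν hc hm h0 h1 h2
    (N := 10) (k := 1) (by norm_num) (by norm_num)
  obtain ⟨C₃, hC₃0, hC₃⟩ := exists_abs_integral_pow_sub_le hν hc hm h0 h1 h2
    (N := 7) (k := 2) (by norm_num) (by norm_num)
  obtain ⟨C₄, hC₄0, hC₄⟩ := exists_abs_integral_pow_sub_le hν hc hm h0 h1 h2
    (N := 4) (k := 3) (by norm_num) (by norm_num)
  obtain ⟨C₅, hC₅0, hC₅⟩ :=
    exists_abs_truncatedRatio_sub_hermiteApprox_le hν hc hm h0 h1 h2 le_rfl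
  set J := ∫ x, Real.exp (x ^ 2 / 32) ^ 5 ∂(gaussianReal 0 1) with hJ
  have hJ0 : 0 ≤ J := integral_nonneg fun x => by positivity
  refine ⟨C₁ + C₂ + C₃ + C₄ + 100 * C₅ ^ 5 * J, fun ε hε hε1 hεc hint => ?_⟩
  obtain ⟨i1, b1⟩ := hC₁ ε hε hε1 hεc
  obtain ⟨i2, b2⟩ := hC₂ ε hε hε1 hεc
  obtain ⟨i3, b3⟩ := hC₃ ε hε hε1 hεc
  obtain ⟨i4, b4⟩ := hC₄ ε hε hε1 hεc
  set r : ℝ → ℝ := fun x => truncatedRatio ν (c ^ 2) ε x - 1 with hr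
  simp only [zero_add, pow_one, Nat.reduceAdd, Nat.reduceMul, mul_zero, add_zero]
    at i1 i2 i3 i4 b1 b2 b3 b4
  have hr3 : ∀ x, |r x| ≤ C₅ * ε ^ 3 * Real.exp (x ^ 2 / 32) := fun x => by
    simpa [hermiteApprox] using hC₅ ε x hε hε1 hεc
  have hpt : ∀ x, ‖truncatedRatio ν (c ^ 2) ε x * Real.log (truncatedRatio ν (c ^ 2) ε x)
      - (r x + r x ^ 2 / 2 - r x ^ 3 / 6 + r x ^ 4 / 12)‖
      ≤ 100 * C₅ ^ 5 * ε ^ 15 * Real.exp (x ^ 2 / 32) ^ 5 := fun x => by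
    have e1 : truncatedRatio ν (c ^ 2) ε x = 1 + r x := by simp [hr]
    have e2 : -1 ≤ r x := by
      have := truncatedRatio_nonneg ν (c ^ 2) ε x
      simp only [hr]; linarith
    rw [e1, Real.norm_eq_abs]
    refine (abs_one_add_mul_log_sub_le e2).trans ?_
    have : |r x| ^ 5 ≤ (C₅ * ε ^ 3 * Real.exp (x ^ 2 / 32)) ^ 5 :=
      pow_le_pow_left₀ (abs_nonneg _) (hr3 x) _
    calc 100 * |r x| ^ 5 ≤ 100 * (C₅ * ε ^ 3 * Real.exp (x ^ 2 / 32)) ^ 5 := by gcongr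
      _ = _ := by ring
  have i12 : Integrable (fun x => r x + r x ^ 2 / 2) (gaussianReal 0 1) :=
    i1.add (i2.div_const 2)
  have i123 : Integrable (fun x => r x + r x ^ 2 / 2 - r x ^ 3 / 6) (gaussianReal 0 1) :=
    i12.sub (i3.div_const 6)
  have i1234 : Integrable (fun x => r x + r x ^ 2 / 2 - r x ^ 3 / 6 + r x ^ 4 / 12)
      (gaussianReal 0 1) := i123.add (i4.div_const 12)
  have hmain := norm_integral_le_of_norm_le
    ((integrable_exp_sq_div_pow (k := 5) le_rfl).const_mul (100 * C₅ ^ 5 * ε ^ 15))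
    (ae_of_all _ hpt)
  rw [integral_const_mul, ← hJ, integral_sub hint i1234, integral_add i123 (i4.div_const 12),
    integral_sub i12 (i3.div_const 6), integral_add i1 (i2.div_const 2), integral_div,
    integral_div, integral_div, Real.norm_eq_abs] at hmain
  have e15 : 100 * C₅ ^ 5 * ε ^ 15 * J ≤ 100 * C₅ ^ 5 * J * ε ^ 14 := by
    have : ε ^ 15 ≤ ε ^ 14 := pow_le_pow_of_le_one hε.le hε1 (by norm_num)
    calc _ = 100 * C₅ ^ 5 * J * ε ^ 15 := by ring
      _ ≤ _ := by gcongr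
  have p14 : 0 ≤ ε ^ 14 := by positivity
  have := mul_nonneg hC₂0 p14
  have := mul_nonneg hC₃0 p14
  have := mul_nonneg hC₄0 p14
  rw [abs_le] at hmain b1 b2 b3 b4 ⊢
  constructor <;> nlinarith [hmain.1, hmain.2, b1.1, b1.2, b2.1, b2.2, b3.1, b3.2, b4.1, b4.2]

end Expansion

/-! ### Evaluation of the Hermite functionals up to order 12 in ε. -/

section Algebra

open Polynomial Topology

variable (m : ℕ → ℝ)

lemma gaussianFunctional_hermiteApprox (N : ℕ) (ε : ℝ) :
    gaussianFunctional (hermiteApprox m N ε) = 0 := by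
  rw [hermiteApprox, map_sum]
  refine Finset.sum_eq_zero fun n hn => ?_
  have h := gaussianFunctional_realHermite_mul_realHermite n 0
  have hn' : n ≠ 0 := by
    have := (Finset.mem_Icc.mp hn).1
    omega
  rw [realHermite_zero, mul_one, if_neg hn'] at h
  rw [map_smul, h, smul_zero]

lemma gaussianFunctional_hermiteApprox_sq (N : ℕ) (ε : ℝ) :
    gaussianFunctional (hermiteApprox m N ε ^ 2)
      = ∑ n ∈ Finset.Icc 3 N, m n ^ 2 / n.factorial * ε ^ (2 * n) := by
  rw [pow_two, hermiteApprox, Finset.sum_mul_sum, map_sum]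
  refine Finset.sum_congr rfl fun i hi => ?_
  rw [map_sum, Finset.sum_eq_single i]
  · rw [smul_mul_smul_comm, map_smul, gaussianFunctional_realHermite_mul_realHermite, if_pos rfl,
      smul_eq_mul]
    have : (i.factorial : ℝ) ≠ 0 := by positivity
    field_simp
    ring
  · intro j _ hj
    rw [smul_mul_smul_comm, map_smul, gaussianFunctional_realHermite_mul_realHermite,
      if_neg hj.symm, smul_zero]
  · exact fun h => absurd hi h

lemma isBigO_const_mul_pow_nhdsGT_zero (a : ℝ) {n k : ℕ} (h : k ≤ n) :
    (fun ε : ℝ => a * ε ^ n) =O[𝓝[>] 0] fun ε => ε ^ k := by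
  refine IsBigO.of_bound |a| ?_
  filter_upwards [Ioo_mem_nhdsGT (zero_lt_one (α := ℝ))] with ε hε
  rw [norm_mul, norm_pow, norm_pow, Real.norm_eq_abs, Real.norm_eq_abs, abs_of_pos hε.1]
  gcongr 1
  exact pow_le_pow_of_le_one hε.1.le hε.2.le h

/-- Orthogonality leaves only the diagonal, where index n contributes order 2n; all n ≥ 7 are
absorbed in the error. -/
lemma isBigO_gaussianFunctional_hermiteApprox_sq :
    (fun ε => gaussianFunctional (hermiteApprox m 10 ε ^ 2)
      - (m 3 ^ 2 / 6 * ε ^ 6 + m 4 ^ 2 / 24 * ε ^ 8 + m 5 ^ 2 / 120 * ε ^ 10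
        + m 6 ^ 2 / 720 * ε ^ 12)) =O[𝓝[>] 0] fun ε => ε ^ 14 := by
  have h : ∀ ε, gaussianFunctional (hermiteApprox m 10 ε ^ 2)
      - (m 3 ^ 2 / 6 * ε ^ 6 + m 4 ^ 2 / 24 * ε ^ 8 + m 5 ^ 2 / 120 * ε ^ 10
        + m 6 ^ 2 / 720 * ε ^ 12)
      = ∑ n ∈ Finset.Icc 7 10, m n ^ 2 / n.factorial * ε ^ (2 * n) := by
    intro ε
    rw [gaussianFunctional_hermiteApprox_sq]
    have : Finset.Icc 3 10 = {3, 4, 5, 6} ∪ Finset.Icc 7 10 := by decide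
    rw [this, Finset.sum_union (by decide)]
    simp [Nat.factorial]
    ring
  simp_rw [h]
  refine IsBigO.fun_sum fun n hn => isBigO_const_mul_pow_nhdsGT_zero _ ?_
  have := (Finset.mem_Icc.mp hn).1
  omega

/-- Triples of odd total degree vanish by parity. With indices at least 3, the even totals below 14
come only from the permutations of (3,3,4), (3,3,6), (3,4,5) and (4,4,4); `s₁` lists these thirteen,
and the finite check `hrest` confirms that none is missing. -/
lemma isBigO_gaussianFunctional_hermiteApprox_pow_three :
    (fun ε => gaussianFunctional (hermiteApprox m 7 ε ^ 3)
      - (3 / 4 * m 3 ^ 2 * m 4 * ε ^ 10 + (m 3 ^ 2 * m 6 / 12 + m 3 * m 4 * m 5 / 2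
        + m 4 ^ 3 / 8) * ε ^ 12)) =O[𝓝[>] 0] fun ε => ε ^ 14 := by
  set t : ℕ × ℕ × ℕ → ℝ := fun q => m q.1 / q.1.factorial * (m q.2.1 / q.2.1.factorial)
    * (m q.2.2 / q.2.2.factorial)
    * gaussianFunctional (realHermite q.1 * realHermite q.2.1 * realHermite q.2.2) with ht
  set s : Finset (ℕ × ℕ × ℕ) := Finset.Icc 3 7 ×ˢ Finset.Icc 3 7 ×ˢ Finset.Icc 3 7 with hs
  have hexp : ∀ ε, gaussianFunctional (hermiteApprox m 7 ε ^ 3)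
      = ∑ q ∈ s, t q * ε ^ (q.1 + q.2.1 + q.2.2) := by
    intro ε
    rw [pow_three, hermiteApprox, hs, Finset.sum_product]
    simp_rw [Finset.sum_product]
    rw [Finset.sum_mul_sum, Finset.sum_mul_sum, map_sum]
    refine Finset.sum_congr rfl fun i _ => ?_
    rw [map_sum]
    refine Finset.sum_congr rfl fun j _ => ?_
    rw [Finset.mul_sum, map_sum]
    refine Finset.sum_congr rfl fun k _ => ?_
    rw [smul_mul_smul_comm, smul_mul_smul_comm, map_smul, smul_eq_mul, ← mul_assoc (realHermite i)]
    simp only [ht]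
    ring
  have htodd : ∀ q : ℕ × ℕ × ℕ, ¬ Even (q.1 + q.2.1 + q.2.2) → t q = 0 := by
    intro q hq
    simp only [ht]
    rw [gaussianFunctional_realHermite_triple_of_odd (Nat.not_even_iff_odd.mp hq), mul_zero]
  set s₁ : Finset (ℕ × ℕ × ℕ) := {(3, 3, 4), (3, 4, 3), (4, 3, 3), (3, 3, 6), (3, 6, 3), (6, 3, 3),
    (3, 4, 5), (3, 5, 4), (4, 3, 5), (4, 5, 3), (5, 3, 4), (5, 4, 3), (4, 4, 4)} with hs₁
  have hsub : s₁ ⊆ s := by decide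
  have hrest : ∀ q ∈ s \ s₁, ¬ Even (q.1 + q.2.1 + q.2.2) ∨ 14 ≤ q.1 + q.2.1 + q.2.2 := by
    decide
  have hperm : ∀ i j k : ℕ, gaussianFunctional (realHermite i * realHermite j * realHermite k)
      = gaussianFunctional (realHermite j * realHermite i * realHermite k) := by
    intro i j k; rw [mul_comm (realHermite i)]
  have hperm' : ∀ i j k : ℕ, gaussianFunctional (realHermite i * realHermite j * realHermite k)
      = gaussianFunctional (realHermite i * realHermite k * realHermite j) := by
    intro i j k; rw [mul_right_comm]
  have v334 := gaussianFunctional_realHermite_334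
  have v343 := (hperm' 3 4 3).trans v334
  have v433 := (hperm 4 3 3).trans v343
  have v336 := gaussianFunctional_realHermite_336
  have v363 := (hperm' 3 6 3).trans v336
  have v633 := (hperm 6 3 3).trans v363
  have v345 := gaussianFunctional_realHermite_345
  have v354 := (hperm' 3 5 4).trans v345
  have v435 := (hperm 4 3 5).trans v345
  have v453 := (hperm' 4 5 3).trans v435
  have v534 := (hperm 5 3 4).trans v354
  have v543 := (hperm' 5 4 3).trans v534
  have h : ∀ ε, gaussianFunctional (hermiteApprox m 7 ε ^ 3)
      - (3 / 4 * m 3 ^ 2 * m 4 * ε ^ 10 + (m 3 ^ 2 * m 6 / 12 + m 3 * m 4 * m 5 / 2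
        + m 4 ^ 3 / 8) * ε ^ 12)
      = ∑ q ∈ s \ s₁, t q * ε ^ (q.1 + q.2.1 + q.2.2) := by
    intro ε
    rw [hexp, ← Finset.sum_sdiff hsub]
    have : ∑ q ∈ s₁, t q * ε ^ (q.1 + q.2.1 + q.2.2)
        = 3 / 4 * m 3 ^ 2 * m 4 * ε ^ 10 + (m 3 ^ 2 * m 6 / 12 + m 3 * m 4 * m 5 / 2
        + m 4 ^ 3 / 8) * ε ^ 12 := by
      simp [hs₁, ht, Nat.factorial, v334, v343, v433, v336, v363, v633, v345, v354, v435, v453,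
        v534, v543, gaussianFunctional_realHermite_444]
      ring
    rw [this]
    ring
  simp_rw [h]
  refine IsBigO.fun_sum fun q hq => ?_
  rcases hrest q hq with h1 | h1
  · rw [htodd q h1]
    simp only [zero_mul]
    exact isBigO_zero _ _
  · exact isBigO_const_mul_pow_nhdsGT_zero _ h1

/-- The leading term is E He₃⁴ / 6⁴ = 3348/1296 = 31/12, and the term of order 13 vanishes by
parity. -/
lemma isBigO_gaussianFunctional_hermiteApprox_pow_four :
    (fun ε => gaussianFunctional (hermiteApprox m 4 ε ^ 4) - 31 / 12 * m 3 ^ 4 * ε ^ 12)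
      =O[𝓝[>] 0] fun ε => ε ^ 14 := by
  set Λ := gaussianFunctional with hΛ
  set p := realHermite 3 with hp
  set q := realHermite 4 with hq
  have hodd : Λ (p ^ 3 * q) = 0 := by
    refine gaussianFunctional_eq_zero_of_odd fun x => ?_
    simp only [hp, hq, eval_mul, eval_pow, eval_neg_realHermite]
    ring
  have h : ∀ ε, Λ (hermiteApprox m 4 ε ^ 4) - 31 / 12 * m 3 ^ 4 * ε ^ 12
      = 6 * (m 3 / 6) ^ 2 * (m 4 / 24) ^ 2 * Λ (p ^ 2 * q ^ 2) * ε ^ 14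
        + 4 * (m 3 / 6) * (m 4 / 24) ^ 3 * Λ (p * q ^ 3) * ε ^ 15
        + (m 4 / 24) ^ 4 * Λ (q ^ 4) * ε ^ 16 := by
    intro ε
    have : hermiteApprox m 4 ε ^ 4 = ((m 3 / 6) ^ 4 * ε ^ 12) • p ^ 4
        + (4 * (m 3 / 6) ^ 3 * (m 4 / 24) * ε ^ 13) • (p ^ 3 * q)
        + (6 * (m 3 / 6) ^ 2 * (m 4 / 24) ^ 2 * ε ^ 14) • (p ^ 2 * q ^ 2)
        + (4 * (m 3 / 6) * (m 4 / 24) ^ 3 * ε ^ 15) • (p * q ^ 3)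
        + ((m 4 / 24) ^ 4 * ε ^ 16) • q ^ 4 := by
      have : Finset.Icc 3 4 = {3, 4} := by decide
      rw [hermiteApprox, this, Finset.sum_pair (by norm_num)]
      simp only [smul_eq_C_mul, Nat.factorial, map_mul, map_pow, ← hp, ← hq, map_ofNat]
      norm_num
      ring
    rw [this]
    simp only [map_add, map_smul, smul_eq_mul, hodd]
    rw [hΛ, hp, gaussianFunctional_realHermite_three_pow_four]
    ring
  simp_rw [h]
  refine IsBigO.add (IsBigO.add ?_ ?_) ?_ <;>
    exact isBigO_const_mul_pow_nhdsGT_zero _ (by norm_num)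

variable {m}

/-- Expansion of the relative entropy of `ε Z + N` with respect to the standard Gaussian law. -/
theorem isBigO_integral_gaussianRatio_mul_log_sub {ν : Measure ℝ} [IsProbabilityMeasure ν] {c : ℝ}
    (hν : ∀ n : ℕ, MemLp id (n : ℝ≥0∞) ν) (hmean : ∫ z, z ∂ν = 0) (hvar : ∫ z, z ^ 2 ∂ν = c ^ 2)
    (hc : 0 ≤ c) (hm : ∀ n, deconvolvedMoment ν c n = (m n : ℂ)) (h0 : m 0 = 1) (h1 : m 1 = 0)
    (h2 : m 2 = 0) :
    (fun ε => ∫ x, gaussianRatio ν (c ^ 2) ε x * Real.log (gaussianRatio ν (c ^ 2) ε x)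
      ∂(gaussianReal 0 1) - expansionInModifiedMoments m ε⁻¹) =O[𝓝[>] 0] fun ε => ε ^ 14 := by
  obtain ⟨C, hC⟩ := exists_abs_integral_truncatedRatio_mul_log_sub_le hν hc hm h0 h1 h2
  have hsmall : ∀ᶠ ε : ℝ in 𝓝[>] 0, 0 < ε ∧ ε ≤ 1 ∧ ε * c ≤ 1 / 64 ∧ c ^ 2 * ε ^ 2 ≤ 1 / 2 := by
    -- Using c + 1 instead of c covers a degenerate Z, where c = 0.
    have : 0 < min 1 (1 / (64 * (c + 1))) := by positivity
    filter_upwards [Ioo_mem_nhdsGT this] with ε hε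
    have hε1 := hε.2.le.trans (min_le_left _ _)
    have hε2 := hε.2.le.trans (min_le_right _ _)
    rw [le_div_iff₀ (by positivity)] at hε2
    have hεpos := hε.1
    have : ε * c ≤ 1 / 64 := by nlinarith
    refine ⟨hεpos, hε1, this, ?_⟩
    have h0 : 0 ≤ ε * c := by positivity
    nlinarith
  have e1 : (fun ε => ∫ x, gaussianRatio ν (c ^ 2) ε x * Real.log (gaussianRatio ν (c ^ 2) ε x)
        ∂(gaussianReal 0 1)
      - ∫ x, truncatedRatio ν (c ^ 2) ε x * Real.log (truncatedRatio ν (c ^ 2) ε x)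
        ∂(gaussianReal 0 1)) =O[𝓝[>] 0] fun ε => ε ^ 14 := by
    refine IsBigO.of_bound (9 * ∫ z, z ^ 14 ∂ν) ?_
    filter_upwards [hsmall] with ε hε
    rw [norm_pow, Real.norm_eq_abs, Real.norm_eq_abs, abs_of_pos hε.1]
    exact (abs_integral_mul_log_sub_truncated_le hν hmean hvar hε.2.2.2).2
  have e2 : (fun ε => ∫ x, truncatedRatio ν (c ^ 2) ε x * Real.log (truncatedRatio ν (c ^ 2) ε x)
        ∂(gaussianReal 0 1) - (gaussianFunctional (hermiteApprox m 13 ε)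
          + gaussianFunctional (hermiteApprox m 10 ε ^ 2) / 2
          - gaussianFunctional (hermiteApprox m 7 ε ^ 3) / 6
          + gaussianFunctional (hermiteApprox m 4 ε ^ 4) / 12))
      =O[𝓝[>] 0] fun ε => ε ^ 14 := by
    refine IsBigO.of_bound C ?_
    filter_upwards [hsmall] with ε hε
    rw [norm_pow, Real.norm_eq_abs, Real.norm_eq_abs, abs_of_pos hε.1]
    exact hC ε hε.1 hε.2.1 hε.2.2.1
      (abs_integral_mul_log_sub_truncated_le hν hmean hvar hε.2.2.2).1
  have e3 := (isBigO_gaussianFunctional_hermiteApprox_sq m).const_mul_left (1 / 2)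
  have e4 := (isBigO_gaussianFunctional_hermiteApprox_pow_three m).const_mul_left (1 / 6)
  have e5 := (isBigO_gaussianFunctional_hermiteApprox_pow_four m).const_mul_left (1 / 12)
  refine (((e1.add e2).add e3).sub e4).add e5 |>.congr_left fun ε => ?_
  rw [gaussianFunctional_hermiteApprox, expansionInModifiedMoments]
  simp only [div_eq_mul_inv, mul_inv, inv_pow, inv_inv]
  ring

end Algebra

/-! ### Deconvolved moments as Taylor coefficients. -/

section Moments

open Topology ContDiff

lemma integrable_pow_of_memLp {ν : Measure ℝ} [IsFiniteMeasure ν]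
    (hν : ∀ n : ℕ, MemLp id (n : ℝ≥0∞) ν) (n : ℕ) : Integrable (fun z : ℝ => z ^ n) ν := by
  refine (integrable_one_add_abs_pow hν n).mono' (by fun_prop) (ae_of_all _ fun z => ?_)
  rw [norm_pow, Real.norm_eq_abs]
  exact pow_le_pow_left₀ (abs_nonneg _) (by linarith [abs_nonneg z]) n

variable {ν : Measure ℝ} [IsProbabilityMeasure ν] {c : ℝ}

lemma deconvolvedMoment_eq_sum (hν : ∀ n : ℕ, MemLp id (n : ℝ≥0∞) ν) (c : ℝ) (n : ℕ) :
    deconvolvedMoment ν c n = ∑ j ∈ Finset.range (n + 1), (n.choose j : ℂ)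
      * ((∫ z, z ^ j ∂ν : ℝ) : ℂ)
      * ((-(Complex.I * c)) ^ (n - j) * ((∫ g, g ^ (n - j) ∂(gaussianReal 0 1) : ℝ) : ℂ)) := by
  have h : ∀ p : ℝ × ℝ, ((p.1 : ℂ) - Complex.I * c * p.2) ^ n
      = ∑ j ∈ Finset.range (n + 1), ((n.choose j : ℂ) * (-(Complex.I * c)) ^ (n - j))
        * (((p.1 ^ j : ℝ) : ℂ) * ((p.2 ^ (n - j) : ℝ) : ℂ)) := by
    intro p
    rw [sub_eq_add_neg, add_pow]
    refine Finset.sum_congr rfl fun j _ => ?_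
    rw [← neg_mul, mul_pow]
    push_cast
    ring
  rw [deconvolvedMoment]
  simp_rw [h]
  have hi : ∀ j : ℕ, Integrable (fun p : ℝ × ℝ => ((p.1 ^ j : ℝ) : ℂ) * ((p.2 ^ (n - j) : ℝ) : ℂ))
      (ν.prod (gaussianReal 0 1)) := fun j =>
    (integrable_pow_of_memLp hν j).ofReal.mul_prod (integrable_pow_gaussianReal (n - j)).ofReal
  rw [integral_finsetSum _ fun j _ => (hi j).const_mul _]
  refine Finset.sum_congr rfl fun j _ => ?_
  rw [integral_const_mul, integral_prod_mul (fun z : ℝ => ((z ^ j : ℝ) : ℂ))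
    (fun g : ℝ => ((g ^ (n - j) : ℝ) : ℂ)), integral_complex_ofReal, integral_complex_ofReal]
  ring

/-- Conjugation replaces G by −G, which has the same law; hence the deconvolved moments are real. -/
lemma deconvolvedMoment_conj (hν : ∀ n : ℕ, MemLp id (n : ℝ≥0∞) ν) (hc : 0 ≤ c) (n : ℕ) :
    (starRingEnd ℂ) (deconvolvedMoment ν c n) = deconvolvedMoment ν c n := by
  have hi := integrable_deconvolved_pow hν n hc
  rw [deconvolvedMoment, ← integral_conj, integral_prod _ hi, integral_prod]
  · refine integral_congr_ae (ae_of_all _ fun z => ?_)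
    have h := gaussianReal_map_neg (μ := 0) (v := 1)
    rw [neg_zero] at h
    simp only
    conv_rhs => rw [← h]
    rw [integral_map (by fun_prop) (by fun_prop)]
    refine integral_congr_ae (ae_of_all _ fun g => ?_)
    simp
  · refine hi.norm.mono' (by fun_prop) (ae_of_all _ fun p => ?_)
    simp only [RCLike.norm_conj, le_refl]

lemma deconvolvedMoment_eq_ofReal_re (hν : ∀ n : ℕ, MemLp id (n : ℝ≥0∞) ν) (hc : 0 ≤ c) (n : ℕ) :
    deconvolvedMoment ν c n = ((deconvolvedMoment ν c n).re : ℂ) :=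
  (Complex.conj_eq_iff_re.mp (deconvolvedMoment_conj hν hc n)).symm

lemma deconvolvedMoment_zero : deconvolvedMoment ν c 0 = 1 := by
  simp [deconvolvedMoment]

lemma deconvolvedMoment_one (hν : ∀ n : ℕ, MemLp id (n : ℝ≥0∞) ν) (hmean : ∫ z, z ∂ν = 0) :
    deconvolvedMoment ν c 1 = 0 := by
  simp [deconvolvedMoment_eq_sum hν, Finset.sum_range_succ, hmean, integral_id_gaussianReal]

/-- The imaginary Gaussian contributes (−ic)² = −c², cancelling the variance. -/
lemma deconvolvedMoment_two (hν : ∀ n : ℕ, MemLp id (n : ℝ≥0∞) ν) (hmean : ∫ z, z ∂ν = 0)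
    (hvar : ∫ z, z ^ 2 ∂ν = c ^ 2) : deconvolvedMoment ν c 2 = 0 := by
  simp [deconvolvedMoment_eq_sum hν, Finset.sum_range_succ, hmean, integral_id_gaussianReal,
    integral_sq_gaussianReal, hvar, mul_pow]

lemma iteratedDeriv_ofReal_comp {f : ℝ → ℝ} (hf : ContDiff ℝ ∞ f) (n : ℕ) :
    iteratedDeriv n (fun t => (f t : ℂ)) = fun t => ((iteratedDeriv n f t : ℝ) : ℂ) := by
  induction n with
  | zero => simp
  | succ n ih =>
    rw [iteratedDeriv_succ, ih, iteratedDeriv_succ]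
    funext t
    have hd : DifferentiableAt ℝ (iteratedDeriv n f) t :=
      (hf.differentiable_iteratedDeriv n (by exact_mod_cast WithTop.coe_lt_top _)) t
    exact hd.hasDerivAt.ofReal_comp.deriv

lemma contDiff_exp_sq_div (c : ℝ) : ContDiff ℝ ∞ (fun t : ℝ => Real.exp (c ^ 2 * t ^ 2 / 2)) := by
  fun_prop

/-- The function is the moment generating function of cG, finite everywhere, so its derivatives at 0
are the moments. -/
lemma iteratedDeriv_exp_sq_div (c : ℝ) (n : ℕ) :
    iteratedDeriv n (fun t : ℝ => Real.exp (c ^ 2 * t ^ 2 / 2)) 0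
      = c ^ n * ∫ g, g ^ n ∂(gaussianReal 0 1) := by
  have hmgf : mgf (fun g => c * g) (gaussianReal 0 1)
      = fun t : ℝ => Real.exp (c ^ 2 * t ^ 2 / 2) := by
    funext t
    have h := gaussianReal_map_const_mul (μ := 0) (v := 1) c
    rw [mgf_gaussianReal h]
    congr 1
    simp
  have hset : integrableExpSet (fun g => c * g) (gaussianReal 0 1) = Set.univ := by
    refine Set.eq_univ_of_forall fun t => ?_
    have := integrable_exp_mul_gaussianReal (μ := 0) (v := 1) (t * c)
    simp only [integrableExpSet, Set.mem_ofPred_eq]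
    refine this.congr (ae_of_all _ fun g => ?_)
    simp only
    ring_nf
  rw [← hmgf, iteratedDeriv_mgf_zero (by rw [hset]; simp), ← integral_const_mul]
  refine integral_congr_ae (ae_of_all _ fun g => ?_)
  simp [mul_pow]

lemma contDiff_charFun_mul_exp (hν : ∀ n : ℕ, MemLp id (n : ℝ≥0∞) ν) (c : ℝ) :
    ContDiff ℝ ∞ (charFun ν * fun t : ℝ => ((Real.exp (c ^ 2 * t ^ 2 / 2) : ℝ) : ℂ)) :=
  (contDiff_charFun' (n := ⊤) hν).mul (Complex.ofRealCLM.contDiff.comp (contDiff_exp_sq_div c))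

/-- The deconvolved moments are the Taylor coefficients of `charFun ν t * exp (c² t² / 2)`. -/
lemma iteratedDeriv_charFun_mul_exp (hν : ∀ n : ℕ, MemLp id (n : ℝ≥0∞) ν) (c : ℝ) (n : ℕ) :
    iteratedDeriv n (charFun ν * fun t : ℝ => ((Real.exp (c ^ 2 * t ^ 2 / 2) : ℝ) : ℂ)) 0
      = Complex.I ^ n * deconvolvedMoment ν c n := by
  have h1 : ContDiff ℝ ∞ (charFun ν) := contDiff_charFun' (n := ⊤) hν
  have h2 : ContDiff ℝ ∞ (fun t : ℝ => ((Real.exp (c ^ 2 * t ^ 2 / 2) : ℝ) : ℂ)) :=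
    Complex.ofRealCLM.contDiff.comp (contDiff_exp_sq_div c)
  have hn : (n : WithTop ℕ∞) ≤ ((⊤ : ℕ∞) : WithTop ℕ∞) := by exact_mod_cast le_top
  rw [iteratedDeriv_mul (h1.contDiffAt.of_le hn) (h2.contDiffAt.of_le hn),
    deconvolvedMoment_eq_sum hν, Finset.mul_sum]
  refine Finset.sum_congr rfl fun j hj => ?_
  have hj' : j ≤ n := by simpa [Nat.lt_succ_iff] using hj
  rw [iteratedDeriv_charFun_zero (hν j), congrFun (iteratedDeriv_ofReal_comp (contDiff_exp_sq_div c) _) 0,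
    iteratedDeriv_exp_sq_div]
  obtain ⟨k, rfl⟩ := Nat.exists_eq_add_of_le hj'
  rw [Nat.add_sub_cancel_left, pow_add]
  -- The factor iᵏ taken from iⁿ undoes the (−i)ᵏ of the imaginary Gaussian, leaving the real cᵏ
  -- that comes from exp(c²t²/2).
  have hI : Complex.I ^ k * (-(Complex.I * c)) ^ k = (c : ℂ) ^ k := by
    rw [← mul_pow]
    congr 1
    linear_combination (-(c : ℂ)) * Complex.I_sq
  rw [Complex.ofReal_mul, Complex.ofReal_pow, ← hI]
  ring

end Moments

/-! ### From deconvolved moments to cumulants and modified moments. -/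

section Cumulants

open Topology ContDiff

lemma contDiffAt_log_charFun {L : Measure ℝ} [IsProbabilityMeasure L]
    (hL : ∀ n : ℕ, MemLp id (n : ℝ≥0∞) L) :
    ContDiffAt ℝ ∞ (fun t => Complex.log (charFun L t)) 0 := by
  have h0 : charFun L 0 ∈ Complex.slitPlane := by simp
  have h1 : ContDiffAt ℝ ∞ Complex.log (charFun L 0) :=
    (Complex.contDiffAt_log h0).restrict_scalars ℝ
  exact h1.comp 0 (contDiff_charFun' (n := ⊤) hL).contDiffAt

lemma contDiff_quadratic (a b : ℂ) : ContDiff ℝ ∞ (fun t : ℝ => a * t + b * (t : ℂ) ^ 2) := by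
  have : ContDiff ℝ ∞ (fun t : ℝ => (t : ℂ)) := Complex.ofRealCLM.contDiff
  fun_prop

lemma iteratedDeriv_quadratic (a b : ℂ) {k : ℕ} (hk : 3 ≤ k) (x : ℝ) :
    iteratedDeriv k (fun t : ℝ => a * t + b * (t : ℂ) ^ 2) x = 0 := by
  obtain ⟨n, rfl⟩ := Nat.exists_eq_add_of_le' hk
  have hid : ∀ t : ℝ, HasDerivAt (fun t : ℝ => (t : ℂ)) 1 t := fun t =>
    Complex.ofRealCLM.hasDerivAt
  have h1 : deriv (fun t : ℝ => a * t + b * (t : ℂ) ^ 2) = fun t : ℝ => a + 2 * b * t := by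
    funext t
    refine ((((hid t).const_mul a).add (((hid t).pow 2).const_mul b)).congr_deriv ?_).deriv
    simp
    ring
  have h2 : deriv (fun t : ℝ => a + 2 * b * (t : ℂ)) = fun _ => 2 * b := by
    funext t
    refine ((((hid t).const_mul (2 * b)).const_add a).congr_deriv ?_).deriv
    simp
  rw [show n + 3 = (n + 1) + 1 + 1 by ring, iteratedDeriv_succ', h1, iteratedDeriv_succ', h2,
    iteratedDeriv_const]
  simp

/-- Adding a quadratic function does not change the derivatives of order at least three. -/
lemma iteratedDeriv_add_quadratic {f : ℝ → ℂ} (hf : ContDiffAt ℝ ∞ f 0) (a b : ℂ) {k : ℕ}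
    (hk : 3 ≤ k) :
    iteratedDeriv k (f + fun t : ℝ => a * t + b * (t : ℂ) ^ 2) 0 = iteratedDeriv k f 0 := by
  have hn : (k : WithTop ℕ∞) ≤ ((⊤ : ℕ∞) : WithTop ℕ∞) := by exact_mod_cast le_top
  rw [iteratedDeriv_add (hf.of_le hn) ((contDiff_quadratic a b).contDiffAt.of_le hn),
    iteratedDeriv_quadratic a b hk, add_zero]

/-- The derivatives of an exponential, by Leibniz' rule. -/
lemma iteratedDeriv_succ_of_eventuallyEq_cexp {χ ψ : ℝ → ℂ} (hχ : ContDiff ℝ ∞ χ)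
    (hψ : ContDiffAt ℝ ∞ ψ 0) (h : χ =ᶠ[𝓝 0] fun t => Complex.exp (ψ t)) (k : ℕ) :
    iteratedDeriv (k + 1) χ 0 = ∑ j ∈ Finset.range (k + 1),
      (k.choose j : ℂ) * iteratedDeriv j χ 0 * iteratedDeriv (k + 1 - j) ψ 0 := by
  have hn : (k : WithTop ℕ∞) ≤ ((⊤ : ℕ∞) : WithTop ℕ∞) := by exact_mod_cast le_top
  have hd : ∀ᶠ t in 𝓝 (0 : ℝ), DifferentiableAt ℝ ψ t := by
    have h1 : ContDiffAt ℝ 1 ψ 0 := hψ.of_le (by exact_mod_cast le_top)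
    filter_upwards [h1.eventually (by simp)] with t ht
    exact ht.differentiableAt one_ne_zero
  -- Near 0, χ = exp ψ gives χ' = χ ψ'; Leibniz' rule applied to this product is the moment-cumulant
  -- recurrence.
  have hder : deriv χ =ᶠ[𝓝 0] χ * deriv ψ := by
    filter_upwards [h.eventuallyEq_nhds, hd] with t ht htd
    rw [ht.deriv_eq, Pi.mul_apply, ht.eq_of_nhds]
    exact htd.hasDerivAt.cexp.deriv
  have hψ' : ContDiffAt ℝ k (deriv ψ) 0 := hψ.derivWithin (by exact_mod_cast le_top)
  rw [iteratedDeriv_succ', hder.iteratedDeriv_eq, iteratedDeriv_mul (hχ.contDiffAt.of_le hn) hψ']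
  refine Finset.sum_congr rfl fun j hj => ?_
  have hj' : j ≤ k := by simpa [Nat.lt_succ_iff] using hj
  rw [← iteratedDeriv_succ', Nat.sub_add_comm hj']

/-- A sequence satisfying the moment-cumulant recurrence with vanishing terms of order one and two
is the sequence of modified moments. -/
lemma modifiedMoment_eq_of_recurrence {κ κ' m : ℕ → ℝ} (h0 : m 0 = 1) (h1 : m 1 = 0) (h2 : m 2 = 0)
    (hrec : ∀ k, m (k + 1)
      = ∑ j ∈ Finset.range (k + 1), (k.choose j : ℝ) * m j * κ' (k + 1 - j))
    (hκ : ∀ k, 3 ≤ k → κ' k = κ k) (n : ℕ) : modifiedMoment κ n = m n := by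
  -- The recurrence itself forces the first two cumulants to vanish, since the first two moments do.
  have hk1 : κ' 1 = 0 := by
    have := hrec 0
    simpa [h0, h1] using this.symm
  have hk2 : κ' 2 = 0 := by
    have := hrec 1
    simpa [Finset.sum_range_succ, h0, h1, h2] using this.symm
  induction n using Nat.strong_induction_on with
  | _ n ih =>
    rw [modifiedMoment]
    split_ifs with hn0 hn3
    · rw [hn0, h0]
    · have : n = 1 ∨ n = 2 := by omega
      rcases this with rfl | rfl
      · rw [h1]
      · rw [h2]
    · obtain ⟨k, rfl⟩ := Nat.exists_eq_succ_of_ne_zero hn0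
      rw [Finset.sum_attach (Finset.Icc 3 (k.succ - 3)) fun j =>
        ((k.succ - 1).choose j : ℝ) * modifiedMoment κ j * κ (k.succ - j)]
      -- Terms with j ∈ {1, 2} vanish through the moments, those with k + 1 − j ∈ {1, 2} through the
      -- cumulants. What is left is j = 0, which gives the leading cumulant, and 3 ≤ j ≤ k − 2.
      have hsub : ∑ j ∈ insert 0 (Finset.Icc 3 (k + 1 - 3)), (k.choose j : ℝ) * m j * κ' (k + 1 - j)
          = ∑ j ∈ Finset.range (k + 1), (k.choose j : ℝ) * m j * κ' (k + 1 - j) := by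
        refine Finset.sum_subset ?_ ?_
        · intro j hj
          simp only [Finset.mem_insert, Finset.mem_Icc] at hj
          simp only [Finset.mem_range]
          omega
        · intro j hj hj'
          simp only [Finset.mem_insert, Finset.mem_Icc] at hj'
          simp only [Finset.mem_range] at hj
          have : j = 1 ∨ j = 2 ∨ k + 1 - j = 1 ∨ k + 1 - j = 2 := by omega
          rcases this with h | h | h | h
          · rw [h, h1]; ring
          · rw [h, h2]; ring
          · rw [h, hk1]; ring
          · rw [h, hk2]; ring
      rw [Nat.succ_eq_add_one, hrec k, ← hsub, Finset.sum_insert (by simp)]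
      congr 1
      · simp [h0, hκ (k + 1) (by omega)]
      · refine Finset.sum_congr rfl fun j hj => ?_
        obtain ⟨hj1, hj2⟩ := Finset.mem_Icc.mp hj
        rw [ih j (by omega), hκ (k + 1 - j) (by omega), Nat.add_sub_cancel]

variable {Ω : Type*} [MeasurableSpace Ω] {P : Measure Ω} [IsProbabilityMeasure P]

/-- The modified moments are the moments of the centered variable, deconvolved by a Gaussian of the
same variance. -/
lemma modifiedMoment_cumulant_eq {Z : Ω → ℝ} (hZ : AEMeasurable Z P)
    (hL : ∀ n : ℕ, MemLp id (n : ℝ≥0∞) (P.map Z)) {μ c : ℝ} (hc : 0 ≤ c) {ν : Measure ℝ}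
    [IsProbabilityMeasure ν] (hν : ∀ n : ℕ, MemLp id (n : ℝ≥0∞) ν)
    (hνL : ν = (P.map Z).map (fun z => z + -μ))
    (hmean : ∫ z, z ∂ν = 0) (hvar : ∫ z, z ^ 2 ∂ν = c ^ 2) (n : ℕ) :
    (deconvolvedMoment ν c n).re = modifiedMoment (cumulant Z P) n := by
  have : IsProbabilityMeasure (P.map Z) := Measure.isProbabilityMeasure_map hZ
  set L := P.map Z with hLdef
  set χ : ℝ → ℂ := charFun ν * fun t : ℝ => ((Real.exp (c ^ 2 * t ^ 2 / 2) : ℝ) : ℂ) with hχ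
  -- The linear term removes the mean and the quadratic one the variance; neither affects
  -- derivatives of order three or more.
  set ψ : ℝ → ℂ := (fun t => Complex.log (charFun L t))
    + fun t : ℝ => (-(μ * Complex.I)) * t + (c ^ 2 / 2 : ℂ) * (t : ℂ) ^ 2 with hψ
  have hψs : ContDiffAt ℝ ∞ ψ 0 :=
    (contDiffAt_log_charFun hL).add (contDiff_quadratic _ _).contDiffAt
  have hne : ∀ᶠ t in 𝓝 (0 : ℝ), charFun L t ≠ 0 := by
    have hcont : Continuous (charFun L) := (contDiff_charFun' (n := ⊤) hL).continuous
    exact hcont.continuousAt.eventually_ne (by simp)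
  have heq : χ =ᶠ[𝓝 0] fun t => Complex.exp (ψ t) := by
    filter_upwards [hne] with t ht
    simp only [hχ, hψ, Pi.mul_apply, Pi.add_apply]
    rw [Complex.exp_add, Complex.exp_log ht, hνL, charFun_map_add_const, Complex.exp_add,
      mul_assoc, Complex.ofReal_exp]
    congr 3
    · simp
      ring
    · push_cast
      ring
  have hrec := iteratedDeriv_succ_of_eventuallyEq_cexp (contDiff_charFun_mul_exp hν c) hψs heq
  symm
  refine modifiedMoment_eq_of_recurrence (m := fun n => (deconvolvedMoment ν c n).re)
    (κ' := fun k => (iteratedDeriv k ψ 0 / Complex.I ^ k).re) ?_ ?_ ?_ ?_ ?_ n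
  · simp [deconvolvedMoment_zero]
  · simp [deconvolvedMoment_one hν hmean]
  · simp [deconvolvedMoment_two hν hmean hvar]
  · intro k
    have hk := hrec k
    simp_rw [iteratedDeriv_charFun_mul_exp hν] at hk
    -- The moments on the right are written as real numbers, so that taking real parts turns the
    -- complex recurrence into one for the real parts of the normalized derivatives of ψ.
    have h1 : deconvolvedMoment ν c (k + 1) = ∑ j ∈ Finset.range (k + 1),
        (((k.choose j : ℝ) * (deconvolvedMoment ν c j).re : ℝ) : ℂ)
          * (iteratedDeriv (k + 1 - j) ψ 0 / Complex.I ^ (k + 1 - j)) := by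
      have hI : Complex.I ^ (k + 1) ≠ 0 := pow_ne_zero _ Complex.I_ne_zero
      apply mul_left_cancel₀ hI
      rw [hk, Finset.mul_sum]
      refine Finset.sum_congr rfl fun j hj => ?_
      have hj' : j ≤ k + 1 := by
        have := Finset.mem_range.mp hj
        omega
      have hIj : Complex.I ^ (k + 1 - j) ≠ 0 := pow_ne_zero _ Complex.I_ne_zero
      have hp : Complex.I ^ (k + 1) = Complex.I ^ j * Complex.I ^ (k + 1 - j) := by
        rw [← pow_add, Nat.add_sub_cancel' hj']
      rw [hp]
      conv_lhs => rw [deconvolvedMoment_eq_ofReal_re hν hc j]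
      push_cast
      field_simp
    rw [h1, Complex.re_sum]
    refine Finset.sum_congr rfl fun j _ => ?_
    rw [Complex.re_ofReal_mul]
  · intro k hk
    simp only [hψ, cumulant]
    rw [iteratedDeriv_add_quadratic (contDiffAt_log_charFun hL) _ _ hk]

/-- Adding independent Gaussian noise does not change the cumulants of order at least three. -/
lemma cumulant_add_gaussian {Z N : Ω → ℝ} (hZ : AEMeasurable Z P)
    (hL : ∀ n : ℕ, MemLp id (n : ℝ≥0∞) (P.map Z)) {s : ℝ}
    (hN : HasLaw N (gaussianReal 0 (Real.toNNReal (s ^ 2))) P) (hind : IndepFun Z N P)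
    {k : ℕ} (hk : 3 ≤ k) : cumulant (Z + N) P k = cumulant Z P k := by
  have : IsProbabilityMeasure (P.map Z) := Measure.isProbabilityMeasure_map hZ
  have hne : ∀ᶠ t in 𝓝 (0 : ℝ), charFun (P.map Z) t ≠ 0 := by
    have hcont : Continuous (charFun (P.map Z)) := (contDiff_charFun' (n := ⊤) hL).continuous
    exact hcont.continuousAt.eventually_ne (by simp)
  have heq : (fun t => Complex.log (charFun (P.map (Z + N)) t))
      =ᶠ[𝓝 0] (fun t => Complex.log (charFun (P.map Z) t))
        + fun t : ℝ => (0 : ℂ) * t + (-(s ^ 2 / 2) : ℂ) * (t : ℂ) ^ 2 := by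
    filter_upwards [hne] with t ht
    rw [hind.charFun_map_add_eq_mul hZ hN.aemeasurable, Pi.mul_apply, hN.map_eq,
      charFun_gaussianReal]
    have : Complex.exp (t * (0 : ℝ) * Complex.I - (Real.toNNReal (s ^ 2) : ℝ) * t ^ 2 / 2)
        = ((Real.exp (-(s ^ 2 * t ^ 2 / 2)) : ℝ) : ℂ) := by
      rw [Real.coe_toNNReal _ (sq_nonneg s)]
      push_cast
      congr 1
      ring
    -- The Gaussian factor is a positive real, so the principal logarithm splits without a branch
    -- correction.
    rw [this, Complex.log_mul_ofReal _ (Real.exp_pos _) _ ht, Real.log_exp]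
    simp only [Pi.add_apply]
    push_cast
    ring
  rw [cumulant, cumulant, heq.iteratedDeriv_eq,
    iteratedDeriv_add_quadratic (contDiffAt_log_charFun hL) _ _ hk]

end Cumulants

/-! ### Relative entropy, affine maps and differential entropy. -/

section Laws

/-- The relative entropy of a measure with density `ρ`. -/
lemma klDiv_withDensity_ofReal {G : Measure ℝ} [IsProbabilityMeasure G] {ρ : ℝ → ℝ}
    (hρ : Measurable ρ) (hρ0 : ∀ x, 0 ≤ ρ x)
    [IsProbabilityMeasure (G.withDensity fun x => ENNReal.ofReal (ρ x))]
    (hint : Integrable (fun x => ρ x * Real.log (ρ x)) G) :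
    klDiv (G.withDensity fun x => ENNReal.ofReal (ρ x)) G ≠ ∞ ∧
    (klDiv (G.withDensity fun x => ENNReal.ofReal (ρ x)) G).toReal
      = ∫ x, ρ x * Real.log (ρ x) ∂G := by
  set Q := G.withDensity fun x => ENNReal.ofReal (ρ x) with hQ
  have hac : Q ≪ G := withDensity_absolutelyContinuous _ _
  have hllr : llr Q G =ᵐ[Q] fun x => Real.log (ρ x) := by
    refine hac.ae_le ?_
    filter_upwards [Measure.rnDeriv_withDensity G hρ.ennreal_ofReal] with x hx
    rw [llr_def, hQ]
    simp only [hx, ENNReal.toReal_ofReal (hρ0 x)]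
  have hI : Integrable (llr Q G) Q := by
    refine Integrable.congr ?_ hllr.symm
    rw [hQ, integrable_withDensity_iff_integrable_smul' hρ.ennreal_ofReal (by simp)]
    simpa [ENNReal.toReal_ofReal (hρ0 _)] using hint
  refine ⟨klDiv_ne_top hac hI, ?_⟩
  rw [toReal_klDiv_of_measure_eq hac (by simp), integral_congr_ae hllr, hQ,
    integral_withDensity_eq_integral_toReal_smul hρ.ennreal_ofReal (by simp)]
  refine integral_congr_ae (ae_of_all _ fun x => ?_)
  simp [ENNReal.toReal_ofReal (hρ0 _)]

/-- The law of `ε Z` plus Gaussian noise of variance `1 - v ε ^ 2`. -/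
lemma conv_gaussianReal_eq_withDensity {ν : Measure ℝ} [IsProbabilityMeasure ν] {v ε : ℝ}
    (h : v * ε ^ 2 < 1) :
    (ν.map (fun z => ε * z)) ∗ gaussianReal 0 (Real.toNNReal (1 - v * ε ^ 2))
      = (gaussianReal 0 1).withDensity (fun x => ENNReal.ofReal (gaussianRatio ν v ε x)) := by
  have hm : Measurable fun p : ℝ × ℝ => ENNReal.ofReal (ratioKernel v ε p.2 p.1) :=
    (continuous_ratioKernel v ε).measurable.ennreal_ofReal
  ext B hB
  have hind : Measurable (B.indicator (1 : ℝ → ℝ≥0∞)) := measurable_one.indicator hB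
  have hinner : Measurable fun x : ℝ => ∫⁻ y, B.indicator (1 : ℝ → ℝ≥0∞) (x + y)
      ∂(gaussianReal 0 (Real.toNNReal (1 - v * ε ^ 2))) :=
    (hind.comp measurable_add).lintegral_prod_right'
  rw [← lintegral_indicator_one hB, Measure.lintegral_conv hind,
    lintegral_map hinner (by fun_prop),
    withDensity_apply _ hB]
  have h1 : ∀ z, ∫⁻ y, B.indicator (1 : ℝ → ℝ≥0∞) (ε * z + y)
      ∂(gaussianReal 0 (Real.toNNReal (1 - v * ε ^ 2)))
      = ∫⁻ x in B, ENNReal.ofReal (ratioKernel v ε x z) ∂(gaussianReal 0 1) := by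
    intro z
    rw [← withDensity_apply _ hB, ← gaussianReal_eq_withDensity_ratioKernel h,
      ← lintegral_indicator_one hB]
    have h2 := gaussianReal_map_const_add (μ := 0) (v := Real.toNNReal (1 - v * ε ^ 2)) (ε * z)
    rw [zero_add] at h2
    rw [← h2, lintegral_map hind (by fun_prop)]
  simp_rw [h1]
  rw [lintegral_lintegral_swap hm.aemeasurable]
  refine lintegral_congr fun x => ?_
  rw [gaussianRatio, ofReal_integral_eq_lintegral_ofReal (integrable_ratioKernel h x)
    (ae_of_all _ fun z => ratioKernel_nonneg _ _ _ _)]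

lemma gaussianReal_map_standardize (μ : ℝ) {σ : ℝ} (hσ : 0 < σ) :
    (gaussianReal μ (Real.toNNReal (σ ^ 2))).map (fun y => (y - μ) / σ) = gaussianReal 0 1 := by
  have : (fun y : ℝ => (y - μ) / σ) = (fun y => y / σ) ∘ fun y => y - μ := rfl
  rw [this, ← Measure.map_map (by fun_prop) (by fun_prop), gaussianReal_map_sub_const,
    gaussianReal_map_div_const]
  congr 1
  · simp
  · ext
    simp [max_eq_left (sq_nonneg σ), hσ.ne']

lemma gaussianReal_map_affine (μ : ℝ) (σ : ℝ) :
    (gaussianReal 0 1).map (fun x => σ * x + μ) = gaussianReal μ (Real.toNNReal (σ ^ 2)) := by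
  have : (fun x : ℝ => σ * x + μ) = (fun y => y + μ) ∘ fun x => σ * x := rfl
  rw [this, ← Measure.map_map (by fun_prop) (by fun_prop), gaussianReal_map_const_mul,
    gaussianReal_map_add_const]
  congr 1
  · simp
  · ext
    simp [sq_nonneg]

/-- Relative entropy is invariant under standardization. -/
lemma klDiv_map_standardize (Q : Measure ℝ) [IsProbabilityMeasure Q] (μ : ℝ) {σ : ℝ} (hσ : 0 < σ) :
    klDiv (Q.map fun y => (y - μ) / σ) (gaussianReal 0 1)
      = klDiv Q (gaussianReal μ (Real.toNNReal (σ ^ 2))) := by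
  have hg : Measurable fun y : ℝ => (y - μ) / σ := by fun_prop
  have hh : Measurable fun x : ℝ => σ * x + μ := by fun_prop
  have : IsProbabilityMeasure (Q.map fun y => (y - μ) / σ) :=
    Measure.isProbabilityMeasure_map hg.aemeasurable
  -- Data processing is applied to the standardization and to its inverse.
  refine le_antisymm ?_ ?_
  · have := klDiv_map_le Q (gaussianReal μ (Real.toNNReal (σ ^ 2))) hg
    rwa [gaussianReal_map_standardize μ hσ] at this
  · have h1 := klDiv_map_le (Q.map fun y => (y - μ) / σ) (gaussianReal 0 1) hh
    rw [gaussianReal_map_affine, Measure.map_map hh hg] at h1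
    have : (fun x => σ * x + μ) ∘ (fun y => (y - μ) / σ) = id := by
      funext y
      simp only [Function.comp, id]
      field_simp
      ring
    rwa [this, Measure.map_id] at h1

lemma withDensity_map_affine {ρ : ℝ → ℝ} (hρ : Measurable ρ) (μ : ℝ) {σ : ℝ} (hσ : 0 < σ) :
    ((gaussianReal 0 1).withDensity fun x => ENNReal.ofReal (ρ x)).map (fun x => σ * x + μ)
      = (gaussianReal μ (Real.toNNReal (σ ^ 2))).withDensity
        fun y => ENNReal.ofReal (ρ ((y - μ) / σ)) := by
  have hg : Measurable fun y : ℝ => (y - μ) / σ := by fun_prop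
  have hh : Measurable fun x : ℝ => σ * x + μ := by fun_prop
  ext B hB
  rw [Measure.map_apply hh hB, withDensity_apply _ (hh hB), withDensity_apply _ hB,
    ← gaussianReal_map_affine, setLIntegral_map hB (by fun_prop) hh]
  refine lintegral_congr fun x => ?_
  congr 2
  field_simp
  ring

/-- Differential entropy of a law given by its density ratio to a Gaussian law of the same mean
and variance. -/
lemma differentialEntropy_withDensity {ρ : ℝ → ℝ} (hρ : Measurable ρ) (hρ0 : ∀ x, 0 < ρ x) (μ : ℝ)
    {σ : ℝ} (hσ : 0 < σ)
    (hsq : Integrable (fun x => ρ x * (1 + x ^ 2)) (gaussianReal 0 1))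
    (hlog : Integrable (fun x => ρ x * Real.log (ρ x)) (gaussianReal 0 1))
    (h1 : ∫ x, ρ x ∂(gaussianReal 0 1) = 1)
    (h2 : ∫ x, ρ x * (1 + x ^ 2) ∂(gaussianReal 0 1) = 2) :
    HasDifferentialEntropy ((gaussianReal μ (Real.toNNReal (σ ^ 2))).withDensity
        fun y => ENNReal.ofReal (ρ ((y - μ) / σ))) ∧
      differentialEntropy ((gaussianReal μ (Real.toNNReal (σ ^ 2))).withDensity
        fun y => ENNReal.ofReal (ρ ((y - μ) / σ)))
        = 1 / 2 * Real.log (2 * Real.pi * Real.exp 1 * σ ^ 2)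
          - ∫ x, ρ x * Real.log (ρ x) ∂(gaussianReal 0 1) := by
  set w := Real.toNNReal (σ ^ 2) with hw
  have hw0 : w ≠ 0 := by
    rw [hw]; simpa using hσ.ne'
  have hwσ : (w : ℝ) = σ ^ 2 := Real.coe_toNNReal _ (sq_nonneg σ)
  set g : ℝ → ℝ := fun y => (y - μ) / σ with hg
  have hgm : Measurable g := by fun_prop
  set p : ℝ → ℝ := fun y => gaussianPDFReal μ w y * ρ (g y) with hp
  have hpdf0 : ∀ y, 0 < gaussianPDFReal μ w y := fun y => gaussianPDFReal_pos μ w y hw0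
  set Q := (gaussianReal μ w).withDensity fun y => ENNReal.ofReal (ρ (g y)) with hQ
  have hQv : Q = volume.withDensity fun y => ENNReal.ofReal (p y) := by
    have hm : Measurable fun y => ENNReal.ofReal (ρ (g y)) := (hρ.comp hgm).ennreal_ofReal
    rw [hQ, gaussianReal_of_var_ne_zero μ hw0,
      ← withDensity_mul _ (measurable_gaussianPDF μ w) hm]
    congr 1
    funext y
    simp only [Pi.mul_apply, gaussianPDF, hp]
    rw [ENNReal.ofReal_mul (hpdf0 y).le]
  have hpm : Measurable p := (measurable_gaussianPDFReal μ w).mul (hρ.comp hgm)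
  have hdens : lebesgueDensity Q =ᵐ[volume] p := by
    filter_upwards [Measure.rnDeriv_withDensity volume hpm.ennreal_ofReal] with y hy
    rw [lebesgueDensity, hQv, hy, ENNReal.toReal_ofReal (mul_pos (hpdf0 y) (hρ0 _)).le]
  -- log p splits into log ρ − A − x²/2 in the standardized variable x. Total mass 1 and unit second
  -- moment turn the last two terms into −A − 1/2 = −½ log(2πeσ²).
  set A : ℝ := Real.log (2 * Real.pi * σ ^ 2) / 2 with hA
  set F : ℝ → ℝ := fun x => ρ x * Real.log (ρ x) - A * ρ x - ρ x * x ^ 2 / 2 with hF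
  have hFm : Measurable F := by fun_prop
  have hlogp : ∀ y, p y * Real.log (p y) = gaussianPDFReal μ w y • F (g y) := by
    intro y
    have e1 : Real.log (p y) = Real.log (ρ (g y)) - A - (g y) ^ 2 / 2 := by
      simp only [hp]
      rw [Real.log_mul (hpdf0 y).ne' (hρ0 _).ne', gaussianPDFReal, hwσ,
        Real.log_mul (by positivity) (Real.exp_ne_zero _), Real.log_exp, Real.log_inv,
        Real.log_sqrt (by positivity)]
      simp only [hg, hA]
      field_simp
      ring
    rw [e1]
    simp only [hp, hF, smul_eq_mul]
    ring
  have hρi : Integrable ρ (gaussianReal 0 1) := by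
    refine hsq.mono' hρ.aestronglyMeasurable (ae_of_all _ fun x => ?_)
    rw [Real.norm_of_nonneg (hρ0 x).le]
    have := mul_nonneg (hρ0 x).le (sq_nonneg x)
    linarith
  have hρx : Integrable (fun x => ρ x * x ^ 2) (gaussianReal 0 1) := by
    refine (hsq.sub hρi).congr (ae_of_all _ fun x => ?_)
    simp
    ring
  have hρxv : ∫ x, ρ x * x ^ 2 ∂(gaussianReal 0 1) = 1 := by
    have : ∫ x, ρ x * x ^ 2 ∂(gaussianReal 0 1)
        = ∫ x, (ρ x * (1 + x ^ 2) - ρ x) ∂(gaussianReal 0 1) :=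
      integral_congr_ae (ae_of_all _ fun x => by simp only; ring)
    rw [this, integral_sub hsq hρi, h1, h2]
    norm_num
  have hF1 : Integrable (fun x => ρ x * Real.log (ρ x) - A * ρ x) (gaussianReal 0 1) :=
    hlog.sub (hρi.const_mul A)
  have hFi : Integrable F (gaussianReal 0 1) := hF1.sub (hρx.div_const 2)
  have hFv : ∫ x, F x ∂(gaussianReal 0 1)
      = ∫ x, ρ x * Real.log (ρ x) ∂(gaussianReal 0 1) - A - 1 / 2 := by
    simp only [hF]
    rw [integral_sub hF1 (hρx.div_const 2), integral_sub hlog (hρi.const_mul A),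
      integral_const_mul, integral_div, h1, hρxv, mul_one]
  have hmap := gaussianReal_map_standardize μ hσ
  have hFg : Integrable (fun y => F (g y)) (gaussianReal μ w) := by
    rw [← hmap] at hFi
    exact hFi.comp_measurable hgm
  refine ⟨⟨?_, ?_⟩, ?_⟩
  · rw [hQv]
    exact withDensity_absolutelyContinuous _ _
  · have : Integrable (fun y => p y * Real.log (p y)) volume := by
      simp_rw [hlogp]
      exact (integrable_gaussianReal_iff μ hw0).mp hFg
    refine this.congr ?_
    filter_upwards [hdens] with y hy
    rw [hy]
  · have e1 : ∫ y, lebesgueDensity Q y * Real.log (lebesgueDensity Q y)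
        = ∫ y, p y * Real.log (p y) := by
      refine integral_congr_ae ?_
      filter_upwards [hdens] with y hy
      rw [hy]
    rw [differentialEntropy, e1]
    simp_rw [hlogp]
    rw [← integral_gaussianReal_eq_integral_smul hw0]
    have e2 : ∫ y, F (g y) ∂(gaussianReal μ w) = ∫ x, F x ∂(gaussianReal 0 1) := by
      rw [← hmap, integral_map hgm.aemeasurable hFm.aestronglyMeasurable]
    rw [e2, hFv]
    have e3 : Real.log (2 * Real.pi * Real.exp 1 * σ ^ 2) = Real.log (2 * Real.pi * σ ^ 2) + 1 := by
      rw [show 2 * Real.pi * Real.exp 1 * σ ^ 2 = (2 * Real.pi * σ ^ 2) * Real.exp 1 by ring,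
        Real.log_mul (by positivity) (Real.exp_ne_zero _), Real.log_exp]
    rw [e3, hA]
    ring

end Laws

/-! ### Low-order modified moments in terms of cumulants. -/

lemma modifiedMoment_of_three_le (κ : ℕ → ℝ) {k : ℕ} (hk : 3 ≤ k) :
    modifiedMoment κ k = κ k + ∑ j ∈ Finset.Icc 3 (k - 3),
      ((k - 1).choose j : ℝ) * modifiedMoment κ j * κ (k - j) := by
  rw [modifiedMoment, if_neg (by omega), if_neg (by omega),
    Finset.sum_attach (Finset.Icc 3 (k - 3)) fun j =>
      ((k - 1).choose j : ℝ) * modifiedMoment κ j * κ (k - j)]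

lemma modifiedMoment_three_to_six (κ : ℕ → ℝ) :
    modifiedMoment κ 3 = κ 3 ∧ modifiedMoment κ 4 = κ 4 ∧ modifiedMoment κ 5 = κ 5
      ∧ modifiedMoment κ 6 = κ 6 + 10 * κ 3 ^ 2 := by
  have h3 : modifiedMoment κ 3 = κ 3 := by
    rw [modifiedMoment_of_three_le κ (by norm_num)]; simp
  refine ⟨h3, by rw [modifiedMoment_of_three_le κ (by norm_num)]; simp,
    by rw [modifiedMoment_of_three_le κ (by norm_num)]; simp, ?_⟩
  rw [modifiedMoment_of_three_le κ (by norm_num)]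
  simp [h3, show Nat.choose 5 3 = 10 from rfl]
  ring

/-- Substituting m₆ = κ₆ + 10κ₃², the κ₃²κ₆ terms cancel (20/1440 = 1/72), and the coefficient of
κ₃⁴ becomes 100/1440 − 10/72 + 31/144 = 7/48. -/
lemma expansionInModifiedMoments_eq (κ : ℕ → ℝ) (σ : ℝ) :
    expansionInModifiedMoments (modifiedMoment κ) σ = expansionInCumulants κ σ := by
  obtain ⟨h3, h4, h5, h6⟩ := modifiedMoment_three_to_six κ
  rw [expansionInModifiedMoments, expansionInCumulants, h3, h4, h5, h6]
  ring

/-! ### The noisy variable Z + N at a fixed noise level. -/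

section Noise

variable {Ω : Type*} [MeasurableSpace Ω] {P : Measure Ω} {Z N : Ω → ℝ} {s : ℝ}

/-- The law of the centered variable `Z - E Z`. -/
noncomputable def centeredLaw (Z : Ω → ℝ) (P : Measure Ω) : Measure ℝ :=
  (P.map Z).map fun z => z + -∫ ω, Z ω ∂P

lemma aemeasurable_of_forall_memLp (hZ : ∀ n : ℕ, MemLp Z (n : ℝ≥0∞) P) : AEMeasurable Z P :=
  (hZ 0).aestronglyMeasurable.aemeasurable

lemma memLp_id_map (hZ : ∀ n : ℕ, MemLp Z (n : ℝ≥0∞) P) (n : ℕ) :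
    MemLp id (n : ℝ≥0∞) (P.map Z) :=
  (memLp_map_measure_iff aestronglyMeasurable_id (aemeasurable_of_forall_memLp hZ)).mpr (hZ n)

lemma memLp_two_of_hasLaw_gaussianReal {m : ℝ} {w : ℝ≥0} (hN : HasLaw N (gaussianReal m w) P) :
    MemLp N 2 P := by
  have h := memLp_id_gaussianReal (μ := m) (v := w) 2
  rw [← hN.map_eq, memLp_map_measure_iff aestronglyMeasurable_id hN.aemeasurable] at h
  exact_mod_cast h

lemma centeredLaw_eq_map (hZ : ∀ n : ℕ, MemLp Z (n : ℝ≥0∞) P) :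
    centeredLaw Z P = P.map fun ω => Z ω + -∫ ω, Z ω ∂P := by
  rw [centeredLaw, AEMeasurable.map_map_of_aemeasurable (by fun_prop)
    (aemeasurable_of_forall_memLp hZ)]
  rfl

lemma variance_add_gaussian (hZ : ∀ n : ℕ, MemLp Z (n : ℝ≥0∞) P)
    (hN : HasLaw N (gaussianReal 0 (Real.toNNReal (s ^ 2))) P) (hind : IndepFun Z N P) :
    variance (Z + N) P = variance Z P + s ^ 2 := by
  rw [hind.variance_add (by exact_mod_cast hZ 2) (memLp_two_of_hasLaw_gaussianReal hN),
    hN.variance_eq, variance_id_gaussianReal, Real.coe_toNNReal _ (sq_nonneg s)]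

lemma integral_sq_centeredLaw (hZ : ∀ n : ℕ, MemLp Z (n : ℝ≥0∞) P) :
    ∫ z, z ^ 2 ∂(centeredLaw Z P) = Real.sqrt (variance Z P) ^ 2 := by
  have hm := aemeasurable_of_forall_memLp hZ
  rw [Real.sq_sqrt (variance_nonneg Z P), centeredLaw_eq_map hZ,
    integral_map (by fun_prop) (by fun_prop), variance_eq_integral hm]
  simp [sub_eq_add_neg]

lemma stdDev_add_gaussian (hZ : ∀ n : ℕ, MemLp Z (n : ℝ≥0∞) P)
    (hN : HasLaw N (gaussianReal 0 (Real.toNNReal (s ^ 2))) P) (hind : IndepFun Z N P) :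
    stdDev (Z + N) P = Real.sqrt (variance Z P + s ^ 2) := by
  rw [stdDev, variance_add_gaussian hZ hN hind]

variable [IsProbabilityMeasure P]

lemma isProbabilityMeasure_centeredLaw (hZ : ∀ n : ℕ, MemLp Z (n : ℝ≥0∞) P) :
    IsProbabilityMeasure (centeredLaw Z P) := by
  have : IsProbabilityMeasure (P.map Z) :=
    Measure.isProbabilityMeasure_map (aemeasurable_of_forall_memLp hZ)
  exact Measure.isProbabilityMeasure_map (by fun_prop)

lemma memLp_id_centeredLaw (hZ : ∀ n : ℕ, MemLp Z (n : ℝ≥0∞) P) (n : ℕ) :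
    MemLp id (n : ℝ≥0∞) (centeredLaw Z P) := by
  have : IsProbabilityMeasure (P.map Z) :=
    Measure.isProbabilityMeasure_map (aemeasurable_of_forall_memLp hZ)
  rw [centeredLaw, memLp_map_measure_iff aestronglyMeasurable_id (by fun_prop)]
  exact (memLp_id_map hZ n).add (memLp_const _)

lemma integral_centeredLaw (hZ : ∀ n : ℕ, MemLp Z (n : ℝ≥0∞) P) :
    ∫ z, z ∂(centeredLaw Z P) = 0 := by
  have hm := aemeasurable_of_forall_memLp hZ
  have hi : Integrable Z P := (hZ 1).integrable (by simp)
  rw [centeredLaw_eq_map hZ, integral_map (by fun_prop) (by fun_prop),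
    integral_add hi (integrable_const _)]
  simp

lemma integral_add_gaussian (hZ : ∀ n : ℕ, MemLp Z (n : ℝ≥0∞) P)
    (hN : HasLaw N (gaussianReal 0 (Real.toNNReal (s ^ 2))) P) :
    ∫ ω, (Z + N) ω ∂P = ∫ ω, Z ω ∂P := by
  have hi : Integrable Z P := (hZ 1).integrable (by simp)
  have hiN : Integrable N P := (memLp_two_of_hasLaw_gaussianReal hN).integrable (by norm_num)
  have h0 : ∫ ω, N ω ∂P = 0 := by rw [hN.integral_eq, integral_id_gaussianReal]
  simp only [Pi.add_apply]
  rw [integral_add hi hiN, h0, add_zero]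

lemma standardize_add_gaussian (hZ : ∀ n : ℕ, MemLp Z (n : ℝ≥0∞) P)
    (hN : HasLaw N (gaussianReal 0 (Real.toNNReal (s ^ 2))) P) (ω : Ω) :
    standardize (Z + N) P ω = (Z ω + N ω - ∫ ω, Z ω ∂P) / stdDev (Z + N) P := by
  rw [standardize, integral_add_gaussian hZ hN, Pi.add_apply]

lemma stdDev_add_gaussian_pos (hZ : ∀ n : ℕ, MemLp Z (n : ℝ≥0∞) P) (hs : 0 < s)
    (hN : HasLaw N (gaussianReal 0 (Real.toNNReal (s ^ 2))) P) (hind : IndepFun Z N P) :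
    0 < stdDev (Z + N) P := by
  rw [stdDev_add_gaussian hZ hN hind]
  have := variance_nonneg Z P
  positivity

lemma matchedGaussian_add_gaussian (hZ : ∀ n : ℕ, MemLp Z (n : ℝ≥0∞) P)
    (hN : HasLaw N (gaussianReal 0 (Real.toNNReal (s ^ 2))) P) :
    matchedGaussian (Z + N) P
      = gaussianReal (∫ ω, Z ω ∂P) (Real.toNNReal (stdDev (Z + N) P ^ 2)) := by
  rw [matchedGaussian, integral_add_gaussian hZ hN, stdDev, Real.sq_sqrt (variance_nonneg _ _)]

lemma one_sub_sqrt_variance_mul (hZ : ∀ n : ℕ, MemLp Z (n : ℝ≥0∞) P) (hs : 0 < s)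
    (hN : HasLaw N (gaussianReal 0 (Real.toNNReal (s ^ 2))) P) (hind : IndepFun Z N P) :
    1 - Real.sqrt (variance Z P) ^ 2 * (stdDev (Z + N) P)⁻¹ ^ 2
      = (stdDev (Z + N) P)⁻¹ ^ 2 * s ^ 2 := by
  have hσ := stdDev_add_gaussian_pos hZ hs hN hind
  have h : stdDev (Z + N) P ^ 2 = variance Z P + s ^ 2 := by
    rw [stdDev, Real.sq_sqrt (variance_nonneg _ _), variance_add_gaussian hZ hN hind]
  rw [Real.sq_sqrt (variance_nonneg _ _)]
  field_simp
  linarith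

/-- The rescaled noise keeps a positive share s²/σ² of the unit variance. This makes the kernel
available for every s > 0, so the finiteness and entropy identities are not merely asymptotic. -/
lemma sqrt_variance_mul_lt_one (hZ : ∀ n : ℕ, MemLp Z (n : ℝ≥0∞) P) (hs : 0 < s)
    (hN : HasLaw N (gaussianReal 0 (Real.toNNReal (s ^ 2))) P) (hind : IndepFun Z N P) :
    Real.sqrt (variance Z P) ^ 2 * (stdDev (Z + N) P)⁻¹ ^ 2 < 1 := by
  have h := one_sub_sqrt_variance_mul hZ hs hN hind
  have hσ := stdDev_add_gaussian_pos hZ hs hN hind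
  have : 0 < (stdDev (Z + N) P)⁻¹ ^ 2 * s ^ 2 := by positivity
  linarith

/-- The law of the standardized noisy variable, as a density relative to the standard Gaussian. -/
lemma map_standardize_add_gaussian (hZ : ∀ n : ℕ, MemLp Z (n : ℝ≥0∞) P) (hs : 0 < s)
    (hN : HasLaw N (gaussianReal 0 (Real.toNNReal (s ^ 2))) P) (hind : IndepFun Z N P) :
    P.map (standardize (Z + N) P) = (gaussianReal 0 1).withDensity fun x => ENNReal.ofReal
      (gaussianRatio (centeredLaw Z P) (Real.sqrt (variance Z P) ^ 2) (stdDev (Z + N) P)⁻¹ x) := by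
  have := isProbabilityMeasure_centeredLaw hZ
  have hm := aemeasurable_of_forall_memLp hZ
  set ε := (stdDev (Z + N) P)⁻¹ with hε
  set μ := ∫ ω, Z ω ∂P with hμ
  rw [← conv_gaussianReal_eq_withDensity (sqrt_variance_mul_lt_one hZ hs hN hind),
    one_sub_sqrt_variance_mul hZ hs hN hind]
  have hstd : standardize (Z + N) P
      = ((fun z => ε * (z + -μ)) ∘ Z) + ((fun x => ε * x) ∘ N) := by
    funext ω
    rw [standardize_add_gaussian hZ hN, div_eq_mul_inv, ← hε, ← hμ]
    simp only [Pi.add_apply, Function.comp]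
    ring
  have hA : P.map ((fun z => ε * (z + -μ)) ∘ Z) = (centeredLaw Z P).map fun z => ε * z := by
    rw [centeredLaw_eq_map hZ,
      AEMeasurable.map_map_of_aemeasurable (by fun_prop) (by fun_prop)]
    rfl
  have hB : P.map ((fun x => ε * x) ∘ N) = gaussianReal 0 (Real.toNNReal (ε ^ 2 * s ^ 2)) := by
    have h := (gaussianReal_const_mul hN ε).map_eq
    rw [mul_zero] at h
    refine h.trans ?_
    congr 1
    ext
    simp [Real.toNNReal_mul (sq_nonneg ε), max_eq_left (sq_nonneg ε)]
  have hAm : AEMeasurable ((fun z => ε * (z + -μ)) ∘ Z) P := (hm.add_const _).const_mul ε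
  have hBm : AEMeasurable ((fun x => ε * x) ∘ N) P := hN.aemeasurable.const_mul ε
  rw [hstd, IndepFun.map_add_eq_map_conv_map₀ hAm hBm
    (hind.comp (by fun_prop) (by fun_prop)), hA, hB]

lemma map_add_gaussian_eq_withDensity (hZ : ∀ n : ℕ, MemLp Z (n : ℝ≥0∞) P) (hs : 0 < s)
    (hN : HasLaw N (gaussianReal 0 (Real.toNNReal (s ^ 2))) P) (hind : IndepFun Z N P) :
    P.map (Z + N) = (gaussianReal (∫ ω, Z ω ∂P) (Real.toNNReal (stdDev (Z + N) P ^ 2))).withDensity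
      fun y => ENNReal.ofReal (gaussianRatio (centeredLaw Z P) (Real.sqrt (variance Z P) ^ 2)
        (stdDev (Z + N) P)⁻¹ ((y - ∫ ω, Z ω ∂P) / stdDev (Z + N) P)) := by
  have := isProbabilityMeasure_centeredLaw hZ
  have hm := aemeasurable_of_forall_memLp hZ
  have hσ := stdDev_add_gaussian_pos hZ hs hN hind
  have hY : AEMeasurable (Z + N) P := hm.add hN.aemeasurable
  have hstdm : AEMeasurable (standardize (Z + N) P) P := (hY.sub_const _).div_const _
  rw [← withDensity_map_affine (measurable_gaussianRatio _ _ _) _ hσ,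
    ← map_standardize_add_gaussian hZ hs hN hind,
    AEMeasurable.map_map_of_aemeasurable (by fun_prop) hstdm]
  congr 1
  funext ω
  rw [Function.comp_apply, standardize_add_gaussian hZ hN, Pi.add_apply]
  field_simp
  ring

/-- The divergence of the noisy variable from Gaussianity, through its standardized density. -/
lemma nonGaussianity_add_gaussian (hZ : ∀ n : ℕ, MemLp Z (n : ℝ≥0∞) P) (hs : 0 < s)
    (hN : HasLaw N (gaussianReal 0 (Real.toNNReal (s ^ 2))) P) (hind : IndepFun Z N P) :
    nonGaussianity (Z + N) P ≠ ∞ ∧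
    nonGaussianity (Z + N) P = klDiv (P.map (standardize (Z + N) P)) (gaussianReal 0 1) ∧
    (nonGaussianity (Z + N) P).toReal
      = ∫ x, gaussianRatio (centeredLaw Z P) (Real.sqrt (variance Z P) ^ 2)
          (stdDev (Z + N) P)⁻¹ x * Real.log (gaussianRatio (centeredLaw Z P)
          (Real.sqrt (variance Z P) ^ 2) (stdDev (Z + N) P)⁻¹ x) ∂(gaussianReal 0 1) := by
  have := isProbabilityMeasure_centeredLaw hZ
  have hm := aemeasurable_of_forall_memLp hZ
  have hσ := stdDev_add_gaussian_pos hZ hs hN hind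
  have hY : AEMeasurable (Z + N) P := hm.add hN.aemeasurable
  have hstdm : AEMeasurable (standardize (Z + N) P) P := (hY.sub_const _).div_const _
  have hprobY : IsProbabilityMeasure (P.map (Z + N)) := Measure.isProbabilityMeasure_map hY
  have hprob : IsProbabilityMeasure (P.map (standardize (Z + N) P)) :=
    Measure.isProbabilityMeasure_map hstdm
  have h1 := sqrt_variance_mul_lt_one hZ hs hN hind
  have hν2 : MemLp id 2 (centeredLaw Z P) := by exact_mod_cast memLp_id_centeredLaw hZ 2
  have hkl : nonGaussianity (Z + N) P
      = klDiv (P.map (standardize (Z + N) P)) (gaussianReal 0 1) := by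
    rw [nonGaussianity, matchedGaussian_add_gaussian hZ hN, ← klDiv_map_standardize _ _ hσ,
      AEMeasurable.map_map_of_aemeasurable (by fun_prop) hY]
    congr 2
    funext ω
    rw [Function.comp_apply, standardize_add_gaussian hZ hN, Pi.add_apply]
  have hlaw := map_standardize_add_gaussian hZ hs hN hind
  rw [hlaw] at hprob
  have hfin := klDiv_withDensity_ofReal (measurable_gaussianRatio _ _ _)
    (fun x => (gaussianRatio_pos hν2 (integral_centeredLaw hZ) (integral_sq_centeredLaw hZ) h1 x).le)
    (integrable_gaussianRatio_mul_log hν2 (integral_centeredLaw hZ) (integral_sq_centeredLaw hZ) h1)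
  rw [← hlaw, ← hkl] at hfin
  exact ⟨hfin.1, hkl, hfin.2⟩

lemma integral_gaussianRatio {ν : Measure ℝ} [IsProbabilityMeasure ν] {v ε : ℝ}
    (hν : MemLp id 2 ν) (h : v * ε ^ 2 < 1) :
    ∫ x, gaussianRatio ν v ε x ∂(gaussianReal 0 1) = 1 := by
  have hi : Integrable (fun p : ℝ × ℝ => ratioKernel v ε p.2 p.1) (ν.prod (gaussianReal 0 1)) := by
    refine (integrable_prod_ratioKernel_mul_one_add_sq hν h).mono'
      (continuous_ratioKernel v ε).aestronglyMeasurable (ae_of_all _ fun p => ?_)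
    rw [Real.norm_of_nonneg (ratioKernel_nonneg _ _ _ _)]
    have := mul_nonneg (ratioKernel_nonneg v ε p.2 p.1) (sq_nonneg p.2)
    linarith
  simp only [gaussianRatio]
  rw [← integral_integral_swap hi]
  have : ∀ z, ∫ x, ratioKernel v ε x z ∂(gaussianReal 0 1) = 1 := fun z => by
    simpa using integral_ratioKernel_mul h z fun _ => 1
  simp [this]

/-- Mass 1 plus second moment 1: the signal part vε² and the noise part 1 − vε² add up to the
standardized variance. -/
lemma integral_gaussianRatio_mul_one_add_sq {ν : Measure ℝ} [IsProbabilityMeasure ν] {v ε : ℝ}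
    (hν : MemLp id 2 ν) (hv : ∫ z, z ^ 2 ∂ν = v) (h : v * ε ^ 2 < 1) :
    ∫ x, gaussianRatio ν v ε x * (1 + x ^ 2) ∂(gaussianReal 0 1) = 2 := by
  have hi := integrable_prod_ratioKernel_mul_one_add_sq hν h
  simp only [gaussianRatio, ← integral_mul_const]
  rw [← integral_integral_swap hi]
  simp only [integral_ratioKernel_mul_one_add_sq h]
  have hsq : Integrable (fun z : ℝ => z ^ 2) ν := hν.integrable_sq
  rw [integral_add (integrable_const _) (hsq.const_mul _), integral_const_mul]
  simp only [hv, integral_const, probReal_univ, smul_eq_mul]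
  ring

/-- Differential entropies of the noisy variable and of the matched Gaussian. -/
lemma differentialEntropy_add_gaussian (hZ : ∀ n : ℕ, MemLp Z (n : ℝ≥0∞) P) (hs : 0 < s)
    (hN : HasLaw N (gaussianReal 0 (Real.toNNReal (s ^ 2))) P) (hind : IndepFun Z N P) :
    HasDifferentialEntropy (P.map (Z + N)) ∧
    HasDifferentialEntropy (matchedGaussian (Z + N) P) ∧
    differentialEntropy (P.map (Z + N))
      = 1 / 2 * Real.log (2 * Real.pi * Real.exp 1 * stdDev (Z + N) P ^ 2)
        - (nonGaussianity (Z + N) P).toReal ∧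
    differentialEntropy (matchedGaussian (Z + N) P)
      = 1 / 2 * Real.log (2 * Real.pi * Real.exp 1 * stdDev (Z + N) P ^ 2) := by
  have := isProbabilityMeasure_centeredLaw hZ
  have hσ := stdDev_add_gaussian_pos hZ hs hN hind
  have h1 := sqrt_variance_mul_lt_one hZ hs hN hind
  have hν2 : MemLp id 2 (centeredLaw Z P) := by exact_mod_cast memLp_id_centeredLaw hZ 2
  have hm := integral_centeredLaw hZ
  have hv := integral_sq_centeredLaw hZ
  have hY := differentialEntropy_withDensity (measurable_gaussianRatio _ _ _)
    (gaussianRatio_pos hν2 hm hv h1) (∫ ω, Z ω ∂P) hσ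
    (integrable_gaussianRatio_mul_one_add_sq hν2 h1)
    (integrable_gaussianRatio_mul_log hν2 hm hv h1) (integral_gaussianRatio hν2 h1)
    (integral_gaussianRatio_mul_one_add_sq hν2 hv h1)
  rw [← map_add_gaussian_eq_withDensity hZ hs hN hind,
    ← (nonGaussianity_add_gaussian hZ hs hN hind).2.2] at hY
  have hsq : Integrable (fun x : ℝ => 1 + x ^ 2) (gaussianReal 0 1) :=
    (integrable_const 1).add (integrable_sq_gaussianReal 0 1)
  -- The constant ratio 1 describes the matched Gaussian itself, and its ρ log ρ term is zero.
  have hG := differentialEntropy_withDensity (ρ := fun _ => 1) measurable_const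
    (fun _ => one_pos) (∫ ω, Z ω ∂P) hσ (by simpa using hsq) (by simp) (by simp) (by
      simp only [one_mul]
      rw [integral_add (integrable_const 1) (integrable_sq_gaussianReal 0 1),
        integral_sq_gaussianReal]
      norm_num)
  simp only [ENNReal.ofReal_one, Real.log_one, mul_zero, integral_zero, sub_zero] at hG
  rw [show (fun _ : ℝ => (1 : ℝ≥0∞)) = 1 from rfl, withDensity_one,
    ← matchedGaussian_add_gaussian hZ hN] at hG
  exact ⟨hY.1, hG.1, hY.2, hG.2⟩

end Noise

/-! ### The limit of large noise. -/

section Expansion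

open scoped Topology

variable {Ω : Type*} [MeasurableSpace Ω] {P : Measure Ω} [IsProbabilityMeasure P]
  {Z : Ω → ℝ} {N : ℝ → Ω → ℝ}

/-- Since σ ≥ s, the parameter ε = 1/σ tends to 0 from the right, so the expansion in ε can be
composed with it. -/
lemma tendsto_inv_stdDev_add_gaussian (hZ : ∀ n : ℕ, MemLp Z (n : ℝ≥0∞) P)
    (hN : ∀ s : ℝ, 0 < s → HasLaw (N s) (gaussianReal 0 (Real.toNNReal (s ^ 2))) P)
    (hindep : ∀ s : ℝ, 0 < s → IndepFun Z (N s) P) :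
    Tendsto (fun s => (stdDev (Z + N s) P)⁻¹) atTop (𝓝[>] 0) := by
  refine tendsto_inv_atTop_nhdsGT_zero.comp (tendsto_atTop_mono' _ ?_ tendsto_id)
  filter_upwards [eventually_gt_atTop 0] with s hs
  rw [stdDev_add_gaussian hZ (hN s hs) (hindep s hs)]
  exact Real.le_sqrt_of_sq_le (le_add_of_nonneg_left (variance_nonneg Z P))

/-- The expansion of the divergence from Gaussianity as the noise level grows. -/
theorem isBigO_nonGaussianity_add_gaussian_sub (hZ : ∀ n : ℕ, MemLp Z (n : ℝ≥0∞) P)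
    (hN : ∀ s : ℝ, 0 < s → HasLaw (N s) (gaussianReal 0 (Real.toNNReal (s ^ 2))) P)
    (hindep : ∀ s : ℝ, 0 < s → IndepFun Z (N s) P) :
    (fun s : ℝ => (nonGaussianity (Z + N s) P).toReal
        - expansionInModifiedMoments (modifiedMoment (cumulant Z P)) (stdDev (Z + N s) P))
      =O[atTop] fun s : ℝ => 1 / stdDev (Z + N s) P ^ 14 := by
  have := isProbabilityMeasure_centeredLaw hZ
  have hν := memLp_id_centeredLaw hZ
  have hmean := integral_centeredLaw hZ
  have hvar := integral_sq_centeredLaw hZ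
  have hc : 0 ≤ Real.sqrt (variance Z P) := Real.sqrt_nonneg _
  have hm : ∀ n, deconvolvedMoment (centeredLaw Z P) (Real.sqrt (variance Z P)) n
      = (modifiedMoment (cumulant Z P) n : ℂ) := fun n => by
    rw [deconvolvedMoment_eq_ofReal_re hν hc, modifiedMoment_cumulant_eq
      (aemeasurable_of_forall_memLp hZ) (memLp_id_map hZ) hc hν rfl hmean hvar]
  have h := (isBigO_integral_gaussianRatio_mul_log_sub hν hmean hvar hc hm
    (by rw [modifiedMoment]; simp) (by rw [modifiedMoment]; simp)
    (by rw [modifiedMoment]; simp)).comp_tendsto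
      (tendsto_inv_stdDev_add_gaussian hZ hN hindep)
  refine h.congr' ?_ (Eventually.of_forall fun s => by simp)
  filter_upwards [eventually_gt_atTop 0] with s hs
  rw [Function.comp_apply, inv_inv,
    (nonGaussianity_add_gaussian hZ hs (hN s hs) (hindep s hs)).2.2]

end Expansion

theorem mainTheorem4 {Ω : Type*} [MeasurableSpace Ω] (P : Measure Ω) [IsProbabilityMeasure P]
    (Z : Ω → ℝ) (N : ℝ → Ω → ℝ)
    (hZ : ∀ n : ℕ, MemLp Z (n : ℝ≥0∞) P)
    -- `N s` is the Gaussian noise with standard deviation `s`; the observation is `Y = Z + N s`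
    (hN : ∀ s : ℝ, 0 < s → HasLaw (N s) (gaussianReal 0 (Real.toNNReal (s ^ 2))) P)
    (hindep : ∀ s : ℝ, 0 < s → IndepFun Z (N s) P) :
    -- the cumulants of order at least three of `Y` are those of `Z`
    (∀ s : ℝ, 0 < s → ∀ k : ℕ, 3 ≤ k → cumulant (Z + N s) P k = cumulant Z P k) ∧
    -- `D(Y‖Y*)` is finite and equals `D(f‖g)`, with `f` the density of the standardized `Y`
    -- and `g` the standard Gaussian density
    (∀ s : ℝ, 0 < s → nonGaussianity (Z + N s) P ≠ ∞ ∧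
      nonGaussianity (Z + N s) P
        = klDiv (P.map (standardize (Z + N s) P)) (gaussianReal 0 1)) ∧
    -- expansion of the divergence in modified moments
    ((fun s : ℝ => (nonGaussianity (Z + N s) P).toReal
        - expansionInModifiedMoments (modifiedMoment (cumulant Z P)) (stdDev (Z + N s) P))
      =O[atTop] fun s : ℝ => 1 / stdDev (Z + N s) P ^ 14) ∧
    -- expansion of the divergence in cumulants
    ((fun s : ℝ => (nonGaussianity (Z + N s) P).toReal
        - expansionInCumulants (cumulant Z P) (stdDev (Z + N s) P))
      =O[atTop] fun s : ℝ => 1 / stdDev (Z + N s) P ^ 14) ∧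
    -- the divergence as a difference `h(Y*) - h(Y)` of differential entropies
    (∀ s : ℝ, 0 < s →
      HasDifferentialEntropy (P.map (Z + N s)) ∧
      HasDifferentialEntropy (matchedGaussian (Z + N s) P) ∧
      (nonGaussianity (Z + N s) P).toReal
        = differentialEntropy (matchedGaussian (Z + N s) P)
          - differentialEntropy (P.map (Z + N s)) ∧
      differentialEntropy (matchedGaussian (Z + N s) P)
        = 1 / 2 * Real.log (2 * Real.pi * Real.exp 1 * stdDev (Z + N s) P ^ 2)) ∧
    -- expansion of the differential entropy `h(Y)`
    ((fun s : ℝ => differentialEntropy (P.map (Z + N s))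
        - (1 / 2 * Real.log (2 * Real.pi * Real.exp 1 * stdDev (Z + N s) P ^ 2)
          - expansionInCumulants (cumulant Z P) (stdDev (Z + N s) P)))
      =O[atTop] fun s : ℝ => 1 / stdDev (Z + N s) P ^ 14) := by
  have hexp := isBigO_nonGaussianity_add_gaussian_sub hZ hN hindep
  have hcum := hexp
  simp only [expansionInModifiedMoments_eq] at hcum
  refine ⟨fun s hs k hk => cumulant_add_gaussian (aemeasurable_of_forall_memLp hZ)
    (memLp_id_map hZ) (hN s hs) (hindep s hs) hk, fun s hs => ?_, hexp, hcum, fun s hs => ?_, ?_⟩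
  · have h := nonGaussianity_add_gaussian hZ hs (hN s hs) (hindep s hs)
    exact ⟨h.1, h.2.1⟩
  · obtain ⟨h1, h2, h3, h4⟩ := differentialEntropy_add_gaussian hZ hs (hN s hs) (hindep s hs)
    exact ⟨h1, h2, by rw [h3, h4]; ring, h4⟩
  -- By h(Y) = ½ log(2πeσ²) − D, the entropy remainder is the negative of the divergence remainder,
  -- for every s > 0.
  · refine hcum.neg_left.congr' ?_ EventuallyEq.rfl
    filter_upwards [eventually_gt_atTop 0] with s hs
    rw [(differentialEntropy_add_gaussian hZ hs (hN s hs) (hindep s hs)).2.2.1]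
    ring
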